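/- **Theorem 2.10.** Let $k$ be a commutative ring and let $H$ be a weak Hopf algebra over $k$ whose antipode $S$ is bijective: $H$ is a $k$-algebra and a $k$-coalgebra with $\Delta(gh)=\Delta(g)\Delta(h)$, $\Delta^2(1)=1_{(1)}\otimes 1_{(2)}1_{(1')}\otimes 1_{(2')}=1_{(1)}\otimes 1_{(1')}1_{(2)}\otimes 1_{(2')}$, $\varepsilon(hgl)=\varepsilon(hg_{(1)})\varepsilon(g_{(2)}l)=\varepsilon(hg_{(2)})\varepsilon(g_{(1)}l)$, and $S*\mathrm{id}=\varepsilon_s$, $\mathrm{id}*S=\varepsilon_t$, $S*\mathrm{id}*S=S$ (convolution products), where $$\varepsilon_t(h)=\varepsilon(1_{(1)}h)1_{(2)},\quad \varepsilon_s(h)=1_{(1)}\varepsilon(h1_{(2)}),\quad \overline\varepsilon_t(h)=\varepsilon(h1_{(1)})1_{(2)},\quad \overline\varepsilon_s(h)=\varepsilon(1_{(2)}h)1_{(1)}.$$ Put $H_t=\varepsilon_t(H)$ and $H_s=\varepsilon_s(H)$. For left $H$-modules let $M\otimes_tN=\Delta(1)(M\otimes_k N)$, and for right $H$-modules let $M\otimes_sN=(M\otimes_k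 N)\Delta(1)$. A Yetter-Drinfeld module is a $k$-module $M$ with an $H$-action and a (coassociative, counital) $H$-coaction such that for all $h\in H$, $m\in M$: * left-left (${}^H_H\mathcal{YD}$): $m_{[-1]}\otimes m_{[0]}\in H\otimes_tM$ and $h_{(1)}m_{[-1]}\otimes h_{(2)}m_{[0]}=(h_{(1)}m)_{[-1]}h_{(2)}\otimes(h_{(1)}m)_{[0]}$; * left-right (${}_H\mathcal{YD}^H$): $m_{[0]}\otimes m_{[1]}\in M\otimes_tH$ and $h_{(1)}m_{[0]}\otimes h_{(2)}m_{[1]}=(h_{(2)}m)_{[0]}\otimes(h_{(2)}m)_{[1]}h_{(1)}$; * right-right ($\mathcal{YD}^H_H$): $m_{[0]}\otimes m_{[1]}\in M\otimes_sH$ and $m_{[0]}h_{(1)}\otimes m_{[1]}h_{(2)}=(mh_{(2)})_{[0]}\otimes h_{(1)}(mh_{(2)})_{[1]}$; * right-left (${}^H\mathcal{YD}_H$): $m_{[-1]}\otimes m_{[0]}\in H\otimes_sM$ and $m_{[-1]}h_{(1)}\otimes m_{[0]}h_{(2)}=h_{(2)}(mh_{(1)})_{[-1]}\otimes(mh_{(1)})_{[0]}$.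 Morphisms are the $H$-linear and $H$-colinear maps. Then these four categories are braided monoidal categories, with the associativity constraints and tensor products of morphisms of $k$-modules, the diagonal $H$-action on tensor products, and the following data. * ${}^H_H\mathcal{YD}$: tensor product $\otimes_t$ with coaction $m_{[-1]}n_{[-1]}\otimes m_{[0]}\otimes n_{[0]}$; braiding $1_{(1)}m\otimes1_{(2)}n\mapsto m_{[-1]}n\otimes m_{[0]}$; unit $H_t$ with action $h\triangleright z=\varepsilon_t(hz)$ and coaction $\Delta(z)$. * ${}_H\mathcal{YD}^H$: tensor product $\otimes_t$ with coaction $m_{[0]}\otimes n_{[0]}\otimes n_{[1]}m_{[1]}$; braiding $1_{(1)}m\otimes1_{(2)}n\mapsto n_{[0]}\otimes n_{[1]}m$; unit $H_t$ with action $h\triangleright z=\varepsilon_t(hz)$ and coaction $z\mapsto\varepsilon_t(1_{(1)})\otimes1_{(2)}\overline\varepsilon_s(z)$. * $\mathcal{YD}^H_H$: tensor product $\otimes_s$ with coaction $m_{[0]}\otimes n_{[0]}\otimes m_{[1]}n_{[1]}$; braiding $m1_{(1)}\otimes n1_{(2)}\mapsto n_{[0]}\otimes mn_{[1]}$; unit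 $H_s$ with action $z\triangleleft h=\varepsilon_s(zh)$ and coaction $\Delta(z)$. * ${}^H\mathcal{YD}_H$: tensor product $\otimes_s$ with coaction $n_{[-1]}m_{[-1]}\otimes m_{[0]}\otimes n_{[0]}$; braiding $m1_{(1)}\otimes n1_{(2)}\mapsto nm_{[-1]}\otimes m_{[0]}$; unit $H_s$ with action $z\triangleleft h=\varepsilon_s(zh)$ and coaction $z\mapsto\overline\varepsilon_t(z)1_{(1)}\otimes\varepsilon_s(1_{(2)})$. The left and right unit constraints are $1_{(1)}\triangleright z\otimes1_{(2)}m\mapsto zm$ and $1_{(1)}m\otimes1_{(2)}\triangleright z\mapsto\overline\varepsilon_s(z)m$ in the first two categories, and $z\triangleleft1_{(1)}\otimes m1_{(2)}\mapsto m\overline\varepsilon_t(z)$ and $m1_{(1)}\otimes z\triangleleft1_{(2)}\mapsto mz$ in the last two. For a braided monoidal category $\mathcal C$ with braiding $c$, let $\mathcal C^{\rm in}$ be the same monoidal category with the braiding $(M,N)\mapsto c_{N,M}^{-1}$, and let $\overline{\mathcal C}$ be the same category with the reversed tensor product $M\,\overline\otimes\,N=N\otimes M$ and the braiding $(M,N)\mapsto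 c_{N,M}$. Then there are isomorphisms of braided monoidal categories (braided strong monoidal functors that are isomorphisms of categories) $${}^H_H\mathcal{YD}\;\cong\;({}_H\mathcal{YD}^H)^{\rm in}\;\cong\;\overline{\mathcal{YD}^H_H}\;\cong\;\bigl(\,\overline{{}^H\mathcal{YD}_H}\,\bigr)^{\rm in}.$$ -/

import Mathlib

open CategoryTheory
open scoped TensorProduct

universe u v

noncomputable section

namespace WeakHopf

/-! ### Weak bialgebras and weak Hopf algebras -/

/-- A weak bialgebra over a commutative ring `k`: an algebra and a coalgebra `H` such that the
comultiplication is multiplicative, `Δ²(1) = 1₁ ⊗ 1₂1₁' ⊗ 1₂' = 1₁ ⊗ 1₁'1₂ ⊗ 1₂'`, and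
`ε(hgl) = ε(hg₁)ε(g₂l) = ε(hg₂)ε(g₁l)`. -/
class WeakBialgebra (k : Type u) (H : Type v) [CommRing k] [Ring H] [Algebra k H]
    [Coalgebra k H] : Prop where
  comul_mul : ∀ g h : H,
    (Coalgebra.comul (g * h) : H ⊗[k] H) = Coalgebra.comul g * Coalgebra.comul h
  comul_comul_one : (Coalgebra.comul (R := k) (A := H)).lTensor H (Coalgebra.comul (1 : H)) =
    TensorProduct.assoc k H H H (Coalgebra.comul (1 : H) ⊗ₜ[k] (1 : H)) *
      ((1 : H) ⊗ₜ[k] (Coalgebra.comul (1 : H) : H ⊗[k] H))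
  comul_comul_one' : (Coalgebra.comul (R := k) (A := H)).lTensor H (Coalgebra.comul (1 : H)) =
    ((1 : H) ⊗ₜ[k] (Coalgebra.comul (1 : H) : H ⊗[k] H)) *
      TensorProduct.assoc k H H H (Coalgebra.comul (1 : H) ⊗ₜ[k] (1 : H))
  counit_mul_mul : ∀ h g l : H, (Coalgebra.counit (h * g * l) : k) =
    LinearMap.mul' k k (TensorProduct.map
      (Coalgebra.counit ∘ₗ LinearMap.mulLeft k h) (Coalgebra.counit ∘ₗ LinearMap.mulRight k l)
      (Coalgebra.comul g))
  counit_mul_mul' : ∀ h g l : H, (Coalgebra.counit (h * g * l) : k) =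
    LinearMap.mul' k k (TensorProduct.map
      (Coalgebra.counit ∘ₗ LinearMap.mulRight k l) (Coalgebra.counit ∘ₗ LinearMap.mulLeft k h)
      (Coalgebra.comul g))

section Maps

variable (k : Type u) (H : Type v) [CommRing k] [Ring H] [Algebra k H] [Coalgebra k H]

/-- The bilinear form `(g, h) ↦ ε(gh)`. -/
def counitMul : H →ₗ[k] H →ₗ[k] k := (LinearMap.mul k H).compr₂ Coalgebra.counit

/-- The target map `ε_t(h) = ε(1₁h)1₂`. -/
def epsT : H →ₗ[k] H where
  toFun h := TensorProduct.lid k H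
    (((counitMul k H).flip h).rTensor H (Coalgebra.comul (1 : H)))
  map_add' := by simp [LinearMap.rTensor_add]
  map_smul' := by simp [LinearMap.rTensor_smul]

/-- The source map `ε_s(h) = 1₁ε(h1₂)`. -/
def epsS : H →ₗ[k] H where
  toFun h := TensorProduct.rid k H
    ((counitMul k H h).lTensor H (Coalgebra.comul (1 : H)))
  map_add' := by simp [LinearMap.lTensor_add]
  map_smul' := by simp [LinearMap.lTensor_smul]

/-- The map `h ↦ ε(h1₁)1₂`, the target map of the opposite weak bialgebra. -/
def epsTBar : H →ₗ[k] H where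
  toFun h := TensorProduct.lid k H
    ((counitMul k H h).rTensor H (Coalgebra.comul (1 : H)))
  map_add' := by simp [LinearMap.rTensor_add]
  map_smul' := by simp [LinearMap.rTensor_smul]

/-- The map `h ↦ 1₁ε(1₂h)`, the source map of the opposite weak bialgebra. -/
def epsSBar : H →ₗ[k] H where
  toFun h := TensorProduct.rid k H
    (((counitMul k H).flip h).lTensor H (Coalgebra.comul (1 : H)))
  map_add' := by simp [LinearMap.lTensor_add]
  map_smul' := by simp [LinearMap.lTensor_smul]

variable {k H}

/-- The convolution product `(f * g)(h) = f(h₁)g(h₂)`. -/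
def conv (f g : H →ₗ[k] H) : H →ₗ[k] H :=
  LinearMap.mul' k H ∘ₗ TensorProduct.map f g ∘ₗ Coalgebra.comul

/-- The map `h ↦ f(h₁, h₂)`. -/
def sweedler {P : Type*} [AddCommGroup P] [Module k P] (f : H →ₗ[k] H →ₗ[k] P) : H →ₗ[k] P :=
  TensorProduct.lift f ∘ₗ Coalgebra.comul

end Maps

/-- A weak Hopf algebra: a weak bialgebra with an antipode `S` such that `S * id = ε_s`,
`id * S = ε_t` and `S * id * S = S` for the convolution product. -/
class WeakHopfAlgebra (k : Type u) (H : Type v) [CommRing k] [Ring H] [Algebra k H]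
    [Coalgebra k H] extends WeakBialgebra k H where
  antipode : H →ₗ[k] H
  antipode_conv_id : conv antipode LinearMap.id = epsS k H
  id_conv_antipode : conv LinearMap.id antipode = epsT k H
  antipode_conv_id_conv_antipode : conv (conv antipode LinearMap.id) antipode = antipode

/-! ### Actions, balanced tensor products and coactions -/

section Actions

variable (k : Type u) (H : Type v) [CommRing k] [Ring H] [Algebra k H]

/-- The left action `h ↦ (m ↦ hm)` on a left `H`-module. -/
def lAct (M : Type v) [AddCommGroup M] [Module k M] [Module H M] [IsScalarTower k H M] :
    H →ₗ[k] M →ₗ[k] M :=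
  (Algebra.lsmul k k M : H →ₐ[k] Module.End k M).toLinearMap

/-- The right action `h ↦ (m ↦ mh)` on a right `H`-module, that is, a module over the opposite
ring. -/
def rAct (M : Type v) [AddCommGroup M] [Module k M] [Module Hᵐᵒᵖ M] [IsScalarTower k Hᵐᵒᵖ M] :
    H →ₗ[k] M →ₗ[k] M :=
  (Algebra.lsmul k k M : Hᵐᵒᵖ →ₐ[k] Module.End k M).toLinearMap ∘ₗ
    (MulOpposite.opLinearEquiv k : H ≃ₗ[k] Hᵐᵒᵖ).toLinearMap

variable [Coalgebra k H]

variable {k H} in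
/-- For `H`-actions `a` on `M` and `b` on `N` on the same side: multiplication by `Δ(1)` on
`M ⊗ N`, that is, `m ⊗ n ↦ 1₁m ⊗ 1₂n` for left actions and `m ⊗ n ↦ m1₁ ⊗ n1₂` for right
actions. -/
def balance {M N : Type v} [AddCommGroup M] [Module k M] [AddCommGroup N] [Module k N]
    (a : H →ₗ[k] M →ₗ[k] M) (b : H →ₗ[k] N →ₗ[k] N) : M ⊗[k] N →ₗ[k] M ⊗[k] N :=
  TensorProduct.map₂ a b (Coalgebra.comul (1 : H))

variable {k H} in
/-- The `k`-submodule `M ⊗_t N = Δ(1)(M ⊗ N)` (left actions) or `M ⊗_s N = (M ⊗ N)Δ(1)` (right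
actions) of `M ⊗ N`. -/
def balanced {M N : Type v} [AddCommGroup M] [Module k M] [AddCommGroup N] [Module k N]
    (a : H →ₗ[k] M →ₗ[k] M) (b : H →ₗ[k] N →ₗ[k] N) : Submodule k (M ⊗[k] N) :=
  LinearMap.range (balance a b)

variable {k H}

/-- A coassociative and counital left coaction `m ↦ m₍₋₁₎ ⊗ m₍₀₎`. -/
structure IsLeftCoaction {M : Type v} [AddCommGroup M] [Module k M]
    (coact : M →ₗ[k] H ⊗[k] M) : Prop where
  coassoc : coact.lTensor H ∘ₗ coact =
    (TensorProduct.assoc k H H M).toLinearMap ∘ₗ Coalgebra.comul.rTensor M ∘ₗ coact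
  counit : (TensorProduct.lid k M).toLinearMap ∘ₗ Coalgebra.counit.rTensor M ∘ₗ coact =
    LinearMap.id

/-- A coassociative and counital right coaction `m ↦ m₍₀₎ ⊗ m₍₁₎`. -/
structure IsRightCoaction {M : Type v} [AddCommGroup M] [Module k M]
    (coact : M →ₗ[k] M ⊗[k] H) : Prop where
  coassoc : Coalgebra.comul.lTensor M ∘ₗ coact =
    (TensorProduct.assoc k M H H).toLinearMap ∘ₗ coact.rTensor H ∘ₗ coact
  counit : (TensorProduct.rid k M).toLinearMap ∘ₗ Coalgebra.counit.lTensor M ∘ₗ coact =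
    LinearMap.id

end Actions

/-- The opposite multiplication `g ⊗ h ↦ hg`. -/
def mulRev (k : Type u) (H : Type v) [CommRing k] [Ring H] [Algebra k H] :
    H ⊗[k] H →ₗ[k] H :=
  LinearMap.mul' k H ∘ₗ (TensorProduct.comm k H H).toLinearMap

/-! ### Left-left Yetter-Drinfeld modules -/

/-- A left-left Yetter-Drinfeld module: a `k`-module `M` with a left `H`-action and a left `H`-coaction
such that the coaction takes values in `H ⊗_t M` and
`h₁m₍₋₁₎ ⊗ h₂m₍₀₎ = (h₁m)₍₋₁₎h₂ ⊗ (h₁m)₍₀₎`. -/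
structure LLYD (k : Type u) (H : Type v) [CommRing k] [Ring H] [Algebra k H]
    [Coalgebra k H] where
  carrier : Type v
  [addCommGroup : AddCommGroup carrier]
  [moduleBase : Module k carrier]
  [module : Module H carrier]
  [isScalarTower : IsScalarTower k H carrier]
  coact : carrier →ₗ[k] H ⊗[k] carrier
  isCoaction : IsLeftCoaction coact
  coact_mem : ∀ m, coact m ∈ balanced (LinearMap.mul k H) (lAct k H carrier)
  compat : ∀ (h : H) (m : carrier),
    TensorProduct.map₂ (LinearMap.mul k H) (lAct k H carrier) (Coalgebra.comul h) (coact m) =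
    sweedler (((LinearMap.rTensorHom carrier ∘ₗ (LinearMap.mul k H).flip).flip ∘ₗ
      coact ∘ₗ (lAct k H carrier).flip m)) h

namespace LLYD

attribute [instance] addCommGroup moduleBase module isScalarTower

variable {k : Type u} {H : Type v} [CommRing k] [Ring H] [Algebra k H] [Coalgebra k H]

instance : CoeSort (LLYD k H) (Type v) := ⟨carrier⟩

/-- `H`-linear and `H`-colinear maps. -/
@[ext]
structure Hom (M N : LLYD k H) where
  hom : M →ₗ[k] N
  map_act : ∀ (h : H) (m : M), hom (h • m) = h • hom m
  map_coact : N.coact ∘ₗ hom = hom.lTensor H ∘ₗ M.coact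

instance : Category (LLYD k H) where
  Hom := Hom
  id M := ⟨LinearMap.id, fun _ _ => rfl, by simp⟩
  comp f g := ⟨g.hom ∘ₗ f.hom, fun h m => by simp [f.map_act, g.map_act], by
    rw [← LinearMap.comp_assoc, g.map_coact, LinearMap.comp_assoc, f.map_coact,
      ← LinearMap.comp_assoc, ← LinearMap.lTensor_comp]⟩

/-- The map `m ⊗ n ↦ m₍₋₁₎n₍₋₁₎ ⊗ m₍₀₎ ⊗ n₍₀₎`. -/
def codiag (M N : LLYD k H) : M ⊗[k] N →ₗ[k] H ⊗[k] (M ⊗[k] N) :=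
  (LinearMap.mul' k H).rTensor (M ⊗[k] N) ∘ₗ
    (TensorProduct.tensorTensorTensorComm k H M H N).toLinearMap ∘ₗ
    TensorProduct.map M.coact N.coact

variable (k H)

/-- The braided monoidal structure of the category of left-left Yetter-Drinfeld modules.

A monoidal category structure and a braiding on this category are the standard ones if, under
identifications `tens` of the tensor product of `M` and `N` with `M ⊗_t N ⊆ M ⊗ N` and `unit` of
the unit object with `H_t ⊆ H`, they are given by the following formulas:
* `H` acts diagonally on `M ⊗_t N`, the coaction is
  `m ⊗ n ↦ m₍₋₁₎n₍₋₁₎ ⊗ m₍₀₎ ⊗ n₍₀₎`, and the tensor product of morphisms is the usual one;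
* the action on `H_t` is `h▹z = ε_t(hz)` and the coaction is `z ↦ Δ(z)`;
* the associativity constraint is that of `k`-modules;
* the unit constraints are `1₁▹z ⊗ 1₂m ↦ zm` and `1₁m ⊗ 1₂▹z ↦ ε̄_s(z)m`;
* the braiding is `1₁m ⊗ 1₂n ↦ m₍₋₁₎n ⊗ m₍₀₎`. -/
structure StandardBraided [MonoidalCategory (LLYD k H)] [BraidedCategory (LLYD k H)] where
  tens : ∀ M N : LLYD k H, (MonoidalCategory.tensorObj M N : LLYD k H) →ₗ[k] M ⊗[k] N
  tens_injective : ∀ M N, Function.Injective (tens M N)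
  range_tens : ∀ M N : LLYD k H,
    LinearMap.range (tens M N) = balanced (lAct k H M) (lAct k H N)
  tens_act : ∀ (M N : LLYD k H) (h : H) (x : (MonoidalCategory.tensorObj M N : LLYD k H)),
    tens M N (h • x) =
      TensorProduct.map₂ (lAct k H M) (lAct k H N) (Coalgebra.comul h) (tens M N x)
  tens_coact : ∀ M N : LLYD k H,
    (tens M N).lTensor H ∘ₗ (MonoidalCategory.tensorObj M N).coact = codiag M N ∘ₗ tens M N
  tens_hom : ∀ {M M' N N' : LLYD k H} (f : M ⟶ M') (g : N ⟶ N'),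
    tens M' N' ∘ₗ (MonoidalCategory.tensorHom f g).hom =
      TensorProduct.map f.hom g.hom ∘ₗ tens M N
  unit : (MonoidalCategory.tensorUnit (LLYD k H)) →ₗ[k] H
  unit_injective : Function.Injective unit
  range_unit : LinearMap.range unit = LinearMap.range (epsT k H)
  unit_act : ∀ (h : H) (z : MonoidalCategory.tensorUnit (LLYD k H)),
    unit (h • z) = epsT k H (h * unit z)
  unit_coact : ∀ z : MonoidalCategory.tensorUnit (LLYD k H),
    unit.lTensor H ((MonoidalCategory.tensorUnit (LLYD k H)).coact z) =
    Coalgebra.comul (unit z)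
  associator : ∀ M N P : LLYD k H,
    (tens N P).lTensor M ∘ₗ tens M (MonoidalCategory.tensorObj N P) ∘ₗ
        (MonoidalCategory.associator M N P).hom.hom =
      (TensorProduct.assoc k M N P).toLinearMap ∘ₗ
        (tens M N).rTensor P ∘ₗ tens (MonoidalCategory.tensorObj M N) P
  leftUnitor : ∀ (M : LLYD k H) (z : MonoidalCategory.tensorUnit (LLYD k H)) (m : M)
    (x : (MonoidalCategory.tensorObj (MonoidalCategory.tensorUnit (LLYD k H)) M : LLYD k H)),
    tens _ M x = balance (lAct k H (MonoidalCategory.tensorUnit (LLYD k H))) (lAct k H M) (z ⊗ₜ[k] m) →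
      (MonoidalCategory.leftUnitor M).hom.hom x = unit z • m
  rightUnitor : ∀ (M : LLYD k H) (m : M) (z : MonoidalCategory.tensorUnit (LLYD k H))
    (x : (MonoidalCategory.tensorObj M (MonoidalCategory.tensorUnit (LLYD k H)) : LLYD k H)),
    tens M _ x = balance (lAct k H M) (lAct k H (MonoidalCategory.tensorUnit (LLYD k H))) (m ⊗ₜ[k] z) →
      (MonoidalCategory.rightUnitor M).hom.hom x = epsSBar k H (unit z) • m
  braiding : ∀ (M N : LLYD k H) (m : M) (n : N)
    (x : (MonoidalCategory.tensorObj M N : LLYD k H)),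
    tens M N x = balance (lAct k H M) (lAct k H N) (m ⊗ₜ[k] n) →
      tens N M ((BraidedCategory.braiding M N).hom.hom x) =
        ((lAct k H N).flip n).rTensor M (M.coact m)

end LLYD

/-! ### Left-right Yetter-Drinfeld modules -/

/-- A left-right Yetter-Drinfeld module: a `k`-module `M` with a left `H`-action and a right `H`-coaction
such that the coaction takes values in `M ⊗_t H` and
`h₁m₍₀₎ ⊗ h₂m₍₁₎ = (h₂m)₍₀₎ ⊗ (h₂m)₍₁₎h₁`. -/
structure LRYD (k : Type u) (H : Type v) [CommRing k] [Ring H] [Algebra k H]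
    [Coalgebra k H] where
  carrier : Type v
  [addCommGroup : AddCommGroup carrier]
  [moduleBase : Module k carrier]
  [module : Module H carrier]
  [isScalarTower : IsScalarTower k H carrier]
  coact : carrier →ₗ[k] carrier ⊗[k] H
  isCoaction : IsRightCoaction coact
  coact_mem : ∀ m, coact m ∈ balanced (lAct k H carrier) (LinearMap.mul k H)
  compat : ∀ (h : H) (m : carrier),
    TensorProduct.map₂ (lAct k H carrier) (LinearMap.mul k H) (Coalgebra.comul h) (coact m) =
    sweedler (((LinearMap.lTensorHom carrier ∘ₗ (LinearMap.mul k H).flip).flip ∘ₗ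
      coact ∘ₗ (lAct k H carrier).flip m).flip) h

namespace LRYD

attribute [instance] addCommGroup moduleBase module isScalarTower

variable {k : Type u} {H : Type v} [CommRing k] [Ring H] [Algebra k H] [Coalgebra k H]

instance : CoeSort (LRYD k H) (Type v) := ⟨carrier⟩

/-- `H`-linear and `H`-colinear maps. -/
@[ext]
structure Hom (M N : LRYD k H) where
  hom : M →ₗ[k] N
  map_act : ∀ (h : H) (m : M), hom (h • m) = h • hom m
  map_coact : N.coact ∘ₗ hom = hom.rTensor H ∘ₗ M.coact

instance : Category (LRYD k H) where
  Hom := Hom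
  id M := ⟨LinearMap.id, fun _ _ => rfl, by simp⟩
  comp f g := ⟨g.hom ∘ₗ f.hom, fun h m => by simp [f.map_act, g.map_act], by
    rw [← LinearMap.comp_assoc, g.map_coact, LinearMap.comp_assoc, f.map_coact,
      ← LinearMap.comp_assoc, ← LinearMap.rTensor_comp]⟩

/-- The map `m ⊗ n ↦ m₍₀₎ ⊗ n₍₀₎ ⊗ n₍₁₎m₍₁₎`. -/
def codiag (M N : LRYD k H) : M ⊗[k] N →ₗ[k] (M ⊗[k] N) ⊗[k] H :=
  (mulRev k H).lTensor (M ⊗[k] N) ∘ₗ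
    (TensorProduct.tensorTensorTensorComm k M H N H).toLinearMap ∘ₗ
    TensorProduct.map M.coact N.coact

variable (k H)

/-- The braided monoidal structure of the category of left-right Yetter-Drinfeld modules.

A monoidal category structure and a braiding on this category are the standard ones if, under
identifications `tens` of the tensor product of `M` and `N` with `M ⊗_t N ⊆ M ⊗ N` and `unit` of
the unit object with `H_t ⊆ H`, they are given by the following formulas:
* `H` acts diagonally on `M ⊗_t N`, the coaction is
  `m ⊗ n ↦ m₍₀₎ ⊗ n₍₀₎ ⊗ n₍₁₎m₍₁₎`, and the tensor product of morphisms is the usual one;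
* the action on `H_t` is `h▹z = ε_t(hz)` and the coaction is `z ↦ ε_t(1₁) ⊗ 1₂ε̄_s(z)`;
* the associativity constraint is that of `k`-modules;
* the unit constraints are `1₁▹z ⊗ 1₂m ↦ zm` and `1₁m ⊗ 1₂▹z ↦ ε̄_s(z)m`;
* the braiding is `1₁m ⊗ 1₂n ↦ n₍₀₎ ⊗ n₍₁₎m`. -/
structure StandardBraided [MonoidalCategory (LRYD k H)] [BraidedCategory (LRYD k H)] where
  tens : ∀ M N : LRYD k H, (MonoidalCategory.tensorObj M N : LRYD k H) →ₗ[k] M ⊗[k] N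
  tens_injective : ∀ M N, Function.Injective (tens M N)
  range_tens : ∀ M N : LRYD k H,
    LinearMap.range (tens M N) = balanced (lAct k H M) (lAct k H N)
  tens_act : ∀ (M N : LRYD k H) (h : H) (x : (MonoidalCategory.tensorObj M N : LRYD k H)),
    tens M N (h • x) =
      TensorProduct.map₂ (lAct k H M) (lAct k H N) (Coalgebra.comul h) (tens M N x)
  tens_coact : ∀ M N : LRYD k H,
    (tens M N).rTensor H ∘ₗ (MonoidalCategory.tensorObj M N).coact = codiag M N ∘ₗ tens M N
  tens_hom : ∀ {M M' N N' : LRYD k H} (f : M ⟶ M') (g : N ⟶ N'),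
    tens M' N' ∘ₗ (MonoidalCategory.tensorHom f g).hom =
      TensorProduct.map f.hom g.hom ∘ₗ tens M N
  unit : (MonoidalCategory.tensorUnit (LRYD k H)) →ₗ[k] H
  unit_injective : Function.Injective unit
  range_unit : LinearMap.range unit = LinearMap.range (epsT k H)
  unit_act : ∀ (h : H) (z : MonoidalCategory.tensorUnit (LRYD k H)),
    unit (h • z) = epsT k H (h * unit z)
  unit_coact : ∀ z : MonoidalCategory.tensorUnit (LRYD k H),
    unit.rTensor H ((MonoidalCategory.tensorUnit (LRYD k H)).coact z) =
    TensorProduct.map (epsT k H) (LinearMap.mulRight k (epsSBar k H (unit z)))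
      (Coalgebra.comul (1 : H))
  associator : ∀ M N P : LRYD k H,
    (tens N P).lTensor M ∘ₗ tens M (MonoidalCategory.tensorObj N P) ∘ₗ
        (MonoidalCategory.associator M N P).hom.hom =
      (TensorProduct.assoc k M N P).toLinearMap ∘ₗ
        (tens M N).rTensor P ∘ₗ tens (MonoidalCategory.tensorObj M N) P
  leftUnitor : ∀ (M : LRYD k H) (z : MonoidalCategory.tensorUnit (LRYD k H)) (m : M)
    (x : (MonoidalCategory.tensorObj (MonoidalCategory.tensorUnit (LRYD k H)) M : LRYD k H)),
    tens _ M x = balance (lAct k H (MonoidalCategory.tensorUnit (LRYD k H))) (lAct k H M) (z ⊗ₜ[k] m) →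
      (MonoidalCategory.leftUnitor M).hom.hom x = unit z • m
  rightUnitor : ∀ (M : LRYD k H) (m : M) (z : MonoidalCategory.tensorUnit (LRYD k H))
    (x : (MonoidalCategory.tensorObj M (MonoidalCategory.tensorUnit (LRYD k H)) : LRYD k H)),
    tens M _ x = balance (lAct k H M) (lAct k H (MonoidalCategory.tensorUnit (LRYD k H))) (m ⊗ₜ[k] z) →
      (MonoidalCategory.rightUnitor M).hom.hom x = epsSBar k H (unit z) • m
  braiding : ∀ (M N : LRYD k H) (m : M) (n : N)
    (x : (MonoidalCategory.tensorObj M N : LRYD k H)),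
    tens M N x = balance (lAct k H M) (lAct k H N) (m ⊗ₜ[k] n) →
      tens N M ((BraidedCategory.braiding M N).hom.hom x) =
        ((lAct k H M).flip m).lTensor N (N.coact n)

end LRYD

/-! ### Right-right Yetter-Drinfeld modules -/

/-- A right-right Yetter-Drinfeld module: a `k`-module `M` with a right `H`-action and a right `H`-coaction
such that the coaction takes values in `M ⊗_s H` and
`m₍₀₎h₁ ⊗ m₍₁₎h₂ = (mh₂)₍₀₎ ⊗ h₁(mh₂)₍₁₎`. -/
structure RRYD (k : Type u) (H : Type v) [CommRing k] [Ring H] [Algebra k H]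
    [Coalgebra k H] where
  carrier : Type v
  [addCommGroup : AddCommGroup carrier]
  [moduleBase : Module k carrier]
  [module : Module Hᵐᵒᵖ carrier]
  [isScalarTower : IsScalarTower k Hᵐᵒᵖ carrier]
  coact : carrier →ₗ[k] carrier ⊗[k] H
  isCoaction : IsRightCoaction coact
  coact_mem : ∀ m, coact m ∈ balanced (rAct k H carrier) (LinearMap.mul k H).flip
  compat : ∀ (h : H) (m : carrier),
    TensorProduct.map₂ (rAct k H carrier) (LinearMap.mul k H).flip (Coalgebra.comul h) (coact m) =
    sweedler (((LinearMap.lTensorHom carrier ∘ₗ (LinearMap.mul k H)).flip ∘ₗ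
      coact ∘ₗ (rAct k H carrier).flip m).flip) h

namespace RRYD

attribute [instance] addCommGroup moduleBase module isScalarTower

variable {k : Type u} {H : Type v} [CommRing k] [Ring H] [Algebra k H] [Coalgebra k H]

instance : CoeSort (RRYD k H) (Type v) := ⟨carrier⟩

/-- `H`-linear and `H`-colinear maps. -/
@[ext]
structure Hom (M N : RRYD k H) where
  hom : M →ₗ[k] N
  map_act : ∀ (h : H) (m : M), hom (MulOpposite.op h • m) = MulOpposite.op h • hom m
  map_coact : N.coact ∘ₗ hom = hom.rTensor H ∘ₗ M.coact

instance : Category (RRYD k H) where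
  Hom := Hom
  id M := ⟨LinearMap.id, fun _ _ => rfl, by simp⟩
  comp f g := ⟨g.hom ∘ₗ f.hom, fun h m => by simp [f.map_act, g.map_act], by
    rw [← LinearMap.comp_assoc, g.map_coact, LinearMap.comp_assoc, f.map_coact,
      ← LinearMap.comp_assoc, ← LinearMap.rTensor_comp]⟩

/-- The map `m ⊗ n ↦ m₍₀₎ ⊗ n₍₀₎ ⊗ m₍₁₎n₍₁₎`. -/
def codiag (M N : RRYD k H) : M ⊗[k] N →ₗ[k] (M ⊗[k] N) ⊗[k] H :=
  (LinearMap.mul' k H).lTensor (M ⊗[k] N) ∘ₗ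
    (TensorProduct.tensorTensorTensorComm k M H N H).toLinearMap ∘ₗ
    TensorProduct.map M.coact N.coact

variable (k H)

/-- The braided monoidal structure of the category of right-right Yetter-Drinfeld modules.

A monoidal category structure and a braiding on this category are the standard ones if, under
identifications `tens` of the tensor product of `M` and `N` with `M ⊗_s N ⊆ M ⊗ N` and `unit` of
the unit object with `H_s ⊆ H`, they are given by the following formulas:
* `H` acts diagonally on `M ⊗_s N`, the coaction is
  `m ⊗ n ↦ m₍₀₎ ⊗ n₍₀₎ ⊗ m₍₁₎n₍₁₎`, and the tensor product of morphisms is the usual one;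
* the action on `H_s` is `z◃h = ε_s(zh)` and the coaction is `z ↦ Δ(z)`;
* the associativity constraint is that of `k`-modules;
* the unit constraints are `z◃1₁ ⊗ m1₂ ↦ mε̄_t(z)` and `m1₁ ⊗ z◃1₂ ↦ mz`;
* the braiding is `m1₁ ⊗ n1₂ ↦ n₍₀₎ ⊗ mn₍₁₎`. -/
structure StandardBraided [MonoidalCategory (RRYD k H)] [BraidedCategory (RRYD k H)] where
  tens : ∀ M N : RRYD k H, (MonoidalCategory.tensorObj M N : RRYD k H) →ₗ[k] M ⊗[k] N
  tens_injective : ∀ M N, Function.Injective (tens M N)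
  range_tens : ∀ M N : RRYD k H,
    LinearMap.range (tens M N) = balanced (rAct k H M) (rAct k H N)
  tens_act : ∀ (M N : RRYD k H) (h : H) (x : (MonoidalCategory.tensorObj M N : RRYD k H)),
    tens M N (MulOpposite.op h • x) =
      TensorProduct.map₂ (rAct k H M) (rAct k H N) (Coalgebra.comul h) (tens M N x)
  tens_coact : ∀ M N : RRYD k H,
    (tens M N).rTensor H ∘ₗ (MonoidalCategory.tensorObj M N).coact = codiag M N ∘ₗ tens M N
  tens_hom : ∀ {M M' N N' : RRYD k H} (f : M ⟶ M') (g : N ⟶ N'),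
    tens M' N' ∘ₗ (MonoidalCategory.tensorHom f g).hom =
      TensorProduct.map f.hom g.hom ∘ₗ tens M N
  unit : (MonoidalCategory.tensorUnit (RRYD k H)) →ₗ[k] H
  unit_injective : Function.Injective unit
  range_unit : LinearMap.range unit = LinearMap.range (epsS k H)
  unit_act : ∀ (h : H) (z : MonoidalCategory.tensorUnit (RRYD k H)),
    unit (MulOpposite.op h • z) = epsS k H (unit z * h)
  unit_coact : ∀ z : MonoidalCategory.tensorUnit (RRYD k H),
    unit.rTensor H ((MonoidalCategory.tensorUnit (RRYD k H)).coact z) =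
    Coalgebra.comul (unit z)
  associator : ∀ M N P : RRYD k H,
    (tens N P).lTensor M ∘ₗ tens M (MonoidalCategory.tensorObj N P) ∘ₗ
        (MonoidalCategory.associator M N P).hom.hom =
      (TensorProduct.assoc k M N P).toLinearMap ∘ₗ
        (tens M N).rTensor P ∘ₗ tens (MonoidalCategory.tensorObj M N) P
  leftUnitor : ∀ (M : RRYD k H) (z : MonoidalCategory.tensorUnit (RRYD k H)) (m : M)
    (x : (MonoidalCategory.tensorObj (MonoidalCategory.tensorUnit (RRYD k H)) M : RRYD k H)),
    tens _ M x = balance (rAct k H (MonoidalCategory.tensorUnit (RRYD k H))) (rAct k H M) (z ⊗ₜ[k] m) →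
      (MonoidalCategory.leftUnitor M).hom.hom x = MulOpposite.op (epsTBar k H (unit z)) • m
  rightUnitor : ∀ (M : RRYD k H) (m : M) (z : MonoidalCategory.tensorUnit (RRYD k H))
    (x : (MonoidalCategory.tensorObj M (MonoidalCategory.tensorUnit (RRYD k H)) : RRYD k H)),
    tens M _ x = balance (rAct k H M) (rAct k H (MonoidalCategory.tensorUnit (RRYD k H))) (m ⊗ₜ[k] z) →
      (MonoidalCategory.rightUnitor M).hom.hom x = MulOpposite.op (unit z) • m
  braiding : ∀ (M N : RRYD k H) (m : M) (n : N)
    (x : (MonoidalCategory.tensorObj M N : RRYD k H)),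
    tens M N x = balance (rAct k H M) (rAct k H N) (m ⊗ₜ[k] n) →
      tens N M ((BraidedCategory.braiding M N).hom.hom x) =
        ((rAct k H M).flip m).lTensor N (N.coact n)

end RRYD

/-! ### Right-left Yetter-Drinfeld modules -/

/-- A right-left Yetter-Drinfeld module: a `k`-module `M` with a right `H`-action and a left `H`-coaction
such that the coaction takes values in `H ⊗_s M` and
`m₍₋₁₎h₁ ⊗ m₍₀₎h₂ = h₂(mh₁)₍₋₁₎ ⊗ (mh₁)₍₀₎`. -/
structure RLYD (k : Type u) (H : Type v) [CommRing k] [Ring H] [Algebra k H]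
    [Coalgebra k H] where
  carrier : Type v
  [addCommGroup : AddCommGroup carrier]
  [moduleBase : Module k carrier]
  [module : Module Hᵐᵒᵖ carrier]
  [isScalarTower : IsScalarTower k Hᵐᵒᵖ carrier]
  coact : carrier →ₗ[k] H ⊗[k] carrier
  isCoaction : IsLeftCoaction coact
  coact_mem : ∀ m, coact m ∈ balanced (LinearMap.mul k H).flip (rAct k H carrier)
  compat : ∀ (h : H) (m : carrier),
    TensorProduct.map₂ (LinearMap.mul k H).flip (rAct k H carrier) (Coalgebra.comul h) (coact m) =
    sweedler (((LinearMap.rTensorHom carrier ∘ₗ (LinearMap.mul k H)).flip ∘ₗ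
      coact ∘ₗ (rAct k H carrier).flip m)) h

namespace RLYD

attribute [instance] addCommGroup moduleBase module isScalarTower

variable {k : Type u} {H : Type v} [CommRing k] [Ring H] [Algebra k H] [Coalgebra k H]

instance : CoeSort (RLYD k H) (Type v) := ⟨carrier⟩

/-- `H`-linear and `H`-colinear maps. -/
@[ext]
structure Hom (M N : RLYD k H) where
  hom : M →ₗ[k] N
  map_act : ∀ (h : H) (m : M), hom (MulOpposite.op h • m) = MulOpposite.op h • hom m
  map_coact : N.coact ∘ₗ hom = hom.lTensor H ∘ₗ M.coact

instance : Category (RLYD k H) where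
  Hom := Hom
  id M := ⟨LinearMap.id, fun _ _ => rfl, by simp⟩
  comp f g := ⟨g.hom ∘ₗ f.hom, fun h m => by simp [f.map_act, g.map_act], by
    rw [← LinearMap.comp_assoc, g.map_coact, LinearMap.comp_assoc, f.map_coact,
      ← LinearMap.comp_assoc, ← LinearMap.lTensor_comp]⟩

/-- The map `m ⊗ n ↦ n₍₋₁₎m₍₋₁₎ ⊗ m₍₀₎ ⊗ n₍₀₎`. -/
def codiag (M N : RLYD k H) : M ⊗[k] N →ₗ[k] H ⊗[k] (M ⊗[k] N) :=
  (mulRev k H).rTensor (M ⊗[k] N) ∘ₗ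
    (TensorProduct.tensorTensorTensorComm k H M H N).toLinearMap ∘ₗ
    TensorProduct.map M.coact N.coact

variable (k H)

/-- The braided monoidal structure of the category of right-left Yetter-Drinfeld modules.

A monoidal category structure and a braiding on this category are the standard ones if, under
identifications `tens` of the tensor product of `M` and `N` with `M ⊗_s N ⊆ M ⊗ N` and `unit` of
the unit object with `H_s ⊆ H`, they are given by the following formulas:
* `H` acts diagonally on `M ⊗_s N`, the coaction is
  `m ⊗ n ↦ n₍₋₁₎m₍₋₁₎ ⊗ m₍₀₎ ⊗ n₍₀₎`, and the tensor product of morphisms is the usual one;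
* the action on `H_s` is `z◃h = ε_s(zh)` and the coaction is `z ↦ ε̄_t(z)1₁ ⊗ ε_s(1₂)`;
* the associativity constraint is that of `k`-modules;
* the unit constraints are `z◃1₁ ⊗ m1₂ ↦ mε̄_t(z)` and `m1₁ ⊗ z◃1₂ ↦ mz`;
* the braiding is `m1₁ ⊗ n1₂ ↦ nm₍₋₁₎ ⊗ m₍₀₎`. -/
structure StandardBraided [MonoidalCategory (RLYD k H)] [BraidedCategory (RLYD k H)] where
  tens : ∀ M N : RLYD k H, (MonoidalCategory.tensorObj M N : RLYD k H) →ₗ[k] M ⊗[k] N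
  tens_injective : ∀ M N, Function.Injective (tens M N)
  range_tens : ∀ M N : RLYD k H,
    LinearMap.range (tens M N) = balanced (rAct k H M) (rAct k H N)
  tens_act : ∀ (M N : RLYD k H) (h : H) (x : (MonoidalCategory.tensorObj M N : RLYD k H)),
    tens M N (MulOpposite.op h • x) =
      TensorProduct.map₂ (rAct k H M) (rAct k H N) (Coalgebra.comul h) (tens M N x)
  tens_coact : ∀ M N : RLYD k H,
    (tens M N).lTensor H ∘ₗ (MonoidalCategory.tensorObj M N).coact = codiag M N ∘ₗ tens M N
  tens_hom : ∀ {M M' N N' : RLYD k H} (f : M ⟶ M') (g : N ⟶ N'),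
    tens M' N' ∘ₗ (MonoidalCategory.tensorHom f g).hom =
      TensorProduct.map f.hom g.hom ∘ₗ tens M N
  unit : (MonoidalCategory.tensorUnit (RLYD k H)) →ₗ[k] H
  unit_injective : Function.Injective unit
  range_unit : LinearMap.range unit = LinearMap.range (epsS k H)
  unit_act : ∀ (h : H) (z : MonoidalCategory.tensorUnit (RLYD k H)),
    unit (MulOpposite.op h • z) = epsS k H (unit z * h)
  unit_coact : ∀ z : MonoidalCategory.tensorUnit (RLYD k H),
    unit.lTensor H ((MonoidalCategory.tensorUnit (RLYD k H)).coact z) =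
    TensorProduct.map (LinearMap.mulLeft k (epsTBar k H (unit z))) (epsS k H)
      (Coalgebra.comul (1 : H))
  associator : ∀ M N P : RLYD k H,
    (tens N P).lTensor M ∘ₗ tens M (MonoidalCategory.tensorObj N P) ∘ₗ
        (MonoidalCategory.associator M N P).hom.hom =
      (TensorProduct.assoc k M N P).toLinearMap ∘ₗ
        (tens M N).rTensor P ∘ₗ tens (MonoidalCategory.tensorObj M N) P
  leftUnitor : ∀ (M : RLYD k H) (z : MonoidalCategory.tensorUnit (RLYD k H)) (m : M)
    (x : (MonoidalCategory.tensorObj (MonoidalCategory.tensorUnit (RLYD k H)) M : RLYD k H)),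
    tens _ M x = balance (rAct k H (MonoidalCategory.tensorUnit (RLYD k H))) (rAct k H M) (z ⊗ₜ[k] m) →
      (MonoidalCategory.leftUnitor M).hom.hom x = MulOpposite.op (epsTBar k H (unit z)) • m
  rightUnitor : ∀ (M : RLYD k H) (m : M) (z : MonoidalCategory.tensorUnit (RLYD k H))
    (x : (MonoidalCategory.tensorObj M (MonoidalCategory.tensorUnit (RLYD k H)) : RLYD k H)),
    tens M _ x = balance (rAct k H M) (rAct k H (MonoidalCategory.tensorUnit (RLYD k H))) (m ⊗ₜ[k] z) →
      (MonoidalCategory.rightUnitor M).hom.hom x = MulOpposite.op (unit z) • m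
  braiding : ∀ (M N : RLYD k H) (m : M) (n : N)
    (x : (MonoidalCategory.tensorObj M N : RLYD k H)),
    tens M N x = balance (rAct k H M) (rAct k H N) (m ⊗ₜ[k] n) →
      tens N M ((BraidedCategory.braiding M N).hom.hom x) =
        ((rAct k H N).flip n).rTensor M (M.coact m)

end RLYD

/-! ### Isomorphisms of braided monoidal categories -/

universe v₁ v₂ u₁ u₂

/-- The category `C^in`: the same monoidal category as `C`, with the inverse braiding
`(M, N) ↦ (c_{N,M})⁻¹`. -/
def InverseBraided (C : Type u₁) : Type u₁ := C

namespace InverseBraided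

variable (C : Type u₁) [Category.{v₁} C] [MonoidalCategory C] [BraidedCategory C]

instance : Category.{v₁} (InverseBraided C) := inferInstanceAs (Category.{v₁} C)

instance : MonoidalCategory (InverseBraided C) := inferInstanceAs (MonoidalCategory C)

instance : BraidedCategory (InverseBraided C) := reverseBraiding C

end InverseBraided

/-- `C` and `D` are isomorphic as braided monoidal categories: there is a braided (strong)
monoidal functor from `C` to `D` which is an isomorphism of categories. The inverse functor is
then braided monoidal as well. -/
def BraidedIsomorphic (C : Type u₁) [Category.{v₁} C] [MonoidalCategory C] [BraidedCategory C]
    (D : Type u₂) [Category.{v₂} D] [MonoidalCategory D] [BraidedCategory D] : Prop :=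
  ∃ (F : C ⥤ D) (G : D ⥤ C) (_ : F.Braided), F ⋙ G = 𝟭 C ∧ G ⋙ F = 𝟭 D

end WeakHopf

end

/-! Everything is built by hand for left-left modules, and the antipode carries it to the other
three categories. Carriers never change: an action changes side by mh = S⁻¹(h)m, or back by hm =
mS(h), and a coaction changes side by applying S or S⁻¹ to its H-leg. Since S reverses products and
coproducts, moving the action to the other side reverses the order of the tensor factors. The
inverse of the left-left braiding is n ⊗ m ↦ m₍₀₎ ⊗ S⁻¹(m₍₋₁₎)n, so the standard braiding elsewhere
corresponds to the inverse one exactly when only one of action and coaction has moved. This accounts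
for the inverse braiding for left-right modules, the reversal for right-right modules, and both for
right-left modules.

The left-left case rests on a few facts about Δ(1). It lies in H_s ⊗ H_t (`sw_one_epsS`,
`sw_one_epsT`). The subalgebras H_t and H_s commute (`epsT_mul_epsS_comm`), and 1₁ ⊗ 1₂z = 1₁ε̄_s(z)
⊗ 1₂ for z in H_t (`IsTarget.sw_one`). For a Yetter-Drinfeld module they imply that the coaction is
H_t-linear (`LLYD.sw_coact_target`) and that elements of H_s pass from its H-leg to its module leg
(`LLYD.sw_coact_source`). With these, every copy of Δ(1) left over by the balanced tensor product
can be split and absorbed. The triangle identity is `IsTarget.sw_one` itself. Linearity of the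
braiding is the Yetter-Drinfeld condition, its invertibility comes from S⁻¹(h₂)h₁ = ε̄_t(h) and
h₂S⁻¹(h₁) = ε̄_s(h), and the hexagons come from coassociativity and from the multiplicative form of
the codiagonal coaction.

The antipode needs only its convolution identities: `antipode_mul` and `comul_antipode` show that it
is antimultiplicative and anticomultiplicative. If action and coaction move together, the two
Yetter-Drinfeld conditions are related by the substitution h ↦ S(h). If only one moves, the
condition must first be brought to a form containing the antipode, which is the purpose of
`LLYD.sw_antipode_coact` and its two analogues.

The other three braided monoidal structures are defined by transport along these isomorphisms, with
the braiding inverted for left-right and right-left modules. The braided isomorphisms are then close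
to formal. What remains to be checked is that objects correspond and that the transported structures
are given by the prescribed formulas. -/

noncomputable section

namespace WeakHopf

/-! ### Sweedler notation as a calculus of finite sums -/

section Calculus

variable {k : Type*} [CommRing k]
variable {A B C D P Q : Type*} [AddCommGroup A] [Module k A] [AddCommGroup B] [Module k B]
  [AddCommGroup C] [Module k C] [AddCommGroup D] [Module k D]
  [AddCommGroup P] [Module k P] [AddCommGroup Q] [Module k Q]

/-- Linearity of an unbundled function, as a predicate that `fun_prop` can prove. -/
@[fun_prop]
def Lin (k : Type*) [CommRing k] {A B : Type*} [AddCommGroup A] [Module k A] [AddCommGroup B]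
    [Module k B] (f : A → B) : Prop := IsLinearMap k f

@[fun_prop]
theorem lin_id : Lin k (fun x : A => x) := ⟨fun _ _ => rfl, fun _ _ => rfl⟩

@[fun_prop]
theorem Lin.comp {f : B → C} {g : A → B} (hf : Lin k f) (hg : Lin k g) :
    Lin k (fun x => f (g x)) :=
  ⟨fun x y => by rw [hg.map_add, hf.map_add], fun c x => by rw [hg.map_smul, hf.map_smul]⟩

@[fun_prop]
theorem Lin.linearMap_apply (l : B →ₗ[k] C) {g : A → B} (hg : Lin k g) : Lin k (fun x => l (g x)) :=
  ⟨fun x y => by rw [hg.map_add, l.map_add], fun c x => by rw [hg.map_smul, l.map_smul]⟩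

@[fun_prop]
theorem Lin.linearMap_apply_left {l : A → B →ₗ[k] C} (hl : Lin k l) (b : B) :
    Lin k (fun x => l x b) :=
  ⟨fun x y => by rw [hl.map_add, LinearMap.add_apply],
    fun c x => by rw [hl.map_smul, LinearMap.smul_apply]⟩

/-- The linear map given by a linear function. -/
def Lin.toLinearMap {f : A → B} (hf : Lin k f) : A →ₗ[k] B := IsLinearMap.mk' f hf

@[simp]
theorem Lin.toLinearMap_apply {f : A → B} (hf : Lin k f) (a : A) : hf.toLinearMap a = f a := rfl

theorem Lin.map_zero {f : A → B} (hf : Lin k f) : f 0 = 0 := IsLinearMap.map_zero hf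

theorem Lin.map_add {f : A → B} (hf : Lin k f) (a a' : A) : f (a + a') = f a + f a' :=
  IsLinearMap.map_add hf a a'

theorem Lin.map_smul {f : A → B} (hf : Lin k f) (c : k) (a : A) : f (c • a) = c • f a :=
  IsLinearMap.map_smul hf c a

theorem _root_.LinearMap.lin (l : B →ₗ[k] C) : Lin k l := l.isLinear

@[fun_prop]
theorem Lin.tmul_left {f : A → B} (hf : Lin k f) (c : C) : Lin k (fun x => f x ⊗ₜ[k] c) :=
  ⟨fun x y => by rw [hf.map_add, TensorProduct.add_tmul],
    fun r x => by rw [hf.map_smul, TensorProduct.smul_tmul']⟩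

@[fun_prop]
theorem Lin.tmul_right {f : A → B} (hf : Lin k f) (c : C) : Lin k (fun x => c ⊗ₜ[k] f x) :=
  ⟨fun x y => by rw [hf.map_add, TensorProduct.tmul_add],
    fun r x => by rw [hf.map_smul, TensorProduct.tmul_smul]⟩

@[fun_prop]
theorem Lin.mul_left {R : Type*} [Ring R] [Algebra k R] {f : A → R} (hf : Lin k f) (c : R) :
    Lin k (fun x => f x * c) :=
  ⟨fun x y => by rw [hf.map_add, add_mul], fun r x => by rw [hf.map_smul, smul_mul_assoc]⟩

@[fun_prop]
theorem Lin.mul_right {R : Type*} [Ring R] [Algebra k R] {f : A → R} (hf : Lin k f) (c : R) :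
    Lin k (fun x => c * f x) :=
  ⟨fun x y => by rw [hf.map_add, mul_add], fun r x => by rw [hf.map_smul, mul_smul_comm]⟩

@[fun_prop]
theorem Lin.smul_left {R : Type*} [Ring R] [Algebra k R] [Module R B] [IsScalarTower k R B]
    {f : A → R} (hf : Lin k f) (b : B) : Lin k (fun x => f x • b) :=
  ⟨fun x y => by rw [hf.map_add, add_smul], fun r x => by rw [hf.map_smul, smul_assoc]⟩

-- Only a scalar tower is assumed, so a scalar of k passes `c` through `algebraMap`, whose image is
-- central.
@[fun_prop]
theorem Lin.smul_right {R : Type*} [Ring R] [Algebra k R] [Module R B] [IsScalarTower k R B]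
    {f : A → B} (hf : Lin k f) (c : R) : Lin k (fun x => c • f x) :=
  ⟨fun x y => by rw [hf.map_add, smul_add], fun r x => by
    rw [hf.map_smul, ← algebraMap_smul R r (f x), ← algebraMap_smul R r (c • f x), smul_smul,
      smul_smul, Algebra.commutes]⟩

@[fun_prop]
theorem Lin.op {R : Type*} [Ring R] [Algebra k R] {f : A → R} (hf : Lin k f) :
    Lin k (fun x => MulOpposite.op (f x)) :=
  ⟨fun x y => by rw [hf.map_add, MulOpposite.op_add],
    fun r x => by rw [hf.map_smul, MulOpposite.op_smul]⟩

/-- Supplies the representation by pure tensors that `sw` fixes once and for all for each x. -/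
theorem exists_sum_tmul (x : A ⊗[k] B) :
    ∃ s : Multiset (A × B), x = (s.map fun p => p.1 ⊗ₜ[k] p.2).sum := by
  induction x with
  | zero => exact ⟨0, by simp⟩
  | tmul a b => exact ⟨{(a, b)}, by simp⟩
  | add x y hx hy =>
    obtain ⟨s, rfl⟩ := hx
    obtain ⟨t, rfl⟩ := hy
    exact ⟨s + t, by simp⟩

/-- Sweedler summation: `sw x f = ∑ f(x₁, x₂)` for `x = ∑ x₁ ⊗ x₂`. The value is meaningful for
bilinear `f` only; for other functions it depends on a chosen representation of `x`. -/
def sw (x : A ⊗[k] B) (f : A → B → P) : P :=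
  ((exists_sum_tmul x).choose.map fun p => f p.1 p.2).sum

/-- The linear map on the tensor product given by a bilinear function. -/
def liftLin {f : A → B → P} (hl : ∀ b, Lin k (fun a => f a b)) (hr : ∀ a, Lin k (fun b => f a b)) :
    A ⊗[k] B →ₗ[k] P :=
  TensorProduct.lift (LinearMap.mk₂ k f (fun a a' b => (hl b).map_add a a')
    (fun c a b => (hl b).map_smul c a) (fun a b b' => (hr a).map_add b b')
    (fun c a b => (hr a).map_smul c b))

@[simp]
theorem liftLin_tmul {f : A → B → P} (hl : ∀ b, Lin k (fun a => f a b))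
    (hr : ∀ a, Lin k (fun b => f a b)) (a : A) (b : B) : liftLin hl hr (a ⊗ₜ b) = f a b := rfl

/-- For bilinear `f` the sum no longer depends on the chosen representation. Every rule below that
changes the tensor, rather than the summand, rests on this. -/
theorem sw_eq_liftLin {f : A → B → P} (hl : ∀ b, Lin k (fun a => f a b))
    (hr : ∀ a, Lin k (fun b => f a b)) (x : A ⊗[k] B) : sw x f = liftLin hl hr x := by
  conv_rhs => rw [(exists_sum_tmul x).choose_spec]
  rw [map_multiset_sum, Multiset.map_map]
  rfl

@[fun_prop]
theorem Lin.sw_left {X : Q → A ⊗[k] B} {F : A → B → P} (hX : Lin k X)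
    (hl : ∀ b, Lin k (fun a => F a b)) (hr : ∀ a, Lin k (fun b => F a b)) :
    Lin k (fun t => sw (X t) F) := by
  simp only [sw_eq_liftLin hl hr]
  fun_prop

-- The representation of `x` is the same for every parameter `t`, so linearity in the parameter
-- needs no bilinearity in the summation variables.
@[fun_prop]
theorem Lin.sw_fun {F : Q → A → B → P} (x : A ⊗[k] B)
    (hF : ∀ a b, Lin k (fun t => F t a b)) : Lin k (fun t => sw x (F t)) := by
  constructor
  · intro t t'
    simp only [WeakHopf.sw, ← Multiset.sum_map_add]
    congr 2
    ext p
    exact (hF p.1 p.2).map_add t t'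
  · intro c t
    simp only [WeakHopf.sw, Multiset.smul_sum, Multiset.map_map]
    congr 2
    ext p
    exact (hF p.1 p.2).map_smul c t

/-! #### Rules for Sweedler sums -/

theorem sw_self (x : A ⊗[k] B) : sw x (fun a b => a ⊗ₜ[k] b) = x :=
  (exists_sum_tmul x).choose_spec.symm

/-- Rewriting under the sum carries no linearity condition; this is the gain from defining `sw` for
arbitrary functions. -/
theorem sw_congr {x : A ⊗[k] B} {f g : A → B → P} (h : ∀ a b, f a b = g a b) :
    sw x f = sw x g := by
  rw [show f = g from funext₂ h]

theorem Lin.map_sw {g : P → Q} (hg : Lin k g) (x : A ⊗[k] B) (f : A → B → P) :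
    g (sw x f) = sw x (fun a b => g (f a b)) := by
  have := map_multiset_sum (IsLinearMap.mk' g hg)
    ((exists_sum_tmul x).choose.map fun p => f p.1 p.2)
  rw [Multiset.map_map] at this
  exact this

theorem map_sw (g : P →ₗ[k] Q) (x : A ⊗[k] B) (f : A → B → P) :
    g (sw x f) = sw x (fun a b => g (f a b)) := Lin.map_sw g.lin x f

theorem tmul_sw (c : C) (x : A ⊗[k] B) (f : A → B → P) :
    c ⊗ₜ[k] sw x f = sw x (fun a b => c ⊗ₜ[k] f a b) :=
  Lin.map_sw (g := fun t => c ⊗ₜ[k] t) (by fun_prop) x f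

theorem sw_tmul (c : C) (x : A ⊗[k] B) (f : A → B → P) :
    sw x f ⊗ₜ[k] c = sw x (fun a b => f a b ⊗ₜ[k] c) :=
  Lin.map_sw (g := fun t => t ⊗ₜ[k] c) (by fun_prop) x f

section Algebra

variable {R : Type*} [Ring R] [Algebra k R]

theorem mul_sw (c : R) (x : A ⊗[k] B) (f : A → B → R) :
    c * sw x f = sw x (fun a b => c * f a b) :=
  Lin.map_sw (k := k) (g := fun t => c * t) (by fun_prop) x f

theorem sw_mul (c : R) (x : A ⊗[k] B) (f : A → B → R) :
    sw x f * c = sw x (fun a b => f a b * c) :=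
  Lin.map_sw (k := k) (g := fun t => t * c) (by fun_prop) x f

variable [Module R P] [IsScalarTower k R P]

theorem smul_sw (c : R) (x : A ⊗[k] B) (f : A → B → P) :
    c • sw x f = sw x (fun a b => c • f a b) :=
  Lin.map_sw (k := k) (g := fun t => c • t) (by fun_prop) x f

theorem sw_smul (p : P) (x : A ⊗[k] B) (f : A → B → R) :
    sw x f • p = sw x (fun a b => f a b • p) :=
  Lin.map_sw (k := k) (g := fun t => t • p) (by fun_prop) x f

end Algebra

/-- Two finite sums are interchanged, which holds for any `f` as long as neither tensor depends on
the variables of the other sum. -/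
theorem sw_comm (x : A ⊗[k] B) (y : C ⊗[k] D) (f : A → B → C → D → P) :
    sw x (fun a b => sw y (fun c d => f a b c d)) =
      sw y (fun c d => sw x (fun a b => f a b c d)) :=
  Multiset.sum_map_sum_map _ _

/-- Bilinearity is needed because the representation chosen for a ⊗ b may be a different one. -/
theorem sw_of_tmul {f : A → B → P} (a : A) (b : B) (hl : ∀ b, Lin k (fun a => f a b))
    (hr : ∀ a, Lin k (fun b => f a b)) : sw (a ⊗ₜ[k] b) f = f a b := by
  rw [sw_eq_liftLin hl hr, liftLin_tmul]

theorem sw_sw {f : A → B → P} (x : C ⊗[k] D) (g : C → D → A ⊗[k] B)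
    (hl : ∀ b, Lin k (fun a => f a b)) (hr : ∀ a, Lin k (fun b => f a b)) :
    sw (sw x g) f = sw x (fun c d => sw (g c d) f) := by
  simp only [sw_eq_liftLin hl hr]
  exact map_sw _ _ _

/-- A linear map on a tensor product as a Sweedler sum. -/
theorem apply_eq_sw (g : A ⊗[k] B →ₗ[k] P) (x : A ⊗[k] B) :
    g x = sw x (fun a b => g (a ⊗ₜ b)) := by
  conv_lhs => rw [← sw_self x, map_sw]

theorem sw_map {f : C → D → P} (g : A →ₗ[k] C) (h : B →ₗ[k] D) (x : A ⊗[k] B)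
    (hl : ∀ b, Lin k (fun a => f a b)) (hr : ∀ a, Lin k (fun b => f a b)) :
    sw (TensorProduct.map g h x) f = sw x (fun a b => f (g a) (h b)) := by
  rw [apply_eq_sw (TensorProduct.map g h) x, sw_sw _ _ hl hr]
  simp only [TensorProduct.map_tmul, sw_of_tmul _ _ hl hr]

theorem sw_lTensor {f : A → D → P} (h : B →ₗ[k] D) (x : A ⊗[k] B)
    (hl : ∀ b, Lin k (fun a => f a b)) (hr : ∀ a, Lin k (fun b => f a b)) :
    sw (h.lTensor A x) f = sw x (fun a b => f a (h b)) := sw_map _ _ _ hl hr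

theorem sw_rTensor {f : C → B → P} (g : A →ₗ[k] C) (x : A ⊗[k] B)
    (hl : ∀ b, Lin k (fun a => f a b)) (hr : ∀ a, Lin k (fun b => f a b)) :
    sw (g.rTensor B x) f = sw x (fun a b => f (g a) b) := sw_map _ _ _ hl hr

theorem sw_mul_tensor {R S : Type*} [Ring R] [Algebra k R] [Ring S] [Algebra k S] {f : R → S → P}
    (x y : R ⊗[k] S) (hl : ∀ b, Lin k (fun a => f a b)) (hr : ∀ a, Lin k (fun b => f a b)) :
    sw (x * y) f = sw x (fun a b => sw y (fun c d => f (a * c) (b * d))) := by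
  conv_lhs => rw [← sw_self x, sw_mul, sw_sw _ _ hl hr]
  congr 1
  ext a b
  conv_lhs => rw [← sw_self y, mul_sw, sw_sw _ _ hl hr]
  congr 1
  ext c d
  rw [Algebra.TensorProduct.tmul_mul_tmul, sw_of_tmul _ _ hl hr]

/-- Translates `balance`, diagonal actions and the Yetter-Drinfeld conditions, all of which are
stated with `TensorProduct.map₂`. -/
theorem map₂_eq_sw (f : A →ₗ[k] C →ₗ[k] P) (g : B →ₗ[k] D →ₗ[k] Q) (x : A ⊗[k] B)
    (y : C ⊗[k] D) :
    TensorProduct.map₂ f g x y = sw x (fun a b => sw y (fun c d => f a c ⊗ₜ[k] g b d)) := by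
  rw [show TensorProduct.map₂ f g x y = (LinearMap.flip (TensorProduct.map₂ f g) y) x from rfl,
    apply_eq_sw (LinearMap.flip (TensorProduct.map₂ f g) y)]
  congr 1
  ext a b
  rw [LinearMap.flip_apply, apply_eq_sw (TensorProduct.map₂ f g (a ⊗ₜ b))]
  simp only [TensorProduct.map₂_apply_tmul, TensorProduct.map_tmul]

theorem sw_assoc {f : A → B → C → P} (x : (A ⊗[k] B) ⊗[k] C)
    (h₁ : ∀ b c, Lin k (fun a => f a b c)) (h₂ : ∀ a c, Lin k (fun b => f a b c))
    (h₃ : ∀ a b, Lin k (fun c => f a b c)) :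
    sw (TensorProduct.assoc k A B C x) (fun a y => sw y (fun b c => f a b c)) =
      sw x (fun y c => sw y (fun a b => f a b c)) := by
  rw [← LinearEquiv.coe_coe, apply_eq_sw (TensorProduct.assoc k A B C).toLinearMap x,
    sw_sw _ _ (by fun_prop) (by fun_prop)]
  congr 1
  ext y c
  rw [show (TensorProduct.assoc k A B C).toLinearMap (y ⊗ₜ[k] c) =
      ((TensorProduct.assoc k A B C).toLinearMap ∘ₗ (TensorProduct.mk k _ _).flip c) y from rfl,
    apply_eq_sw (_ ∘ₗ _), sw_sw _ _ (by fun_prop) (by fun_prop)]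
  congr 1
  ext a b
  simp only [LinearMap.comp_apply, LinearMap.flip_apply, TensorProduct.mk_apply,
    LinearEquiv.coe_coe, TensorProduct.assoc_tmul]
  rw [sw_of_tmul _ _ (by fun_prop) (by fun_prop), sw_of_tmul _ _ (by fun_prop) (by fun_prop)]

section Coalgebra

variable {H : Type*} [AddCommGroup H] [Module k H] [Coalgebra k H]

/-- Coassociativity: a second coproduct may be taken on either leg of the first. -/
theorem sw_comul {f : H → H → H → P}
    (h : H) (h₁ : ∀ b c, Lin k (fun a => f a b c)) (h₂ : ∀ a c, Lin k (fun b => f a b c))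
    (h₃ : ∀ a b, Lin k (fun c => f a b c)) :
    sw (Coalgebra.comul (R := k) h) (fun a b => sw (Coalgebra.comul (R := k) a)
      (fun c d => f c d b)) =
    sw (Coalgebra.comul (R := k) h) (fun a b => sw (Coalgebra.comul (R := k) b)
      (fun c d => f a c d)) := by
  have := congrArg (fun y => sw y (fun a y => sw y (fun c d => f a c d)))
    (Coalgebra.coassoc_apply (R := k) h)
  rw [sw_assoc _ h₁ h₂ h₃, sw_rTensor _ _ (by fun_prop) (by fun_prop),
    sw_lTensor _ _ (by fun_prop) (by fun_prop)] at this
  exact this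

theorem sw_counit_left {f : H → P} (h : H) (hf : Lin k f) :
    sw (Coalgebra.comul (R := k) h) (fun a b => (Coalgebra.counit (R := k) a : k) • f b) =
      f h := by
  have := congrArg (fun y => sw y (fun a b => a • f b)) (Coalgebra.rTensor_counit_comul (R := k) h)
  rwa [sw_rTensor _ _ (by fun_prop) (by fun_prop), sw_of_tmul _ _ (by fun_prop) (by fun_prop),
    one_smul] at this

theorem sw_counit_right {f : H → P} (h : H) (hf : Lin k f) :
    sw (Coalgebra.comul (R := k) h) (fun a b => (Coalgebra.counit (R := k) b : k) • f a) =
      f h := by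
  have := congrArg (fun y => sw y (fun a b => b • f a)) (Coalgebra.lTensor_counit_comul (R := k) h)
  rwa [sw_lTensor _ _ (by fun_prop) (by fun_prop), sw_of_tmul _ _ (by fun_prop) (by fun_prop),
    one_smul] at this

end Coalgebra

theorem lTensor_eq_sw (g : B →ₗ[k] C) (x : A ⊗[k] B) :
    g.lTensor A x = sw x (fun a b => a ⊗ₜ[k] g b) := by
  rw [apply_eq_sw (g.lTensor A)]
  rfl

theorem rTensor_eq_sw (g : A →ₗ[k] C) (x : A ⊗[k] B) :
    g.rTensor B x = sw x (fun a b => g a ⊗ₜ[k] b) := by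
  rw [apply_eq_sw (g.rTensor B)]
  rfl

theorem map_eq_sw (f : A →ₗ[k] C) (g : B →ₗ[k] D) (x : A ⊗[k] B) :
    TensorProduct.map f g x = sw x (fun a b => f a ⊗ₜ[k] g b) := by
  rw [apply_eq_sw (TensorProduct.map f g)]
  rfl

theorem lid_eq_sw (x : k ⊗[k] A) : TensorProduct.lid k A x = sw x (fun c a => c • a) := by
  rw [← LinearEquiv.coe_coe, apply_eq_sw (TensorProduct.lid k A).toLinearMap]
  rfl

theorem rid_eq_sw (x : A ⊗[k] k) : TensorProduct.rid k A x = sw x (fun a c => c • a) := by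
  rw [← LinearEquiv.coe_coe, apply_eq_sw (TensorProduct.rid k A).toLinearMap]
  rfl

theorem assoc_eq_sw (x : (A ⊗[k] B) ⊗[k] C) : TensorProduct.assoc k A B C x =
    sw x (fun y c => sw y (fun a b => a ⊗ₜ[k] (b ⊗ₜ[k] c))) := by
  rw [← sw_self (TensorProduct.assoc k A B C x)]
  conv_lhs => enter [2, a, y]; rw [← sw_self y, tmul_sw]
  rw [sw_assoc _ (by fun_prop) (by fun_prop) (by fun_prop)]

end Calculus

/-! ### Weak bialgebras: the axioms in Sweedler form -/

section WeakBialgebra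

variable {k : Type*} {H : Type*} [CommRing k] [Ring H] [Algebra k H] [Coalgebra k H]
variable {P : Type*} [AddCommGroup P] [Module k P]

local notation "Δ" => Coalgebra.comul (R := k) (A := H)
local notation "ε" => Coalgebra.counit (R := k) (A := H)

theorem epsT_eq (h : H) : epsT k H h = sw (Δ 1) (fun a b => ε (a * h) • b) := by
  rw [epsT, LinearMap.coe_mk, AddHom.coe_mk, ← LinearEquiv.coe_coe, ← LinearMap.comp_apply,
    apply_eq_sw (_ ∘ₗ _)]
  simp [counitMul]

theorem epsS_eq (h : H) : epsS k H h = sw (Δ 1) (fun a b => ε (h * b) • a) := by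
  rw [epsS, LinearMap.coe_mk, AddHom.coe_mk, ← LinearEquiv.coe_coe, ← LinearMap.comp_apply,
    apply_eq_sw (_ ∘ₗ _)]
  simp [counitMul]

theorem epsTBar_eq (h : H) : epsTBar k H h = sw (Δ 1) (fun a b => ε (h * a) • b) := by
  rw [epsTBar, LinearMap.coe_mk, AddHom.coe_mk, ← LinearEquiv.coe_coe, ← LinearMap.comp_apply,
    apply_eq_sw (_ ∘ₗ _)]
  simp [counitMul]

theorem epsSBar_eq (h : H) : epsSBar k H h = sw (Δ 1) (fun a b => ε (b * h) • a) := by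
  rw [epsSBar, LinearMap.coe_mk, AddHom.coe_mk, ← LinearEquiv.coe_coe, ← LinearMap.comp_apply,
    apply_eq_sw (_ ∘ₗ _)]
  simp [counitMul]

variable [WeakBialgebra k H]

theorem sw_comul_mul {f : H → H → P} (g h : H) (hl : ∀ b, Lin k (fun a => f a b))
    (hr : ∀ a, Lin k (fun b => f a b)) :
    sw (Δ (g * h)) f = sw (Δ g) (fun a b => sw (Δ h) (fun c d => f (a * c) (b * d))) := by
  rw [WeakBialgebra.comul_mul, sw_mul_tensor _ _ hl hr]

/-- One of the two factorizations of Δ²(1), with middle leg 1₂1₁'. The primed version has middle leg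
1₁'1₂. Which of them applies below is dictated by the side on which a further factor sits. -/
theorem sw_one_comul {f : H → H → H → P} (h₁ : ∀ b c, Lin k (fun a => f a b c))
    (h₂ : ∀ a c, Lin k (fun b => f a b c)) (h₃ : ∀ a b, Lin k (fun c => f a b c)) :
    sw (Δ 1) (fun a b => sw (Δ b) (fun c d => f a c d)) =
      sw (Δ 1) (fun a b => sw (Δ 1) (fun c d => f a (b * c) d)) := by
  have := congrArg (fun y => sw y (fun a y => sw y (fun c d => f a c d)))
    (WeakBialgebra.comul_comul_one (k := k) (H := H))
  rw [sw_lTensor _ _ (by fun_prop) (by fun_prop), sw_mul_tensor _ _ (by fun_prop) (by fun_prop)]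
    at this
  simp (disch := fun_prop) only [sw_of_tmul, mul_one, sw_mul_tensor] at this
  rw [this, sw_assoc (f := fun a b c => sw (Δ 1) (fun c_1 d => f a (b * c_1) (c * d))) _
    (by fun_prop) (by fun_prop) (by fun_prop)]
  simp (disch := fun_prop) only [sw_of_tmul, one_mul]

theorem sw_one_comul' {f : H → H → H → P} (h₁ : ∀ b c, Lin k (fun a => f a b c))
    (h₂ : ∀ a c, Lin k (fun b => f a b c)) (h₃ : ∀ a b, Lin k (fun c => f a b c)) :
    sw (Δ 1) (fun a b => sw (Δ b) (fun c d => f a c d)) =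
      sw (Δ 1) (fun a b => sw (Δ 1) (fun c d => f a (c * b) d)) := by
  have := congrArg (fun y => sw y (fun a y => sw y (fun c d => f a c d)))
    (WeakBialgebra.comul_comul_one' (k := k) (H := H))
  rw [sw_lTensor _ _ (by fun_prop) (by fun_prop), sw_mul_tensor _ _ (by fun_prop) (by fun_prop)]
    at this
  simp (disch := fun_prop) only [sw_of_tmul, one_mul, sw_mul_tensor] at this
  simp only [sw_comm (Δ 1)] at this
  rw [this, sw_assoc (f := fun a b c => sw (Δ 1) (fun c_1 d => f a (c_1 * b) (d * c))) _
    (by fun_prop) (by fun_prop) (by fun_prop)]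
  simp (disch := fun_prop) only [sw_of_tmul, mul_one]

theorem counit_mul_mul_eq (h g l : H) :
    ε (h * g * l) = sw (Δ g) (fun a b => ε (h * a) * ε (b * l)) := by
  rw [WeakBialgebra.counit_mul_mul, ← LinearMap.comp_apply, apply_eq_sw (_ ∘ₗ _)]
  simp

theorem counit_mul_mul_eq' (h g l : H) :
    ε (h * g * l) = sw (Δ g) (fun a b => ε (a * l) * ε (h * b)) := by
  rw [WeakBialgebra.counit_mul_mul', ← LinearMap.comp_apply, apply_eq_sw (_ ∘ₗ _)]
  simp

/-! #### The counital maps and the counit -/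

/-- Weak multiplicativity of ε with middle argument 1: ε(g1₂)ε(1₁h) = ε(gh). The three analogues for
ε̄_s, ε_s and ε̄_t arise in the same way from one of the two forms of the axiom. -/
theorem counit_mul_epsT (g h : H) : ε (g * epsT k H h) = ε (g * h) := by
  have := counit_mul_mul_eq' (k := k) g 1 h
  rw [mul_one] at this
  simp [this, epsT_eq, mul_sw, map_sw]

theorem counit_mul_epsSBar (g h : H) : ε (g * epsSBar k H h) = ε (g * h) := by
  have := counit_mul_mul_eq (k := k) g 1 h
  rw [mul_one] at this
  simp [this, epsSBar_eq, mul_sw, map_sw, mul_comm]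

theorem counit_epsS_mul (g h : H) : ε (epsS k H g * h) = ε (g * h) := by
  have := counit_mul_mul_eq' (k := k) g 1 h
  rw [mul_one] at this
  simp [this, epsS_eq, sw_mul, map_sw, mul_comm]

theorem counit_epsTBar_mul (g h : H) : ε (epsTBar k H g * h) = ε (g * h) := by
  have := counit_mul_mul_eq (k := k) g 1 h
  rw [mul_one] at this
  simp [this, epsTBar_eq, sw_mul, map_sw]

/-- The outer counital map sees its argument only through ε, where the inner one can be erased. The
same reason covers the family that follows. -/
theorem epsT_mul_epsT (g h : H) : epsT k H (g * epsT k H h) = epsT k H (g * h) := by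
  simp only [epsT_eq (_ * _), ← mul_assoc, counit_mul_epsT]

theorem epsT_mul_epsSBar (g h : H) : epsT k H (g * epsSBar k H h) = epsT k H (g * h) := by
  simp only [epsT_eq (_ * _), ← mul_assoc, counit_mul_epsSBar]

theorem epsSBar_mul_epsT (g h : H) : epsSBar k H (g * epsT k H h) = epsSBar k H (g * h) := by
  simp only [epsSBar_eq (_ * _), ← mul_assoc, counit_mul_epsT]

theorem epsSBar_mul_epsSBar (g h : H) :
    epsSBar k H (g * epsSBar k H h) = epsSBar k H (g * h) := by
  simp only [epsSBar_eq (_ * _), ← mul_assoc, counit_mul_epsSBar]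

theorem epsS_epsS_mul (g h : H) : epsS k H (epsS k H g * h) = epsS k H (g * h) := by
  simp only [epsS_eq (_ * _), mul_assoc, counit_epsS_mul]

theorem epsS_epsTBar_mul (g h : H) : epsS k H (epsTBar k H g * h) = epsS k H (g * h) := by
  simp only [epsS_eq (_ * _), mul_assoc, counit_epsTBar_mul]

theorem epsTBar_epsS_mul (g h : H) : epsTBar k H (epsS k H g * h) = epsTBar k H (g * h) := by
  simp only [epsTBar_eq (_ * _), mul_assoc, counit_epsS_mul]

theorem epsT_epsT (h : H) : epsT k H (epsT k H h) = epsT k H h := by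
  simpa using epsT_mul_epsT (k := k) 1 h

theorem epsT_epsSBar (h : H) : epsT k H (epsSBar k H h) = epsT k H h := by
  simpa using epsT_mul_epsSBar (k := k) 1 h

theorem epsSBar_epsT (h : H) : epsSBar k H (epsT k H h) = epsSBar k H h := by
  simpa using epsSBar_mul_epsT (k := k) 1 h

theorem epsS_epsS (h : H) : epsS k H (epsS k H h) = epsS k H h := by
  simpa using epsS_epsS_mul (k := k) h 1

theorem epsS_epsTBar (h : H) : epsS k H (epsTBar k H h) = epsS k H h := by
  simpa using epsS_epsTBar_mul (k := k) h 1

theorem epsTBar_epsS (h : H) : epsTBar k H (epsS k H h) = epsTBar k H h := by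
  simpa using epsTBar_epsS_mul (k := k) h 1

theorem sw_one_mul {f : H → H → P} (h : H) (hl : ∀ b, Lin k (fun a => f a b))
    (hr : ∀ a, Lin k (fun b => f a b)) :
    sw (Δ 1) (fun a b => sw (Δ h) (fun c d => f (a * c) (b * d))) = sw (Δ h) f := by
  rw [← sw_comul_mul _ _ hl hr, one_mul]

theorem sw_mul_one {f : H → H → P} (h : H) (hl : ∀ b, Lin k (fun a => f a b))
    (hr : ∀ a, Lin k (fun b => f a b)) :
    sw (Δ h) (fun a b => sw (Δ 1) (fun c d => f (a * c) (b * d))) = sw (Δ h) f := by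
  rw [← sw_comul_mul _ _ hl hr, mul_one]

/-- Expand h₁ ⊗ ε_t(h₂) as ε(1₁h₂)h₁ ⊗ 1₂ and replace Δ(h) by Δ(1)Δ(h). The two copies of Δ(1)
combine to Δ²(1), and what remains is the counit applied to the second leg of Δ(1₁h). -/
theorem sw_comul_epsT {f : H → H → P} (h : H) (hl : ∀ b, Lin k (fun a => f a b))
    (hr : ∀ a, Lin k (fun b => f a b)) :
    sw (Δ h) (fun a b => f a (epsT k H b)) = sw (Δ 1) (fun a b => f (a * h) b) := by
  -- The case of the universal bilinear map ⊗ suffices, since every bilinear `f` factors through it.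
  suffices key : sw (Δ h) (fun a b => a ⊗ₜ[k] epsT k H b) =
      sw (Δ 1) (fun a b => (a * h) ⊗ₜ[k] b) by
    simpa only [map_sw, liftLin_tmul] using congrArg (liftLin hl hr) key
  calc _ = sw (Δ 1) (fun c d => sw (Δ h) (fun a b => ε (c * b) • a ⊗ₜ[k] d)) := by
        rw [sw_comm]; simp only [epsT_eq, tmul_sw, TensorProduct.tmul_smul]
    _ = sw (Δ 1) (fun c d => sw (Δ 1) (fun a b => sw (Δ h) (fun a' b' =>
          ε (c * (b * b')) • (a * a') ⊗ₜ[k] d))) := by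
        refine sw_congr fun c d => ?_
        rw [sw_one_mul (f := fun a b => ε (c * b) • a ⊗ₜ[k] d) _ (by fun_prop) (by fun_prop)]
    _ = sw (Δ 1) (fun a b => sw (Δ b) (fun c d => sw (Δ h) (fun a' b' =>
          ε (c * b') • (a * a') ⊗ₜ[k] d))) := by
        rw [sw_one_comul' (by fun_prop) (by fun_prop) (by fun_prop), sw_comm]
        simp only [mul_assoc]
    _ = _ := by
        rw [← sw_comul _ (by fun_prop) (by fun_prop) (by fun_prop)]
        refine sw_congr fun a b => ?_
        rw [← sw_comul_mul (f := fun a d => ε d • a ⊗ₜ[k] b) _ _ (by fun_prop) (by fun_prop),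
          sw_counit_right (f := fun a => a ⊗ₜ[k] b) _ (by fun_prop)]

/-- The mirror image of the argument for ε_t, with Δ(1) inserted on the right of Δ(h). The two
barred versions differ only in the side of the insertion and in the factorization of Δ²(1) used. -/
theorem sw_comul_epsS {f : H → H → P} (h : H) (hl : ∀ b, Lin k (fun a => f a b))
    (hr : ∀ a, Lin k (fun b => f a b)) :
    sw (Δ h) (fun a b => f (epsS k H a) b) = sw (Δ 1) (fun a b => f a (h * b)) := by
  suffices key : sw (Δ h) (fun a b => epsS k H a ⊗ₜ[k] b) =
      sw (Δ 1) (fun a b => a ⊗ₜ[k] (h * b)) by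
    simpa only [map_sw, liftLin_tmul] using congrArg (liftLin hl hr) key
  calc _ = sw (Δ 1) (fun c d => sw (Δ h) (fun a b => ε (a * d) • c ⊗ₜ[k] b)) := by
        rw [sw_comm]; simp only [epsS_eq, sw_tmul, TensorProduct.smul_tmul']
    _ = sw (Δ 1) (fun c d => sw (Δ h) (fun a b => sw (Δ 1) (fun a' b' =>
          ε (a * a' * d) • c ⊗ₜ[k] (b * b')))) := by
        refine sw_congr fun c d => ?_
        rw [sw_mul_one (f := fun a b => ε (a * d) • c ⊗ₜ[k] b) _ (by fun_prop) (by fun_prop)]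
    _ = sw (Δ 1) (fun a b => sw (Δ b) (fun c d => sw (Δ h) (fun a' b' =>
          ε (a' * c) • a ⊗ₜ[k] (b' * d)))) := by
        rw [sw_one_comul' (by fun_prop) (by fun_prop) (by fun_prop)]
        refine sw_congr fun c d => ?_
        rw [sw_comm]
        simp only [mul_assoc]
    _ = _ := by
        refine sw_congr fun a b => ?_
        rw [sw_comm, ← sw_comul_mul (f := fun c d => ε c • a ⊗ₜ[k] d) _ _ (by fun_prop) (by fun_prop),
          sw_counit_left (f := fun d => a ⊗ₜ[k] d) _ (by fun_prop)]

theorem sw_comul_epsTBar {f : H → H → P} (h : H) (hl : ∀ b, Lin k (fun a => f a b))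
    (hr : ∀ a, Lin k (fun b => f a b)) :
    sw (Δ h) (fun a b => f a (epsTBar k H b)) = sw (Δ 1) (fun a b => f (h * a) b) := by
  suffices key : sw (Δ h) (fun a b => a ⊗ₜ[k] epsTBar k H b) =
      sw (Δ 1) (fun a b => (h * a) ⊗ₜ[k] b) by
    simpa only [map_sw, liftLin_tmul] using congrArg (liftLin hl hr) key
  calc _ = sw (Δ 1) (fun c d => sw (Δ h) (fun a b => ε (b * c) • a ⊗ₜ[k] d)) := by
        rw [sw_comm]; simp only [epsTBar_eq, tmul_sw, TensorProduct.tmul_smul]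
    _ = sw (Δ 1) (fun c d => sw (Δ h) (fun a b => sw (Δ 1) (fun a' b' =>
          ε (b * b' * c) • (a * a') ⊗ₜ[k] d))) := by
        refine sw_congr fun c d => ?_
        rw [sw_mul_one (f := fun a b => ε (b * c) • a ⊗ₜ[k] d) _ (by fun_prop) (by fun_prop)]
    _ = sw (Δ 1) (fun a b => sw (Δ b) (fun c d => sw (Δ h) (fun a' b' =>
          ε (b' * c) • (a' * a) ⊗ₜ[k] d))) := by
        rw [sw_one_comul (by fun_prop) (by fun_prop) (by fun_prop), sw_comm (Δ 1) (Δ 1)]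
        refine sw_congr fun c d => ?_
        rw [sw_comm]
        simp only [mul_assoc]
    _ = _ := by
        rw [← sw_comul _ (by fun_prop) (by fun_prop) (by fun_prop)]
        refine sw_congr fun a b => ?_
        rw [sw_comm, ← sw_comul_mul (f := fun a d => ε d • a ⊗ₜ[k] b) _ _ (by fun_prop)
          (by fun_prop), sw_counit_right (f := fun a => a ⊗ₜ[k] b) _ (by fun_prop)]

theorem sw_comul_epsSBar {f : H → H → P} (h : H) (hl : ∀ b, Lin k (fun a => f a b))
    (hr : ∀ a, Lin k (fun b => f a b)) :
    sw (Δ h) (fun a b => f (epsSBar k H a) b) = sw (Δ 1) (fun a b => f a (b * h)) := by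
  suffices key : sw (Δ h) (fun a b => epsSBar k H a ⊗ₜ[k] b) =
      sw (Δ 1) (fun a b => a ⊗ₜ[k] (b * h)) by
    simpa only [map_sw, liftLin_tmul] using congrArg (liftLin hl hr) key
  calc _ = sw (Δ 1) (fun c d => sw (Δ h) (fun a b => ε (d * a) • c ⊗ₜ[k] b)) := by
        rw [sw_comm]; simp only [epsSBar_eq, sw_tmul, TensorProduct.smul_tmul']
    _ = sw (Δ 1) (fun c d => sw (Δ 1) (fun a b => sw (Δ h) (fun a' b' =>
          ε (d * (a * a')) • c ⊗ₜ[k] (b * b')))) := by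
        refine sw_congr fun c d => ?_
        rw [sw_one_mul (f := fun a b => ε (d * a) • c ⊗ₜ[k] b) _ (by fun_prop) (by fun_prop)]
    _ = sw (Δ 1) (fun a b => sw (Δ b) (fun c d => sw (Δ h) (fun a' b' =>
          ε (c * a') • a ⊗ₜ[k] (d * b')))) := by
        rw [sw_one_comul (by fun_prop) (by fun_prop) (by fun_prop)]
        simp only [mul_assoc]
    _ = _ := by
        refine sw_congr fun a b => ?_
        rw [← sw_comul_mul (f := fun c d => ε c • a ⊗ₜ[k] d) _ _ (by fun_prop) (by fun_prop),
          sw_counit_left (f := fun d => a ⊗ₜ[k] d) _ (by fun_prop)]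

/-- The second leg of Δ(1) may be taken in H_t; the next lemma puts the first in H_s. Inserting ε_t
or ε_s into Δ(1), using that the leg is then a target or source element, and removing it again is
the standard manoeuvre of the whole proof. -/
theorem sw_one_epsT {f : H → H → P} (hl : ∀ b, Lin k (fun a => f a b))
    (hr : ∀ a, Lin k (fun b => f a b)) :
    sw (Δ 1) (fun a b => f a (epsT k H b)) = sw (Δ 1) f := by
  simpa using sw_comul_epsT 1 hl hr

theorem sw_one_epsS {f : H → H → P} (hl : ∀ b, Lin k (fun a => f a b))
    (hr : ∀ a, Lin k (fun b => f a b)) :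
    sw (Δ 1) (fun a b => f (epsS k H a) b) = sw (Δ 1) f := by
  simpa using sw_comul_epsS 1 hl hr

theorem epsT_one : epsT k H 1 = 1 := by
  rw [epsT_eq]
  simp only [mul_one]
  exact sw_counit_left (f := fun a => a) 1 (by fun_prop)

theorem epsTBar_one : epsTBar k H 1 = 1 := by
  rw [epsTBar_eq]
  simp only [one_mul]
  exact sw_counit_left (f := fun a => a) 1 (by fun_prop)

theorem epsSBar_one : epsSBar k H 1 = 1 := by
  rw [epsSBar_eq]
  simp only [mul_one]
  exact sw_counit_right (f := fun a => a) 1 (by fun_prop)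

/-- The sum is the counit applied to the first leg of Δ(1)Δ(h) = Δ(h). -/
theorem sw_epsT_mul_self (h : H) : sw (Δ h) (fun a b => epsT k H a * b) = h := by
  simp only [epsT_eq, sw_mul]
  rw [sw_comm]
  simp only [smul_mul_assoc]
  rw [← sw_comul_mul (f := fun a b => ε a • b) _ _ (by fun_prop) (by fun_prop), one_mul,
    sw_counit_left (f := fun x => x) _ (by fun_prop)]

theorem sw_epsSBar_mul_self (h : H) : sw (Δ h) (fun a b => epsSBar k H b * a) = h := by
  simp only [epsSBar_eq, sw_mul]
  rw [sw_comm]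
  simp only [smul_mul_assoc]
  rw [← sw_comul_mul (f := fun a b => ε b • a) _ _ (by fun_prop) (by fun_prop), one_mul,
    sw_counit_right (f := fun x => x) _ (by fun_prop)]

/-! #### The target and source subalgebras -/

/-- Exposes the copy of Δ(1) hidden in ε_t(h) anywhere inside a linear expression, including inside
a coproduct. The three companions do the same for the other counital maps. -/
theorem Lin.map_epsT {g : H → P} (hg : Lin k g) (h : H) :
    g (epsT k H h) = sw (Δ 1) (fun a b => ε (a * h) • g b) := by
  rw [epsT_eq, hg.map_sw]
  exact sw_congr fun a b => hg.map_smul _ _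

theorem Lin.map_epsS {g : H → P} (hg : Lin k g) (h : H) :
    g (epsS k H h) = sw (Δ 1) (fun a b => ε (h * b) • g a) := by
  rw [epsS_eq, hg.map_sw]
  exact sw_congr fun a b => hg.map_smul _ _

theorem Lin.map_epsTBar {g : H → P} (hg : Lin k g) (h : H) :
    g (epsTBar k H h) = sw (Δ 1) (fun a b => ε (h * a) • g b) := by
  rw [epsTBar_eq, hg.map_sw]
  exact sw_congr fun a b => hg.map_smul _ _

theorem Lin.map_epsSBar {g : H → P} (hg : Lin k g) (h : H) :
    g (epsSBar k H h) = sw (Δ 1) (fun a b => ε (b * h) • g a) := by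
  rw [epsSBar_eq, hg.map_sw]
  exact sw_congr fun a b => hg.map_smul _ _

section

variable {f : H → H → P} (h : H)

/-- Apply ε(–h) to the first leg of Δ²(1). Its two factorizations give Δ(z) = 1₁z ⊗ 1₂ and Δ(z) =
z1₁ ⊗ 1₂ for z = ε_t(h). -/
theorem sw_comul_of_epsT (hl : ∀ b, Lin k (fun a => f a b)) (hr : ∀ a, Lin k (fun b => f a b)) :
    sw (Δ (epsT k H h)) f = sw (Δ 1) (fun a b => f (a * epsT k H h) b) := by
  rw [Lin.map_epsT (k := k) (g := fun t => sw (Δ t) f) (by fun_prop)]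
  simp only [smul_sw]
  rw [sw_one_comul' (by fun_prop) (by fun_prop) (by fun_prop), sw_comm]
  refine sw_congr fun a b => ?_
  rw [Lin.map_epsT (k := k) (g := fun t => f (a * t) b) (by fun_prop)]

theorem sw_comul_of_epsT' (hl : ∀ b, Lin k (fun a => f a b)) (hr : ∀ a, Lin k (fun b => f a b)) :
    sw (Δ (epsT k H h)) f = sw (Δ 1) (fun a b => f (epsT k H h * a) b) := by
  rw [Lin.map_epsT (k := k) (g := fun t => sw (Δ t) f) (by fun_prop)]
  simp only [smul_sw]
  rw [sw_one_comul (by fun_prop) (by fun_prop) (by fun_prop), sw_comm]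
  refine sw_congr fun a b => ?_
  rw [Lin.map_epsT (k := k) (g := fun t => f (t * a) b) (by fun_prop)]

theorem sw_comul_of_epsTBar (hl : ∀ b, Lin k (fun a => f a b))
    (hr : ∀ a, Lin k (fun b => f a b)) :
    sw (Δ (epsTBar k H h)) f = sw (Δ 1) (fun a b => f (a * epsTBar k H h) b) := by
  rw [Lin.map_epsTBar (k := k) (g := fun t => sw (Δ t) f) (by fun_prop)]
  simp only [smul_sw]
  rw [sw_one_comul' (by fun_prop) (by fun_prop) (by fun_prop), sw_comm]
  refine sw_congr fun a b => ?_
  rw [Lin.map_epsTBar (k := k) (g := fun t => f (a * t) b) (by fun_prop)]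

theorem sw_comul_of_epsS (hl : ∀ b, Lin k (fun a => f a b)) (hr : ∀ a, Lin k (fun b => f a b)) :
    sw (Δ (epsS k H h)) f = sw (Δ 1) (fun a b => f a (b * epsS k H h)) := by
  rw [Lin.map_epsS (k := k) (g := fun t => sw (Δ t) f) (by fun_prop)]
  simp only [smul_sw]
  rw [sw_comul (f := fun c d b => ε (h * b) • f c d) _ (by fun_prop) (by fun_prop) (by fun_prop),
    sw_one_comul (by fun_prop) (by fun_prop) (by fun_prop)]
  refine sw_congr fun a b => ?_
  rw [Lin.map_epsS (k := k) (g := fun t => f a (b * t)) (by fun_prop)]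

theorem sw_comul_of_epsS' (hl : ∀ b, Lin k (fun a => f a b)) (hr : ∀ a, Lin k (fun b => f a b)) :
    sw (Δ (epsS k H h)) f = sw (Δ 1) (fun a b => f a (epsS k H h * b)) := by
  rw [Lin.map_epsS (k := k) (g := fun t => sw (Δ t) f) (by fun_prop)]
  simp only [smul_sw]
  rw [sw_comul (f := fun c d b => ε (h * b) • f c d) _ (by fun_prop) (by fun_prop) (by fun_prop),
    sw_one_comul' (by fun_prop) (by fun_prop) (by fun_prop)]
  refine sw_congr fun a b => ?_
  rw [Lin.map_epsS (k := k) (g := fun t => f a (t * b)) (by fun_prop)]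

theorem sw_comul_of_epsSBar (hl : ∀ b, Lin k (fun a => f a b))
    (hr : ∀ a, Lin k (fun b => f a b)) :
    sw (Δ (epsSBar k H h)) f = sw (Δ 1) (fun a b => f a (epsSBar k H h * b)) := by
  rw [Lin.map_epsSBar (k := k) (g := fun t => sw (Δ t) f) (by fun_prop)]
  simp only [smul_sw]
  rw [sw_comul (f := fun c d b => ε (b * h) • f c d) _ (by fun_prop) (by fun_prop) (by fun_prop),
    sw_one_comul' (by fun_prop) (by fun_prop) (by fun_prop)]
  refine sw_congr fun a b => ?_
  rw [Lin.map_epsSBar (k := k) (g := fun t => f a (t * b)) (by fun_prop)]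

end

/-- Apply ε to the first leg of Δ(z) = z1₁ ⊗ 1₂. Together with the next lemma this shows that ε_t
and ε̄_t have the same image; the following two do the same for ε_s and ε̄_s. -/
theorem epsTBar_epsT (h : H) : epsTBar k H (epsT k H h) = epsT k H h := by
  conv_rhs => rw [← sw_counit_left (k := k) (f := fun b => b) (epsT k H h) (by fun_prop)]
  rw [sw_comul_of_epsT' _ (by fun_prop) (by fun_prop), epsTBar_eq]

theorem epsT_epsTBar (h : H) : epsT k H (epsTBar k H h) = epsTBar k H h := by
  conv_rhs => rw [← sw_counit_left (k := k) (f := fun b => b) (epsTBar k H h) (by fun_prop)]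
  rw [sw_comul_of_epsTBar _ (by fun_prop) (by fun_prop), epsT_eq]

theorem epsSBar_epsS (h : H) : epsSBar k H (epsS k H h) = epsS k H h := by
  conv_rhs => rw [← sw_counit_right (k := k) (f := fun b => b) (epsS k H h) (by fun_prop)]
  rw [sw_comul_of_epsS _ (by fun_prop) (by fun_prop), epsSBar_eq]

theorem epsS_epsSBar (h : H) : epsS k H (epsSBar k H h) = epsSBar k H h := by
  conv_rhs => rw [← sw_counit_right (k := k) (f := fun b => b) (epsSBar k H h) (by fun_prop)]
  rw [sw_comul_of_epsSBar _ (by fun_prop) (by fun_prop), epsS_eq]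

/-- The two factorizations of Δ²(1) differ only in the order of the product in the middle leg. Apply
ε(–h) to the first leg and ε(g–) to the third. -/
theorem epsT_mul_epsS_comm (g h : H) : epsT k H h * epsS k H g = epsS k H g * epsT k H h := by
  have h₁ := sw_one_comul (k := k) (H := H) (f := fun a b c => (ε (a * h) * ε (g * c)) • b)
    (by fun_prop) (by fun_prop) (by fun_prop)
  rw [sw_one_comul' (by fun_prop) (by fun_prop) (by fun_prop)] at h₁
  simp only [epsT_eq, epsS_eq, sw_mul, mul_sw, smul_mul_smul_comm]
  rw [sw_comm, ← h₁]
  simp only [mul_comm (ε (_ * h))]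

/-- Membership in the target subalgebra. -/
def IsTarget (k : Type*) {H : Type*} [CommRing k] [Ring H] [Algebra k H] [Coalgebra k H]
    (z : H) : Prop := epsT k H z = z

/-- Membership in the source subalgebra. -/
def IsSource (k : Type*) {H : Type*} [CommRing k] [Ring H] [Algebra k H] [Coalgebra k H]
    (y : H) : Prop := epsS k H y = y

theorem isTarget_epsT (h : H) : IsTarget k (epsT k H h) := epsT_epsT h
theorem isTarget_epsTBar (h : H) : IsTarget k (epsTBar k H h) := epsT_epsTBar h
theorem isSource_epsS (h : H) : IsSource k (epsS k H h) := epsS_epsS h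
theorem isSource_epsSBar (h : H) : IsSource k (epsSBar k H h) := epsS_epsSBar h

theorem IsTarget.epsTBar {z : H} (hz : IsTarget k z) : epsTBar k H z = z := by
  rw [← hz, epsTBar_epsT]

theorem IsSource.epsSBar {y : H} (hy : IsSource k y) : epsSBar k H y = y := by
  rw [← hy, epsSBar_epsS]

section

variable {f : H → H → P} {y z : H}

theorem IsTarget.sw_comul (hz : IsTarget k z) (hl : ∀ b, Lin k (fun a => f a b))
    (hr : ∀ a, Lin k (fun b => f a b)) : sw (Δ z) f = sw (Δ 1) (fun a b => f (a * z) b) := by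
  rw [← hz, sw_comul_of_epsT _ hl hr]

theorem IsTarget.sw_comul' (hz : IsTarget k z) (hl : ∀ b, Lin k (fun a => f a b))
    (hr : ∀ a, Lin k (fun b => f a b)) : sw (Δ z) f = sw (Δ 1) (fun a b => f (z * a) b) := by
  rw [← hz, sw_comul_of_epsT' _ hl hr]

theorem IsSource.sw_comul (hy : IsSource k y) (hl : ∀ b, Lin k (fun a => f a b))
    (hr : ∀ a, Lin k (fun b => f a b)) : sw (Δ y) f = sw (Δ 1) (fun a b => f a (b * y)) := by
  rw [← hy, sw_comul_of_epsS _ hl hr]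

theorem IsSource.sw_comul' (hy : IsSource k y) (hl : ∀ b, Lin k (fun a => f a b))
    (hr : ∀ a, Lin k (fun b => f a b)) : sw (Δ y) f = sw (Δ 1) (fun a b => f a (y * b)) := by
  rw [← hy, sw_comul_of_epsS' _ hl hr]

/-- Since Δ(z) = 1₁z ⊗ 1₂, the extra Δ(1) is absorbed by Δ(h). -/
theorem IsTarget.sw_comul_mul (hz : IsTarget k z) (h : H) (hl : ∀ b, Lin k (fun a => f a b))
    (hr : ∀ a, Lin k (fun b => f a b)) :
    sw (Δ (h * z)) f = sw (Δ h) (fun a b => f (a * z) b) := by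
  rw [WeakHopf.sw_comul_mul _ _ hl hr]
  simp (disch := fun_prop) only [hz.sw_comul]
  conv_rhs => rw [← mul_one h, WeakHopf.sw_comul_mul _ _ (by fun_prop) (by fun_prop)]
  simp only [mul_assoc]

theorem IsSource.sw_mul_comul (hy : IsSource k y) (h : H) (hl : ∀ b, Lin k (fun a => f a b))
    (hr : ∀ a, Lin k (fun b => f a b)) :
    sw (Δ (y * h)) f = sw (Δ h) (fun a b => f a (y * b)) := by
  rw [WeakHopf.sw_comul_mul _ _ hl hr, hy.sw_comul' (by fun_prop) (by fun_prop)]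
  conv_rhs => rw [← one_mul h, WeakHopf.sw_comul_mul _ _ (by fun_prop) (by fun_prop)]
  simp only [mul_assoc]

/-- Applying ε to the second leg of Δ(yy') = 1₁ ⊗ yy'1₂ gives ε_s(yy') on one side and yy' on the
other. -/
theorem IsSource.mul (hy : IsSource k y) {y' : H} (hy' : IsSource k y') :
    IsSource k (y * y') := by
  rw [IsSource]
  conv_rhs => rw [← sw_counit_right (k := k) (f := fun b => b) (y * y') (by fun_prop)]
  rw [hy.sw_mul_comul _ (by fun_prop) (by fun_prop), hy'.sw_comul' (by fun_prop) (by fun_prop),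
    epsS_eq]
  simp only [mul_assoc]

/-- The left side is ε̄_s(z₁) ⊗ z₂ = ε̄_s(1₁z) ⊗ 1₂, and ε̄_s(1₁z) = ε̄_s(1₁ε̄_s(z)) = 1₁ε̄_s(z)
because that product already lies in H_s. This relation lets H_t pass between the factors of a
balanced tensor product, and it governs both unit constraints and the triangle identity. -/
theorem IsTarget.sw_one (hz : IsTarget k z) (hl : ∀ b, Lin k (fun a => f a b))
    (hr : ∀ a, Lin k (fun b => f a b)) :
    sw (Δ 1) (fun a b => f a (b * z)) = sw (Δ 1) (fun a b => f (a * epsSBar k H z) b) := by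
  rw [← sw_comul_epsSBar _ hl hr, hz.sw_comul (by fun_prop) (by fun_prop),
    ← sw_one_epsS (by fun_prop) (by fun_prop),
    ← sw_one_epsS (f := fun a b => f (a * epsSBar k H z) b) (by fun_prop) (by fun_prop)]
  refine sw_congr fun a b => ?_
  rw [← epsSBar_mul_epsSBar, ((isSource_epsS a).mul (isSource_epsSBar z)).epsSBar]

end

end WeakBialgebra

/-! ### The antipode and its inverse -/

section Antipode

variable {k : Type*} {H : Type*} [CommRing k] [Ring H] [Algebra k H] [Coalgebra k H]
  [WeakHopfAlgebra k H]
variable {P : Type*} [AddCommGroup P] [Module k P]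

local notation "Δ" => Coalgebra.comul (R := k) (A := H)
local notation "ε" => Coalgebra.counit (R := k) (A := H)
local notation "S" => WeakHopfAlgebra.antipode (k := k) (H := H)

theorem conv_apply (f g : H →ₗ[k] H) (h : H) : conv f g h = sw (Δ h) (fun a b => f a * g b) := by
  rw [conv, LinearMap.comp_apply, LinearMap.comp_apply, ← LinearMap.comp_apply,
    apply_eq_sw (_ ∘ₗ _)]
  simp

theorem sw_antipode_mul (h : H) : sw (Δ h) (fun a b => S a * b) = epsS k H h := by
  rw [← WeakHopfAlgebra.antipode_conv_id, conv_apply]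
  rfl

theorem sw_mul_antipode (h : H) : sw (Δ h) (fun a b => a * S b) = epsT k H h := by
  rw [← WeakHopfAlgebra.id_conv_antipode, conv_apply]
  rfl

/-- The axiom S * id * S = S bracketed to the left; the next lemma brackets it to the right. -/
theorem sw_epsS_mul_antipode (h : H) : sw (Δ h) (fun a b => epsS k H a * S b) = S h := by
  conv_rhs => rw [← WeakHopfAlgebra.antipode_conv_id_conv_antipode, conv_apply,
    WeakHopfAlgebra.antipode_conv_id]

theorem sw_antipode_mul_epsT (h : H) : sw (Δ h) (fun a b => S a * epsT k H b) = S h := by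
  simp only [← sw_mul_antipode, mul_sw]
  rw [← sw_comul _ (by fun_prop) (by fun_prop) (by fun_prop)]
  simp only [← mul_assoc, ← sw_mul, sw_antipode_mul, sw_epsS_mul_antipode]

theorem epsS_one : epsS k H 1 = 1 := by
  rw [epsS_eq]
  simp only [one_mul]
  exact sw_counit_right (f := fun a => a) 1 (by fun_prop)

/-- Replace g by y = ε_s(g) inside ε_s, then use ε_s = S * id and Δ(yh) = h₁ ⊗ yh₂. The target
version is dual. -/
theorem epsS_mul_eq (g h : H) :
    epsS k H (g * h) = sw (Δ h) (fun a b => S a * epsS k H g * b) := by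
  rw [← epsS_epsS_mul, ← sw_antipode_mul,
    (isSource_epsS g).sw_mul_comul _ (by fun_prop) (by fun_prop)]
  simp only [mul_assoc]

theorem epsT_mul_eq (g h : H) :
    epsT k H (g * h) = sw (Δ g) (fun a b => a * epsT k H h * S b) := by
  rw [← epsT_mul_epsT, ← sw_mul_antipode,
    (isTarget_epsT h).sw_comul_mul _ (by fun_prop) (by fun_prop)]

/-- Both sides equal S(h₁)S(g₁)g₂h₂S(g₃h₃). Collecting S(h₁)S(g₁)g₂h₂ gives ε_s(g₁h₁)S(g₂h₂) =
S(gh). Collecting g₂h₂S(g₃h₃) = ε_t(g₂h₂) = g₂ε_t(h₂)S(g₃) gives S(h₁)ε_s(g₁)ε_t(h₂)S(g₂), and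
commuting H_s with H_t splits this into S(h)S(g). -/
theorem antipode_mul (g h : H) : S (g * h) = S h * S g := by
  calc S (g * h) = sw (Δ g) (fun a b => sw (Δ h) (fun c d => epsS k H (a * c) * S (b * d))) := by
        rw [← sw_epsS_mul_antipode, sw_comul_mul _ _ (by fun_prop) (by fun_prop)]
    _ = sw (Δ g) (fun a b => sw (Δ h) (fun c d => sw (Δ c) (fun c₁ c₂ =>
          S c₁ * epsS k H a * c₂ * S (b * d)))) := by
        simp only [epsS_mul_eq, sw_mul]
    _ = sw (Δ g) (fun a b => sw (Δ h) (fun c d => sw (Δ d) (fun c₁ c₂ =>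
          S c * epsS k H a * c₁ * S (b * c₂)))) := by
        refine sw_congr fun a b => ?_
        rw [sw_comul (f := fun c₁ c₂ d => S c₁ * epsS k H a * c₂ * S (b * d)) _ (by fun_prop)
          (by fun_prop) (by fun_prop)]
    _ = sw (Δ g) (fun a b => sw (Δ a) (fun a₁ a₂ => sw (Δ h) (fun c d => sw (Δ d) (fun c₁ c₂ =>
          S c * S a₁ * a₂ * c₁ * S (b * c₂))))) := by
        refine sw_congr fun a b => ?_
        rw [sw_comm]
        refine sw_congr fun c d => ?_
        rw [sw_comm]
        refine sw_congr fun c₁ c₂ => ?_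
        simp only [← sw_antipode_mul, mul_sw, sw_mul, mul_assoc]
    _ = sw (Δ g) (fun a b => sw (Δ b) (fun a₁ a₂ => sw (Δ h) (fun c d => sw (Δ d) (fun c₁ c₂ =>
          S c * S a * a₁ * c₁ * S (a₂ * c₂))))) := by
        rw [sw_comul (f := fun a₁ a₂ b => sw (Δ h) (fun c d => sw (Δ d) (fun c₁ c₂ =>
          S c * S a₁ * a₂ * c₁ * S (b * c₂)))) _ (by fun_prop) (by fun_prop) (by fun_prop)]
    _ = sw (Δ g) (fun a b => sw (Δ h) (fun c d => S c * S a * epsT k H (b * d))) := by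
        refine sw_congr fun a b => ?_
        rw [sw_comm]
        refine sw_congr fun c d => ?_
        rw [← sw_mul_antipode, sw_comul_mul _ _ (by fun_prop) (by fun_prop)]
        simp only [mul_sw, mul_assoc]
    _ = sw (Δ g) (fun a b => sw (Δ h) (fun c d => sw (Δ b) (fun b₁ b₂ =>
          S c * (S a * b₁) * epsT k H d * S b₂))) := by
        simp only [epsT_mul_eq, mul_sw, mul_assoc]
    _ = sw (Δ g) (fun a b => sw (Δ h) (fun c d => S c * epsS k H a * epsT k H d * S b)) := by
        simp only [sw_comm (Δ h)]
        rw [← sw_comul (f := fun a b₁ b₂ => sw (Δ h) (fun c d =>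
          S c * (S a * b₁) * epsT k H d * S b₂)) _ (by fun_prop) (by fun_prop) (by fun_prop)]
        refine sw_congr fun a b => ?_
        rw [sw_comm]
        simp only [← sw_antipode_mul, mul_sw, sw_mul]
    _ = sw (Δ g) (fun a b => sw (Δ h) (fun c d => S c * epsT k H d * (epsS k H a * S b))) := by
        refine sw_congr fun a b => sw_congr fun c d => ?_
        rw [mul_assoc (S c), ← epsT_mul_epsS_comm]
        simp only [mul_assoc]
    _ = S h * S g := by
        simp only [← sw_mul, sw_antipode_mul_epsT, ← mul_sw, sw_epsS_mul_antipode]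

/-- With Δ(z) = 1₁z ⊗ 1₂ one has ε_s(z) = S(1₁z)1₂ = S(z)S(1₁)1₂ = S(z)ε_s(1). -/
theorem antipode_of_isTarget {z : H} (hz : IsTarget k z) : S z = epsS k H z := by
  rw [← sw_antipode_mul, hz.sw_comul (by fun_prop) (by fun_prop)]
  simp only [antipode_mul, mul_assoc, ← mul_sw]
  rw [sw_antipode_mul, epsS_one, mul_one]

theorem antipode_of_isSource {y : H} (hy : IsSource k y) : S y = epsT k H y := by
  rw [← sw_mul_antipode, hy.sw_comul' (by fun_prop) (by fun_prop)]
  simp only [antipode_mul, ← mul_assoc, ← sw_mul]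
  rw [sw_mul_antipode, epsT_one, one_mul]

theorem antipode_one : S 1 = 1 := by
  rw [antipode_of_isSource epsS_one, epsT_one]

/-- As Δ(1) lies in H_s ⊗ H_t, the left side is ε_s(1₂) ⊗ ε_t(1₁). Expanding both maps introduces
two new copies of Δ(1), and weak multiplicativity of ε eliminates the original one, leaving 1₁ ⊗
ε_t(1₂). -/
theorem sw_one_antipode : sw (Δ 1) (fun a b => S b ⊗ₜ[k] S a) = Δ 1 := by
  rw [← sw_one_epsT (by fun_prop) (by fun_prop), ← sw_one_epsS (by fun_prop) (by fun_prop)]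
  simp only [antipode_of_isTarget (isTarget_epsT _), antipode_of_isSource (isSource_epsS _)]
  rw [sw_one_epsS (f := fun a b => epsS k H (epsT k H b) ⊗ₜ[k] epsT k H a) (by fun_prop)
    (by fun_prop), sw_one_epsT (f := fun a b => epsS k H b ⊗ₜ[k] epsT k H a) (by fun_prop)
    (by fun_prop)]
  calc _ = sw (Δ 1) (fun a b => sw (Δ 1) (fun c d => sw (Δ 1) (fun p q =>
        (ε (p * a) * ε (b * d)) • c ⊗ₜ[k] q))) := by
        refine sw_congr fun a b => ?_
        simp only [epsS_eq, epsT_eq, sw_tmul, tmul_sw, ← TensorProduct.smul_tmul',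
          TensorProduct.tmul_smul, smul_smul, smul_sw]
        rw [sw_comm]
    _ = sw (Δ 1) (fun c d => sw (Δ 1) (fun p q => ε (p * 1 * d) • c ⊗ₜ[k] q)) := by
        rw [sw_comm]
        refine sw_congr fun c d => ?_
        rw [sw_comm]
        refine sw_congr fun p q => ?_
        rw [counit_mul_mul_eq, sw_smul]
    _ = sw (Δ 1) (fun c d => c ⊗ₜ[k] epsT k H d) := by
        simp only [epsT_eq, tmul_sw, TensorProduct.tmul_smul, mul_one]
    _ = _ := by rw [sw_one_epsT (by fun_prop) (by fun_prop), sw_self]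

/-- The map h ↦ S(h₂) ⊗ S(h₁) behaves like Δ ∘ S as a generalized convolution inverse of Δ. Hence
Δ(S(h)) = Δ(ε_s(h₁))Δ(S(h₂)) = (S(h₂) ⊗ S(h₁))Δ(h₃S(h₄)), and the last factor is Δ(ε_t(h₃)), which
is absorbed. -/
theorem comul_antipode (h : H) : Δ (S h) = sw (Δ h) (fun a b => S b ⊗ₜ[k] S a) := by
  -- The left inverse law: 1₁ ⊗ ε_s(h)1₂ = 1₁ ⊗ S(h₁)h₂1₂ = ε_s(h₂) ⊗ S(h₁)h₃ = S(h₂)h₃ ⊗ S(h₁)h₄.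
  have h₁ (h : H) : Δ (epsS k H h) = sw (Δ h) (fun a b => sw (Δ a) (fun c d =>
      (S d ⊗ₜ[k] S c) * Δ b)) := by
    rw [sw_comul (f := fun c d b => (S d ⊗ₜ[k] S c) * Δ b) _ (by fun_prop) (by fun_prop)
      (by fun_prop)]
    calc _ = sw (Δ h) (fun a b => sw (Δ 1) (fun c d => c ⊗ₜ[k] (S a * (b * d)))) := by
          rw [sw_comm]
          simp only [← mul_assoc, ← tmul_sw, ← sw_mul]
          rw [sw_antipode_mul, ← sw_self (Δ (epsS k H h)),
            (isSource_epsS h).sw_comul' (by fun_prop) (by fun_prop)]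
      _ = sw (Δ h) (fun a b => sw (Δ b) (fun c d => epsS k H c ⊗ₜ[k] (S a * d))) := by
          refine sw_congr fun a b => ?_
          rw [sw_comul_epsS (f := fun c d => c ⊗ₜ[k] (S a * d)) _ (by fun_prop) (by fun_prop)]
      _ = sw (Δ h) (fun a b => sw (Δ b) (fun c d => sw (Δ c) (fun c₁ c₂ =>
            (S c₁ * c₂) ⊗ₜ[k] (S a * d)))) := by
          simp only [← sw_antipode_mul, sw_tmul]
      _ = sw (Δ h) (fun a b => sw (Δ b) (fun c d => sw (Δ d) (fun c₁ c₂ =>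
            (S c * c₁) ⊗ₜ[k] (S a * c₂)))) := by
          refine sw_congr fun a b => ?_
          rw [sw_comul (f := fun c₁ c₂ d => (S c₁ * c₂) ⊗ₜ[k] (S a * d)) _ (by fun_prop)
            (by fun_prop) (by fun_prop)]
      _ = _ := by
          refine sw_congr fun a b => sw_congr fun c d => ?_
          conv_rhs => rw [← sw_self (Δ d), mul_sw]
          simp only [Algebra.TensorProduct.tmul_mul_tmul]
  -- Write Δ(1) as S(1₂) ⊗ S(1₁); it then merges with Δ(h) as Δ(1)Δ(h), since S reverses products.
  have h₂ (h : H) : sw (Δ h) (fun a b => S b ⊗ₜ[k] S a) * Δ 1 =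
      sw (Δ h) (fun a b => S b ⊗ₜ[k] S a) := by
    conv_rhs => rw [← one_mul h, sw_comul_mul _ _ (by fun_prop) (by fun_prop)]
    conv_lhs => rw [← sw_one_antipode, mul_sw]
    simp only [sw_mul, antipode_mul, Algebra.TensorProduct.tmul_mul_tmul]
  calc Δ (S h) = sw (Δ h) (fun a b => Δ (epsS k H a) * Δ (S b)) := by
        conv_lhs => rw [← sw_epsS_mul_antipode, map_sw]
        simp only [WeakBialgebra.comul_mul]
    _ = sw (Δ h) (fun a b => sw (Δ a) (fun c d => sw (Δ c) (fun p q =>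
          (S q ⊗ₜ[k] S p) * Δ d * Δ (S b)))) := by
        simp only [h₁, sw_mul]
    _ = sw (Δ h) (fun a b => sw (Δ b) (fun c d => sw (Δ a) (fun p q =>
          (S q ⊗ₜ[k] S p) * Δ (c * S d)))) := by
        rw [sw_comul (f := fun c d b => sw (Δ c) (fun p q => (S q ⊗ₜ[k] S p) * Δ d * Δ (S b))) _
          (by fun_prop) (by fun_prop) (by fun_prop)]
        simp only [WeakBialgebra.comul_mul, mul_assoc]
    _ = sw (Δ h) (fun a b => sw (Δ a) (fun p q => (S q ⊗ₜ[k] S p) * Δ (epsT k H b))) := by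
        refine sw_congr fun a b => ?_
        rw [sw_comm]
        simp only [← sw_mul_antipode, map_sw, mul_sw]
    _ = sw (Δ h) (fun a b => sw (Δ a) (fun p q =>
          ((S q * epsT k H b) ⊗ₜ[k] S p) * Δ 1)) := by
        refine sw_congr fun a b => sw_congr fun p q => ?_
        rw [← sw_self (Δ (epsT k H b)), sw_comul_of_epsT' _ (by fun_prop) (by fun_prop)]
        conv_rhs => rw [← sw_self (Δ 1)]
        simp only [mul_sw, Algebra.TensorProduct.tmul_mul_tmul, mul_assoc]
    _ = sw (Δ h) (fun a b => S b ⊗ₜ[k] S a) * Δ 1 := by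
        rw [sw_comul (f := fun p q b => ((S q * epsT k H b) ⊗ₜ[k] S p) * Δ 1) _
          (by fun_prop) (by fun_prop) (by fun_prop)]
        simp only [← sw_mul, ← sw_tmul, sw_antipode_mul_epsT]
    _ = _ := h₂ h

theorem sw_comul_antipode {f : H → H → P} (h : H) (hl : ∀ b, Lin k (fun a => f a b))
    (hr : ∀ a, Lin k (fun b => f a b)) :
    sw (Δ (S h)) f = sw (Δ h) (fun a b => f (S b) (S a)) := by
  rw [comul_antipode, sw_sw _ _ hl hr]
  simp only [sw_of_tmul _ _ hl hr]

theorem antipode_epsTBar (h : H) : S (epsTBar k H h) = epsS k H h := by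
  rw [antipode_of_isTarget (isTarget_epsTBar h), epsS_epsTBar]

theorem antipode_epsSBar (h : H) : S (epsSBar k H h) = epsT k H h := by
  rw [antipode_of_isSource (isSource_epsSBar h), epsT_epsSBar]

/-- Anticomultiplicativity gives ε(S(h₁))S(h₂) = S(h), hence ε(S(h₁))h₂ = h as S is injective. Apply
ε. -/
theorem counit_antipode (hS : Function.Bijective (WeakHopfAlgebra.antipode (k := k) (H := H)))
    (h : H) : ε (S h) = ε h := by
  have h₁ : sw (Δ h) (fun a b => ε (S a) • b) = h := by
    apply hS.1
    rw [map_sw]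
    conv_rhs => rw [← sw_counit_right (k := k) (f := fun a => a) (S h) (by fun_prop),
      sw_comul_antipode _ (by fun_prop) (by fun_prop)]
    simp only [map_smul]
  conv_rhs => rw [← h₁, map_sw]
  simp only [map_smul, smul_eq_mul]
  conv_lhs => rw [← sw_counit_right (k := k) (f := fun a => ε (S a)) h (by fun_prop)]
  simp only [smul_eq_mul, mul_comm]

variable (hS : Function.Bijective (WeakHopfAlgebra.antipode (k := k) (H := H)))

/-- The inverse of a bijective antipode. -/
def antipodeInv : H →ₗ[k] H := (LinearEquiv.ofBijective S hS).symm.toLinearMap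

local notation "T" => antipodeInv hS

theorem antipodeInv_antipode (h : H) : T (S h) = h :=
  (LinearEquiv.ofBijective S hS).symm_apply_apply h

theorem antipode_antipodeInv (h : H) : S (T h) = h :=
  (LinearEquiv.ofBijective S hS).apply_symm_apply h

theorem antipodeInv_mul (g h : H) : T (g * h) = T h * T g :=
  hS.1 (by simp only [antipode_mul, antipode_antipodeInv])

theorem antipodeInv_one : T 1 = 1 :=
  hS.1 (by simp only [antipode_one, antipode_antipodeInv])

/-- Applying S turns the claim into S(h₁)h₂ = ε_s(h). So S⁻¹ is an antipode relative to the opposite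
order, and the barred counital maps take the place of ε_t and ε_s. -/
theorem sw_antipodeInv_mul (h : H) : sw (Δ h) (fun a b => T b * a) = epsTBar k H h :=
  hS.1 (by simp only [map_sw, antipode_mul, antipode_antipodeInv, antipode_epsTBar, sw_antipode_mul])

theorem sw_mul_antipodeInv (h : H) : sw (Δ h) (fun a b => b * T a) = epsSBar k H h :=
  hS.1 (by simp only [map_sw, antipode_mul, antipode_antipodeInv, antipode_epsSBar, sw_mul_antipode])

theorem antipodeInv_epsT (h : H) : T (epsT k H h) = epsSBar k H h :=
  hS.1 (by rw [antipode_antipodeInv, antipode_epsSBar])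

theorem comul_antipodeInv (h : H) : Δ (T h) = sw (Δ h) (fun a b => T b ⊗ₜ[k] T a) := by
  obtain ⟨g, rfl⟩ := hS.2 h
  rw [antipodeInv_antipode, sw_comul_antipode _ (by fun_prop) (by fun_prop)]
  simp only [antipodeInv_antipode, sw_self]

theorem sw_comul_antipodeInv {f : H → H → P} (h : H) (hl : ∀ b, Lin k (fun a => f a b))
    (hr : ∀ a, Lin k (fun b => f a b)) :
    sw (Δ (T h)) f = sw (Δ h) (fun a b => f (T b) (T a)) := by
  rw [comul_antipodeInv, sw_sw _ _ hl hr]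
  simp only [sw_of_tmul _ _ hl hr]

theorem counit_antipodeInv (h : H) : ε (T h) = ε h := by
  rw [← counit_antipode hS, antipode_antipodeInv]

end Antipode

/-! ### The balanced tensor product of left modules -/

section Balanced

variable (k : Type u) (H : Type v) [CommRing k] [Ring H] [Algebra k H] [Coalgebra k H]
variable (M N : Type v) [AddCommGroup M] [Module k M] [Module H M] [IsScalarTower k H M]
  [AddCommGroup N] [Module k N] [Module H N] [IsScalarTower k H N]
variable {P : Type*} [AddCommGroup P] [Module k P]

local notation "Δ" => Coalgebra.comul (R := k) (A := H)

@[simp]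
theorem lAct_apply (h : H) (m : M) : lAct k H M h m = h • m := rfl

theorem balance_lAct (x : M ⊗[k] N) : balance (lAct k H M) (lAct k H N) x =
    sw (Δ 1) (fun a b => sw x (fun m n => (a • m) ⊗ₜ[k] (b • n))) := by
  rw [balance, map₂_eq_sw]
  rfl

/-- The balanced tensor product `M ⊗_t N` of two left modules. -/
def TensorT : Type v := balanced (lAct k H M) (lAct k H N)

instance : AddCommGroup (TensorT k H M N) :=
  inferInstanceAs (AddCommGroup (balanced (lAct k H M) (lAct k H N)))

instance : Module k (TensorT k H M N) :=
  inferInstanceAs (Module k (balanced (lAct k H M) (lAct k H N)))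

namespace TensorT

/-- The inclusion of `M ⊗_t N` in `M ⊗ N`. -/
def incl : TensorT k H M N →ₗ[k] M ⊗[k] N := (balanced (lAct k H M) (lAct k H N)).subtype

theorem incl_injective : Function.Injective (incl k H M N) := Subtype.val_injective

theorem range_incl : LinearMap.range (incl k H M N) = balanced (lAct k H M) (lAct k H N) :=
  Submodule.range_subtype _

/-- The projection `m ⊗ n ↦ 1₁m ⊗ 1₂n` of `M ⊗ N` onto `M ⊗_t N`. -/
def proj : M ⊗[k] N →ₗ[k] TensorT k H M N :=
  LinearMap.rangeRestrict (balance (lAct k H M) (lAct k H N))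

theorem incl_proj (x : M ⊗[k] N) :
    incl k H M N (proj k H M N x) = balance (lAct k H M) (lAct k H N) x := rfl

theorem proj_surjective : Function.Surjective (proj k H M N) :=
  LinearMap.surjective_rangeRestrict _

variable {M N}

/-- The element `1₁m ⊗ 1₂n` of `M ⊗_t N`. -/
def tm (m : M) (n : N) : TensorT k H M N := proj k H M N (m ⊗ₜ n)

local infixl:70 " ⊠ " => tm k H

variable {k H}

@[fun_prop]
theorem _root_.WeakHopf.Lin.tm_left {f : P → M} (hf : Lin k f) (n : N) :
    Lin k (fun x => tm k H (f x) n) := by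
  unfold tm
  fun_prop

@[fun_prop]
theorem _root_.WeakHopf.Lin.tm_right {f : P → N} (hf : Lin k f) (m : M) :
    Lin k (fun x => tm k H m (f x)) := by
  unfold tm
  fun_prop

theorem proj_eq_sw (x : M ⊗[k] N) : proj k H M N x = sw x (fun m n => m ⊠ n) :=
  apply_eq_sw _ _

@[elab_as_elim]
theorem induction_on {motive : TensorT k H M N → Prop} (x : TensorT k H M N)
    (tm : ∀ m n, motive (m ⊠ n)) (zero : motive 0)
    (add : ∀ x y, motive x → motive y → motive (x + y)) : motive x := by
  obtain ⟨x, rfl⟩ := proj_surjective k H M N x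
  induction x with
  | zero => rwa [map_zero]
  | tmul m n => exact tm m n
  | add x y hx hy => rw [map_add]; exact add _ _ hx hy

/-- Two linear functions on `M ⊗_t N` agree if they agree on the elements `m ⊠ n`. -/
theorem lin_ext {f g : TensorT k H M N → P} (h : ∀ m n, f (m ⊠ n) = g (m ⊠ n))
    (hf : Lin k f) (hg : Lin k g) : ∀ x, f x = g x := by
  intro x
  induction x using induction_on with
  | tm m n => exact h m n
  | zero => rw [hf.map_zero, hg.map_zero]
  | add x y hx hy => rw [hf.map_add, hg.map_add, hx, hy]

/-- Functions on M ⊗_t N are defined by evaluating a bilinear `f` on the included tensor, so their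
value on m ⊠ n carries a Δ(1). The lemma `sw_incl` removes it for those `f` that are insensitive to
Δ(1). -/
theorem sw_incl_tm {f : M → N → P} (m : M) (n : N) (hl : ∀ b, Lin k (fun a => f a b))
    (hr : ∀ a, Lin k (fun b => f a b)) :
    sw (incl k H M N (m ⊠ n)) f = sw (Δ 1) (fun a b => f (a • m) (b • n)) := by
  rw [tm, incl_proj, balance_lAct]
  simp (disch := fun_prop) only [sw_sw, sw_of_tmul]

variable [WeakBialgebra k H]

/-- Δ(1) is idempotent. -/
theorem sw_one_tm (m : M) (n : N) : sw (Δ 1) (fun a b => (a • m) ⊠ (b • n)) = m ⊠ n := by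
  apply incl_injective
  rw [map_sw]
  simp only [tm, incl_proj]
  simp only [balance_lAct]
  simp (disch := fun_prop) only [sw_of_tmul]
  rw [sw_comm]
  simp only [smul_smul]
  rw [← sw_comul_mul (f := fun a b => (a • m) ⊗ₜ[k] (b • n)) _ _ (by fun_prop) (by fun_prop), one_mul]

theorem sw_incl {f : M → N → P} (m : M) (n : N) (hl : ∀ b, Lin k (fun a => f a b))
    (hr : ∀ a, Lin k (fun b => f a b))
    (hf : sw (Δ 1) (fun a b => f (a • m) (b • n)) = f m n) :
    sw (incl k H M N (m ⊠ n)) f = f m n := by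
  rw [sw_incl_tm _ _ hl hr, hf]

/-- The diagonal action `h(m ⊗ n) = h₁m ⊗ h₂n`. -/
instance : SMul H (TensorT k H M N) where
  smul h x := sw (incl k H M N x) (fun m n => sw (Δ h) (fun a b => (a • m) ⊠ (b • n)))

theorem smul_def (h : H) (x : TensorT k H M N) :
    h • x = sw (incl k H M N x) (fun m n => sw (Δ h) (fun a b => (a • m) ⊠ (b • n))) := rfl

theorem smul_tm (h : H) (m : M) (n : N) :
    h • (m ⊠ n) = sw (Δ h) (fun a b => (a • m) ⊠ (b • n)) := by
  rw [smul_def, sw_incl _ _ (by fun_prop) (by fun_prop)]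
  rw [sw_comm]
  simp only [smul_smul]
  rw [← sw_comul_mul (f := fun a b => (a • m) ⊠ (b • n)) _ _ (by fun_prop) (by fun_prop), mul_one]

theorem lin_smul_left (x : TensorT k H M N) : Lin k (fun h : H => h • x) := by
  simp only [smul_def]
  fun_prop

theorem lin_smul_right (h : H) : Lin k (fun x : TensorT k H M N => h • x) := by
  simp only [smul_def]
  fun_prop

instance : Module H (TensorT k H M N) where
  one_smul x := by
    revert x
    refine lin_ext (fun m n => ?_) (lin_smul_right 1) lin_id
    rw [smul_tm, sw_one_tm]
  mul_smul g h x := by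
    revert x
    refine lin_ext (fun m n => ?_) (lin_smul_right _)
      ((lin_smul_right g).comp (lin_smul_right h))
    rw [smul_tm, smul_tm, (lin_smul_right g).map_sw, sw_comul_mul _ _ (by fun_prop) (by fun_prop)]
    simp only [smul_tm, smul_smul]
    rw [sw_comm]
  smul_zero h := (lin_smul_right h).map_zero
  smul_add h x y := (lin_smul_right h).map_add x y
  add_smul g h x := (lin_smul_left x).map_add g h
  zero_smul x := (lin_smul_left x).map_zero

instance : IsScalarTower k H (TensorT k H M N) where
  smul_assoc c h x := (lin_smul_left x).map_smul c h

theorem incl_smul (h : H) (x : TensorT k H M N) :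
    incl k H M N (h • x) =
      TensorProduct.map₂ (lAct k H M) (lAct k H N) (Coalgebra.comul h) (incl k H M N x) := by
  revert x
  refine lin_ext (fun m n => ?_) ?_ ?_
  · rw [smul_tm, map_sw, map₂_eq_sw]
    calc _ = sw (Δ h) (fun a b => (a • m) ⊗ₜ[k] (b • n)) := by
          conv_rhs => rw [← one_mul h, sw_comul_mul _ _ (by fun_prop) (by fun_prop)]
          rw [sw_comm]
          refine sw_congr fun a b => ?_
          rw [← sw_self (incl k H M N _), sw_incl_tm _ _ (by fun_prop) (by fun_prop)]
          simp only [smul_smul]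
      _ = _ := by
          conv_lhs => rw [← mul_one h, sw_comul_mul _ _ (by fun_prop) (by fun_prop)]
          refine sw_congr fun a b => ?_
          rw [sw_incl_tm _ _ (by fun_prop) (by fun_prop)]
          simp only [smul_smul, lAct_apply]
  all_goals fun_prop

end TensorT
end Balanced

/-! ### Left coactions and balanced elements in Sweedler form -/

section Coaction

variable {k : Type u} {H : Type v} [CommRing k] [Ring H] [Algebra k H] [Coalgebra k H]
variable {M : Type v} {P : Type*} [AddCommGroup M] [Module k M] [AddCommGroup P] [Module k P]

theorem IsLeftCoaction.sw_coassoc {δ : M →ₗ[k] H ⊗[k] M} (hδ : IsLeftCoaction δ)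
    {f : H → H → M → P} (m : M) (h₁ : ∀ b c, Lin k (fun a => f a b c))
    (h₂ : ∀ a c, Lin k (fun b => f a b c)) (h₃ : ∀ a b, Lin k (fun c => f a b c)) :
    sw (δ m) (fun a n => sw (δ n) (fun b n => f a b n)) =
      sw (δ m) (fun a n => sw (Coalgebra.comul (R := k) a) (fun b c => f b c n)) := by
  have := congrArg (fun y => sw y (fun a y => sw y (fun c d => f a c d)))
    (LinearMap.congr_fun hδ.coassoc m)
  simp only [LinearMap.comp_apply, LinearEquiv.coe_coe] at this
  rwa [sw_lTensor _ _ (by fun_prop) (by fun_prop), sw_assoc _ h₁ h₂ h₃,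
    sw_rTensor _ _ (by fun_prop) (by fun_prop)] at this

theorem IsLeftCoaction.sw_counit {δ : M →ₗ[k] H ⊗[k] M} (hδ : IsLeftCoaction δ)
    {f : M → P} (m : M) (hf : Lin k f) :
    sw (δ m) (fun a n => (Coalgebra.counit (R := k) a : k) • f n) = f m := by
  conv_rhs => rw [← LinearMap.id_apply (R := k) m, ← hδ.counit]
  simp only [LinearMap.comp_apply, LinearEquiv.coe_coe]
  rw [rTensor_eq_sw, lid_eq_sw, sw_sw _ _ (by fun_prop) (by fun_prop), hf.map_sw]
  refine sw_congr fun a n => ?_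
  rw [sw_of_tmul _ _ (by fun_prop) (by fun_prop), hf.map_smul]

theorem IsLeftCoaction.of_sw {δ : M →ₗ[k] H ⊗[k] M}
    (h₁ : ∀ m, sw (δ m) (fun a n => sw (δ n) (fun b n => a ⊗ₜ[k] (b ⊗ₜ[k] n))) =
      sw (δ m) (fun a n => sw (Coalgebra.comul (R := k) a) (fun b c => b ⊗ₜ[k] (c ⊗ₜ[k] n))))
    (h₂ : ∀ m, sw (δ m) (fun a n => (Coalgebra.counit (R := k) a : k) • n) = m) :
    IsLeftCoaction δ where
  coassoc := by
    ext m
    simp only [LinearMap.comp_apply, LinearEquiv.coe_coe]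
    rw [lTensor_eq_sw, rTensor_eq_sw, assoc_eq_sw]
    simp (disch := fun_prop) only [sw_sw, sw_of_tmul]
    rw [← h₁]
    refine sw_congr fun a n => ?_
    rw [← tmul_sw, sw_self]
  counit := by
    ext m
    simp only [LinearMap.comp_apply, LinearEquiv.coe_coe]
    rw [rTensor_eq_sw, lid_eq_sw]
    simp (disch := fun_prop) only [sw_sw, sw_of_tmul]
    exact h₂ m

theorem sweedler_eq_sw (f : H →ₗ[k] H →ₗ[k] P) (h : H) :
    sweedler f h = sw (Coalgebra.comul (R := k) h) (fun a b => f a b) := by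
  rw [sweedler, LinearMap.comp_apply, apply_eq_sw (TensorProduct.lift f)]
  rfl

variable {N : Type v} [AddCommGroup N] [Module k N]
  [WeakBialgebra k H]

/-- For multiplicative actions, the balanced elements are the fixed points of `balance`. -/
theorem mem_balanced_iff {a : H →ₗ[k] M →ₗ[k] M} {b : H →ₗ[k] N →ₗ[k] N}
    (ha : ∀ g h m, a (g * h) m = a g (a h m)) (hb : ∀ g h n, b (g * h) n = b g (b h n))
    (x : M ⊗[k] N) :
    x ∈ balanced a b ↔ sw (Coalgebra.comul (R := k) (1 : H)) (fun g h => sw x (fun m n =>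
      a g m ⊗ₜ[k] b h n)) = x := by
  rw [← map₂_eq_sw]
  refine ⟨?_, fun h => ⟨x, h⟩⟩
  rintro ⟨y, rfl⟩
  rw [balance]
  conv_rhs => rw [← mul_one (1 : H), WeakBialgebra.comul_mul]
  simp (disch := fun_prop) only [map₂_eq_sw, sw_sw, sw_of_tmul, sw_mul_tensor, ha, hb]

/-- For antimultiplicative actions, the balanced elements are the fixed points of `balance`. -/
theorem mem_balanced_iff' {a : H →ₗ[k] M →ₗ[k] M} {b : H →ₗ[k] N →ₗ[k] N}
    (ha : ∀ g h m, a (h * g) m = a g (a h m)) (hb : ∀ g h n, b (h * g) n = b g (b h n))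
    (x : M ⊗[k] N) :
    x ∈ balanced a b ↔ sw (Coalgebra.comul (R := k) (1 : H)) (fun g h => sw x (fun m n =>
      a g m ⊗ₜ[k] b h n)) = x := by
  rw [← map₂_eq_sw]
  refine ⟨?_, fun h => ⟨x, h⟩⟩
  rintro ⟨y, rfl⟩
  rw [balance]
  conv_rhs => rw [← mul_one (1 : H), WeakBialgebra.comul_mul]
  simp (disch := fun_prop) only [map₂_eq_sw, sw_sw, sw_of_tmul, sw_mul_tensor, ha, hb]
  rw [sw_comm]

end Coaction

/-! ### Left-left Yetter-Drinfeld modules: the coaction and the subalgebras H_t and H_s -/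

namespace LLYD

variable {k : Type u} {H : Type v} [CommRing k] [Ring H] [Algebra k H] [Coalgebra k H]
variable {P : Type*} [AddCommGroup P] [Module k P]

local notation "Δ" => Coalgebra.comul (R := k) (A := H)
local notation "ε" => Coalgebra.counit (R := k) (A := H)

section

variable (M : LLYD k H)

theorem sw_compat {f : H → M → P} (h : H) (m : M) (hl : ∀ b, Lin k (fun a => f a b))
    (hr : ∀ a, Lin k (fun b => f a b)) :
    sw (Δ h) (fun a b => sw (M.coact (a • m)) (fun c n => f (c * b) n)) =
      sw (Δ h) (fun a b => sw (M.coact m) (fun c n => f (a * c) (b • n))) := by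
  have := congrArg (fun y => sw y f) (M.compat h m)
  rw [map₂_eq_sw, sweedler_eq_sw] at this
  simp (disch := fun_prop) only [sw_sw, sw_of_tmul, LinearMap.mul_apply', lAct_apply] at this
  rw [this]
  refine sw_congr fun a b => ?_
  simp only [LinearMap.flip_apply, LinearMap.comp_apply, LinearMap.rTensorHom, LinearMap.coe_mk, AddHom.coe_mk, lAct_apply]
  rw [sw_rTensor _ _ hl hr]
  rfl

variable [WeakBialgebra k H]

theorem sw_one_coact {f : H → M → P} (m : M) (hl : ∀ b, Lin k (fun a => f a b))
    (hr : ∀ a, Lin k (fun b => f a b)) :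
    sw (Δ 1) (fun a b => sw (M.coact m) (fun c n => f (a * c) (b • n))) = sw (M.coact m) f := by
  have := (mem_balanced_iff (fun g h m => by simp [mul_assoc]) (fun g h m => by simp [mul_smul])
    _).1 (M.coact_mem m)
  conv_rhs => rw [← this]
  simp (disch := fun_prop) only [sw_sw, sw_of_tmul, LinearMap.mul_apply', lAct_apply]

/-- The Yetter-Drinfeld condition at h = 1, combined with the coaction taking values in H ⊗_t M. -/
theorem sw_one_coact' {f : H → M → P} (m : M) (hl : ∀ b, Lin k (fun a => f a b))
    (hr : ∀ a, Lin k (fun b => f a b)) :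
    sw (Δ 1) (fun a b => sw (M.coact (a • m)) (fun c n => f (c * b) n)) = sw (M.coact m) f := by
  rw [M.sw_compat _ _ hl hr, M.sw_one_coact _ hl hr]

/-- The coaction is H_t-linear: read Δ(z) as 1₁z ⊗ 1₂ on one side of the Yetter-Drinfeld condition
at h = z and as z1₁ ⊗ 1₂ on the other. -/
theorem sw_coact_target {f : H → M → P} {z : H} (hz : IsTarget k z) (m : M)
    (hl : ∀ b, Lin k (fun a => f a b)) (hr : ∀ a, Lin k (fun b => f a b)) :
    sw (M.coact (z • m)) f = sw (M.coact m) (fun a n => f (z * a) n) := by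
  rw [← M.sw_one_coact' _ hl hr]
  simp only [smul_smul]
  rw [← hz.sw_comul (f := fun a b => sw (M.coact (a • m)) (fun c n => f (c * b) n)) (by fun_prop)
    (by fun_prop), M.sw_compat _ _ hl hr, hz.sw_comul' (by fun_prop) (by fun_prop),
    ← M.sw_one_coact (f := fun a n => f (z * a) n) _ (by fun_prop) (by fun_prop)]
  simp only [mul_assoc]

/-- The same argument at h = y with Δ(y) = 1₁ ⊗ 1₂y = 1₁ ⊗ y1₂. A source element passes from the
H-leg to the module leg. -/
theorem sw_coact_source {f : H → M → P} {y : H} (hy : IsSource k y) (m : M)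
    (hl : ∀ b, Lin k (fun a => f a b)) (hr : ∀ a, Lin k (fun b => f a b)) :
    sw (M.coact m) (fun a n => f (a * y) n) = sw (M.coact m) (fun a n => f a (y • n)) := by
  rw [← M.sw_one_coact' (f := fun a n => f (a * y) n) _ (by fun_prop) (by fun_prop)]
  simp only [mul_assoc]
  rw [← hy.sw_comul (f := fun a b => sw (M.coact (a • m)) (fun c n => f (c * b) n)) (by fun_prop)
    (by fun_prop), M.sw_compat _ _ hl hr, hy.sw_comul' (by fun_prop) (by fun_prop),
    ← M.sw_one_coact (f := fun a n => f a (y • n)) _ (by fun_prop) (by fun_prop)]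
  simp only [mul_smul]

/-- Insert Δ(1) on both sides, as in (1₁m)₍₋₁₎1₂ ⊗ (1₁m)₍₀₎; the claim becomes 1₁ε̄_s(z) ⊗ 1₂ = 1₁ ⊗
1₂z. Needed for colinearity of the right unit constraint. -/
theorem sw_coact_epsSBar {f : H → M → P} {z : H} (hz : IsTarget k z) (m : M)
    (hl : ∀ b, Lin k (fun a => f a b)) (hr : ∀ a, Lin k (fun b => f a b)) :
    sw (M.coact (epsSBar k H z • m)) f = sw (M.coact m) (fun a n => f (a * z) n) := by
  rw [← M.sw_one_coact' _ hl hr, ← M.sw_one_coact' (f := fun a n => f (a * z) n) _ (by fun_prop)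
    (by fun_prop)]
  simp only [smul_smul, mul_assoc]
  rw [hz.sw_one (f := fun a b => sw (M.coact (a • m)) (fun c n => f (c * b) n)) (by fun_prop)
    (by fun_prop)]

end

end LLYD

namespace LLYD

variable {k : Type u} {H : Type v} [CommRing k] [Ring H] [Algebra k H] [Coalgebra k H]
variable {P : Type*} [AddCommGroup P] [Module k P]

local notation "Δ" => Coalgebra.comul (R := k) (A := H)
local notation "ε" => Coalgebra.counit (R := k) (A := H)
local infixl:70 " ⊠ " => TensorT.tm k H

/-! #### The tensor product -/

/-- The coaction `m ⊗ n ↦ m₍₋₁₎n₍₋₁₎ ⊗ m₍₀₎ ⊗ n₍₀₎` on `M ⊗_t N`. -/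
def tensorCoact (M N : LLYD k H) : TensorT k H M N →ₗ[k] H ⊗[k] TensorT k H M N :=
  Lin.toLinearMap (f := fun x => sw (TensorT.incl k H M N x) (fun m n => sw (M.coact m) (fun a m' =>
    sw (N.coact n) (fun b n' => (a * b) ⊗ₜ[k] (m' ⊠ n'))))) (by fun_prop)

variable [WeakBialgebra k H]

section

variable {M N : LLYD k H}

/-- The leg 1₂ lies in H_t, so it leaves the coaction of n on the left and joins m₍₋₁₎ on the right,
where `sw_one_coact'` absorbs Δ(1). -/
theorem tensorCoact_balanced {f : H → M → N → P} (m : M) (n : N)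
    (h₁ : ∀ b c, Lin k (fun a => f a b c)) (h₂ : ∀ a c, Lin k (fun b => f a b c))
    (h₃ : ∀ a b, Lin k (fun c => f a b c)) :
    sw (Δ 1) (fun p q => sw (M.coact (p • m)) (fun a m' => sw (N.coact (q • n)) (fun b n' =>
      f (a * b) m' n'))) =
    sw (M.coact m) (fun a m' => sw (N.coact n) (fun b n' => f (a * b) m' n')) := by
  rw [← sw_one_epsT (by fun_prop) (by fun_prop)]
  simp (disch := fun_prop) only [sw_coact_target _ (isTarget_epsT _), ← mul_assoc]
  rw [sw_one_epsT (f := fun p q => sw (M.coact (p • m)) (fun a m' => sw (N.coact n) (fun b n' =>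
    f (a * q * b) m' n'))) (by fun_prop) (by fun_prop),
    M.sw_one_coact' (f := fun a m' => sw (N.coact n) (fun b n' => f (a * b) m' n')) _
      (by fun_prop) (by fun_prop)]

theorem sw_tensorCoact {f : H → TensorT k H M N → P} (m : M) (n : N)
    (hl : ∀ b, Lin k (fun a => f a b)) (hr : ∀ a, Lin k (fun b => f a b)) :
    sw (tensorCoact M N (m ⊠ n)) f =
      sw (M.coact m) (fun a m' => sw (N.coact n) (fun b n' => f (a * b) (m' ⊠ n'))) := by
  rw [tensorCoact, Lin.toLinearMap_apply, TensorT.sw_incl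
    (f := fun m n => sw (M.coact m) (fun a m' => sw (N.coact n) (fun b n' =>
      (a * b) ⊗ₜ[k] (m' ⊠ n')))) _ _ (by fun_prop) (by fun_prop)
    (tensorCoact_balanced (f := fun a m n => a ⊗ₜ[k] (m ⊠ n)) _ _ (by fun_prop) (by fun_prop)
      (by fun_prop))]
  simp (disch := fun_prop) only [sw_sw, sw_of_tmul]

end

variable (M N : LLYD k H)

/-- Coassociativity is inherited factor by factor. Counitality is not, as ε is not multiplicative:
ε(m₍₋₁₎n₍₋₁₎) = ε(m₍₋₁₎1₁)ε(1₂n₍₋₁₎), where 1₁ in H_s crosses the coaction of m and 1₂ in H_t enters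
that of n. What is left is 1₁m ⊠ 1₂n = m ⊠ n. -/
theorem isLeftCoaction_tensorCoact : IsLeftCoaction (tensorCoact M N) := by
  refine .of_sw (TensorT.lin_ext (fun m n => ?_) ?_ ?_) (TensorT.lin_ext (fun m n => ?_) ?_ ?_)
  · rw [sw_tensorCoact _ _ (by fun_prop) (by fun_prop),
      sw_tensorCoact _ _ (by fun_prop) (by fun_prop)]
    simp (disch := fun_prop) only [sw_tensorCoact, sw_comul_mul]
    calc _ = sw (M.coact m) (fun a m' => sw (M.coact m') (fun c m'' => sw (N.coact n) (fun b n' =>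
          sw (N.coact n') (fun d n'' => (a * b) ⊗ₜ[k] ((c * d) ⊗ₜ[k] (m'' ⊠ n'')))))) := by
          refine sw_congr fun a m' => ?_
          rw [sw_comm]
      _ = sw (M.coact m) (fun a m' => sw (Δ a) (fun a c => sw (N.coact n) (fun b n' =>
          sw (N.coact n') (fun d n'' => (a * b) ⊗ₜ[k] ((c * d) ⊗ₜ[k] (m' ⊠ n'')))))) := by
          rw [M.isCoaction.sw_coassoc (f := fun a c m' => sw (N.coact n) (fun b n' =>
            sw (N.coact n') (fun d n'' => (a * b) ⊗ₜ[k] ((c * d) ⊗ₜ[k] (m' ⊠ n''))))) _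
            (by fun_prop) (by fun_prop) (by fun_prop)]
      _ = sw (M.coact m) (fun a m' => sw (Δ a) (fun a c => sw (N.coact n) (fun b n' =>
          sw (Δ b) (fun b d => (a * b) ⊗ₜ[k] ((c * d) ⊗ₜ[k] (m' ⊠ n')))))) := by
          refine sw_congr fun a m' => sw_congr fun a c => ?_
          rw [N.isCoaction.sw_coassoc (f := fun b d n' => (a * b) ⊗ₜ[k] ((c * d) ⊗ₜ[k] (m' ⊠ n')))
            _ (by fun_prop) (by fun_prop) (by fun_prop)]
      _ = _ := by
          refine sw_congr fun a m' => ?_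
          rw [sw_comm]
  · fun_prop
  · fun_prop
  · rw [sw_tensorCoact _ _ (by fun_prop) (by fun_prop)]
    calc _ = sw (Δ 1) (fun p q => sw (M.coact m) (fun a m' => sw (N.coact n) (fun b n' =>
          (ε (a * p) * ε (q * b)) • (m' ⊠ n')))) := by
          conv_rhs => rw [sw_comm]
          refine sw_congr fun a m' => ?_
          conv_rhs => rw [sw_comm]
          refine sw_congr fun b n' => ?_
          rw [← mul_one a, counit_mul_mul_eq, sw_smul]
          simp only [mul_one]
      _ = sw (Δ 1) (fun p q => sw (M.coact m) (fun a m' => sw (N.coact n) (fun b n' =>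
          (ε (a * epsS k H p) * ε (epsT k H q * b)) • (m' ⊠ n')))) := by
          rw [sw_one_epsS (f := fun p q => sw (M.coact m) (fun a m' => sw (N.coact n)
              (fun b n' => (ε (a * p) * ε (epsT k H q * b)) • (m' ⊠ n')))) (by fun_prop)
              (by fun_prop),
            sw_one_epsT (f := fun p q => sw (M.coact m) (fun a m' => sw (N.coact n)
              (fun b n' => (ε (a * p) * ε (q * b)) • (m' ⊠ n')))) (by fun_prop) (by fun_prop)]
      _ = sw (Δ 1) (fun p q => (epsS k H p • m) ⊠ (epsT k H q • n)) := by
          refine sw_congr fun p q => ?_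
          simp only [mul_smul]
          calc _ = sw (M.coact m) (fun a m' => ε (a * epsS k H p) • (m' ⊠ (epsT k H q • n))) := by
                refine sw_congr fun a m' => ?_
                rw [← smul_sw, ← N.sw_coact_target (f := fun b n' => ε b • (m' ⊠ n'))
                  (isTarget_epsT _) _ (by fun_prop) (by fun_prop),
                  N.isCoaction.sw_counit (f := fun n' => m' ⊠ n') _ (by fun_prop)]
            _ = _ := by
                rw [M.sw_coact_source (f := fun a m' => ε a • (m' ⊠ (epsT k H q • n)))
                  (isSource_epsS _) _ (by fun_prop) (by fun_prop),
                  M.isCoaction.sw_counit (f := fun m' => (epsS k H p • m') ⊠ (epsT k H q • n)) _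
                  (by fun_prop)]
      _ = _ := by
          rw [sw_one_epsS (f := fun p q => (p • m) ⊠ (epsT k H q • n)) (by fun_prop) (by fun_prop),
            sw_one_epsT (f := fun p q => (p • m) ⊠ (q • n)) (by fun_prop) (by fun_prop),
            TensorT.sw_one_tm]
  · fun_prop
  · fun_prop

/-- The tensor product `M ⊗_t N` of left-left Yetter-Drinfeld modules. -/
abbrev tensor : LLYD k H where
  carrier := TensorT k H M N
  coact := tensorCoact M N
  isCoaction := isLeftCoaction_tensorCoact M N
  coact_mem x := by
    refine (mem_balanced_iff (fun g h m => by simp [mul_assoc]) (fun g h m => by simp [mul_smul])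
      _).2 ?_
    revert x
    refine TensorT.lin_ext (M := M) (N := N) (fun m n => ?_) ?_ ?_
    · simp only [LinearMap.mul_apply', lAct_apply]
      conv_rhs => rw [← sw_self (tensorCoact M N (m ⊠ n)), sw_tensorCoact _ _ (by fun_prop) (by fun_prop)]
      simp (disch := fun_prop) only [sw_tensorCoact, TensorT.smul_tm, tmul_sw]
      -- Δ²(1) is factored into two copies of Δ(1): one is absorbed by ⊠ and the other by the
      -- coaction of m.
      calc _ = sw (Δ 1) (fun p q => sw (Δ q) (fun r s => sw (M.coact m) (fun a m' =>
            sw (N.coact n) (fun b n' => (p * a * b) ⊗ₜ[k] ((r • m') ⊠ (s • n')))))) := by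
            refine sw_congr fun p q => ?_
            conv_rhs => rw [sw_comm]
            refine sw_congr fun a m' => ?_
            conv_rhs => rw [sw_comm]
            simp only [mul_assoc]
        _ = sw (Δ 1) (fun p q => sw (Δ 1) (fun r s => sw (M.coact m) (fun a m' =>
            sw (N.coact n) (fun b n' => (p * a * b) ⊗ₜ[k] (((r * q) • m') ⊠ (s • n')))))) :=
            sw_one_comul' (f := fun p r s => sw (M.coact m) (fun a m' =>
            sw (N.coact n) (fun b n' => (p * a * b) ⊗ₜ[k] ((r • m') ⊠ (s • n'))))) (by fun_prop)
            (by fun_prop) (by fun_prop)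
        _ = sw (Δ 1) (fun p q => sw (M.coact m) (fun a m' =>
            sw (N.coact n) (fun b n' => (p * a * b) ⊗ₜ[k] ((q • m') ⊠ n')))) := by
            refine sw_congr fun p q => ?_
            rw [sw_comm]
            refine sw_congr fun a m' => ?_
            rw [sw_comm]
            refine sw_congr fun b n' => ?_
            simp only [mul_smul]
            rw [← tmul_sw, TensorT.sw_one_tm]
        _ = _ := M.sw_one_coact (f := fun a m' => sw (N.coact n) (fun b n' =>
            (a * b) ⊗ₜ[k] (m' ⊠ n'))) _ (by fun_prop) (by fun_prop)
    · fun_prop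
    · fun_prop
  compat h x := by
    rw [map₂_eq_sw, sweedler_eq_sw]
    simp only [LinearMap.flip_apply, LinearMap.comp_apply, LinearMap.rTensorHom, LinearMap.coe_mk,
      AddHom.coe_mk, lAct_apply, LinearMap.mul_apply', rTensor_eq_sw]
    revert x
    refine TensorT.lin_ext (M := M) (N := N) (fun m n => ?_) ?_ ?_
    · simp (disch := fun_prop) only [sw_tensorCoact, TensorT.smul_tm, tmul_sw, map_sw, sw_sw,
        sw_of_tmul]
      symm
      -- With Δ²(h), the condition for N is applied to the last two legs and then the condition for
      -- M to the first two.
      calc _ = sw (Δ h) (fun p q => sw (Δ q) (fun r s => sw (M.coact (p • m)) (fun a m' =>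
            sw (N.coact (r • n)) (fun b n' => (a * (b * s)) ⊗ₜ[k] (m' ⊠ n'))))) := by
            simp only [mul_assoc]
            rw [sw_comul (f := fun p r s => sw (M.coact (p • m)) (fun a m' =>
              sw (N.coact (r • n)) (fun b n' => (a * (b * s)) ⊗ₜ[k] (m' ⊠ n')))) _ (by fun_prop)
              (by fun_prop) (by fun_prop)]
        _ = sw (Δ h) (fun p q => sw (Δ q) (fun r s => sw (M.coact (p • m)) (fun a m' =>
            sw (N.coact n) (fun b n' => (a * (r * b)) ⊗ₜ[k] (m' ⊠ (s • n')))))) := by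
            refine sw_congr fun p q => ?_
            rw [sw_comm]
            conv_rhs => rw [sw_comm]
            refine sw_congr fun a m' => ?_
            exact N.sw_compat (f := fun b n' => (a * b) ⊗ₜ[k] (m' ⊠ n')) _ _ (by fun_prop)
              (by fun_prop)
        _ = sw (Δ h) (fun p q => sw (Δ p) (fun r s => sw (M.coact (r • m)) (fun a m' =>
            sw (N.coact n) (fun b n' => (a * s * b) ⊗ₜ[k] (m' ⊠ (q • n')))))) := by
            simp only [mul_assoc]
            rw [sw_comul (f := fun p r s => sw (M.coact (p • m)) (fun a m' =>
              sw (N.coact n) (fun b n' => (a * (r * b)) ⊗ₜ[k] (m' ⊠ (s • n'))))) _ (by fun_prop)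
              (by fun_prop) (by fun_prop)]
        _ = sw (Δ h) (fun p q => sw (Δ p) (fun r s => sw (M.coact m) (fun a m' =>
            sw (N.coact n) (fun b n' => (r * a * b) ⊗ₜ[k] ((s • m') ⊠ (q • n')))))) := by
            refine sw_congr fun p q => ?_
            exact M.sw_compat (f := fun a m' => sw (N.coact n) (fun b n' =>
              (a * b) ⊗ₜ[k] (m' ⊠ (q • n')))) _ _ (by fun_prop) (by fun_prop)
        _ = sw (Δ h) (fun p q => sw (Δ q) (fun r s => sw (M.coact m) (fun a m' =>
            sw (N.coact n) (fun b n' => (p * a * b) ⊗ₜ[k] ((r • m') ⊠ (s • n')))))) := by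
            rw [sw_comul (f := fun p r s => sw (M.coact m) (fun a m' =>
              sw (N.coact n) (fun b n' => (p * a * b) ⊗ₜ[k] ((r • m') ⊠ (s • n'))))) _ (by fun_prop)
              (by fun_prop) (by fun_prop)]
        _ = _ := by
            refine sw_congr fun p q => ?_
            rw [sw_comm]
            refine sw_congr fun a m' => ?_
            rw [sw_comm]
            simp only [mul_assoc]
    · fun_prop
    · fun_prop

end LLYD

namespace TensorT

variable {k : Type u} {H : Type v} [CommRing k] [Ring H] [Algebra k H] [Coalgebra k H]
  [WeakBialgebra k H]
variable {M N Q : Type v} [AddCommGroup M] [Module k M] [Module H M] [IsScalarTower k H M]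
  [AddCommGroup N] [Module k N] [Module H N] [IsScalarTower k H N]
  [AddCommGroup Q] [Module k Q] [Module H Q] [IsScalarTower k H Q]

local notation "Δ" => Coalgebra.comul (R := k) (A := H)
local infixl:70 " ⊠ " => tm k H

/-! #### Associativity -/

theorem smul_tm_assoc (h : H) (m : M) (n : N) (q : Q) :
    sw (Δ h) (fun a b => sw (Δ a) (fun c d => (c • m) ⊠ ((d • n) ⊠ (b • q)))) =
      h • (m ⊠ (n ⊠ q)) := by
  simp only [smul_tm]
  rw [sw_comul (f := fun a b c => (a • m) ⊠ ((b • n) ⊠ (c • q))) _ (by fun_prop) (by fun_prop)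
    (by fun_prop)]
  refine sw_congr fun a b => ?_
  rw [(Lin.tm_right lin_id _).map_sw]

theorem smul_tm_assoc' (h : H) (m : M) (n : N) (q : Q) :
    sw (Δ h) (fun a b => sw (Δ b) (fun c d => ((a • m) ⊠ (c • n)) ⊠ (d • q))) =
      h • ((m ⊠ n) ⊠ q) := by
  simp only [smul_tm]
  rw [← sw_comul (f := fun a b c => ((a • m) ⊠ (b • n)) ⊠ (c • q)) _ (by fun_prop) (by fun_prop)
    (by fun_prop)]
  refine sw_congr fun a b => ?_
  rw [(Lin.tm_left lin_id _).map_sw]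

/-- Acting by 1 on the triple product inserts Δ²(1); its first two legs form Δ(1₁), which absorbs
the additional Δ(1). -/
theorem sw_one_tm_tm (m : M) (n : N) (q : Q) :
    sw (Δ 1) (fun a b => (a • m) ⊠ ((b • n) ⊠ q)) = m ⊠ (n ⊠ q) := by
  conv_rhs => rw [← one_smul H (m ⊠ (n ⊠ q)), ← smul_tm_assoc]
  calc _ = sw (Δ 1) (fun c d => sw (Δ 1) (fun a b => sw (Δ a) (fun r s =>
        ((r * c) • m) ⊠ (((s * d) • n) ⊠ (b • q))))) := by
        refine sw_congr fun c d => ?_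
        conv_lhs => rw [← one_smul H (_ ⊠ (_ ⊠ _)), ← smul_tm_assoc]
        simp only [smul_smul]
    _ = _ := by
        rw [sw_comm]
        refine sw_congr fun a b => ?_
        conv_rhs => rw [← mul_one a, sw_comul_mul _ _ (by fun_prop) (by fun_prop)]
        rw [sw_comm]

theorem sw_one_tm_tm' (m : M) (n : N) (q : Q) :
    sw (Δ 1) (fun a b => (m ⊠ (a • n)) ⊠ (b • q)) = (m ⊠ n) ⊠ q := by
  conv_rhs => rw [← one_smul H ((m ⊠ n) ⊠ q), ← smul_tm_assoc']
  calc _ = sw (Δ 1) (fun c d => sw (Δ 1) (fun a b => sw (Δ b) (fun r s =>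
        ((a • m) ⊠ ((r * c) • n)) ⊠ ((s * d) • q)))) := by
        refine sw_congr fun c d => ?_
        conv_lhs => rw [← one_smul H ((_ ⊠ _) ⊠ _), ← smul_tm_assoc']
        simp only [smul_smul]
    _ = _ := by
        rw [sw_comm]
        refine sw_congr fun a b => ?_
        conv_rhs => rw [← mul_one b, sw_comul_mul _ _ (by fun_prop) (by fun_prop)]
        rw [sw_comm]

/-- The associativity constraint `(m ⊠ n) ⊠ q ↦ m ⊠ (n ⊠ q)`. -/
def assocFun (x : TensorT k H (TensorT k H M N) Q) : TensorT k H M (TensorT k H N Q) :=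
  sw (incl k H _ _ x) (fun y q => sw (incl k H _ _ y) (fun m n => m ⊠ (n ⊠ q)))

/-- The inverse `m ⊠ (n ⊠ q) ↦ (m ⊠ n) ⊠ q` of the associativity constraint. -/
def assocInvFun (x : TensorT k H M (TensorT k H N Q)) : TensorT k H (TensorT k H M N) Q :=
  sw (incl k H _ _ x) (fun m y => sw (incl k H _ _ y) (fun n q => (m ⊠ n) ⊠ q))

@[fun_prop]
theorem lin_assocFun : Lin k (assocFun (k := k) (H := H) (M := M) (N := N) (Q := Q)) := by
  unfold assocFun
  fun_prop

@[fun_prop]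
theorem lin_assocInvFun : Lin k (assocInvFun (k := k) (H := H) (M := M) (N := N) (Q := Q)) := by
  unfold assocInvFun
  fun_prop

@[simp]
theorem assocFun_tm (m : M) (n : N) (q : Q) : assocFun ((m ⊠ n) ⊠ q) = m ⊠ (n ⊠ q) := by
  -- The inner inclusion is harmless because m ⊠ (n ⊠ q) is already balanced in m and n. The outer
  -- one inserts Δ(1), which amounts to acting by 1.
  have key (m : M) (n : N) (q : Q) : sw (incl k H _ _ (m ⊠ n)) (fun m n => m ⊠ (n ⊠ q)) =
      m ⊠ (n ⊠ q) :=
    sw_incl _ _ (by fun_prop) (by fun_prop) (sw_one_tm_tm _ _ _)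
  rw [assocFun, sw_incl_tm _ _ (by fun_prop) (by fun_prop)]
  conv_rhs => rw [← one_smul H (_ ⊠ (_ ⊠ _)), ← smul_tm_assoc]
  refine sw_congr fun a b => ?_
  rw [smul_tm]
  rw [Lin.map_sw (g := fun y => sw (incl k H _ _ y) (fun m n => m ⊠ (n ⊠ (b • q)))) (by fun_prop)]
  simp only [key]

@[simp]
theorem assocInvFun_tm (m : M) (n : N) (q : Q) : assocInvFun (m ⊠ (n ⊠ q)) = (m ⊠ n) ⊠ q := by
  have key (m : M) (n : N) (q : Q) : sw (incl k H _ _ (n ⊠ q)) (fun n q => (m ⊠ n) ⊠ q) =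
      (m ⊠ n) ⊠ q :=
    sw_incl _ _ (by fun_prop) (by fun_prop) (sw_one_tm_tm' _ _ _)
  rw [assocInvFun, sw_incl_tm _ _ (by fun_prop) (by fun_prop)]
  conv_rhs => rw [← one_smul H ((_ ⊠ _) ⊠ _), ← smul_tm_assoc']
  refine sw_congr fun a b => ?_
  rw [smul_tm]
  rw [Lin.map_sw (g := fun y => sw (incl k H _ _ y) (fun n q => ((a • m) ⊠ n) ⊠ q)) (by fun_prop)]
  simp only [key]

variable {P : Type*} [AddCommGroup P] [Module k P]

theorem lin_ext₃ {f g : TensorT k H (TensorT k H M N) Q → P}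
    (h : ∀ m n q, f ((m ⊠ n) ⊠ q) = g ((m ⊠ n) ⊠ q)) (hf : Lin k f) (hg : Lin k g) :
    ∀ x, f x = g x := by
  refine lin_ext (fun y q => ?_) hf hg
  revert y
  refine lin_ext (fun m n => h m n q) ?_ ?_
  · exact hf.comp (Lin.tm_left lin_id q)
  · exact hg.comp (Lin.tm_left lin_id q)

theorem lin_ext₃' {f g : TensorT k H M (TensorT k H N Q) → P}
    (h : ∀ m n q, f (m ⊠ (n ⊠ q)) = g (m ⊠ (n ⊠ q))) (hf : Lin k f) (hg : Lin k g) :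
    ∀ x, f x = g x := by
  refine lin_ext (fun m y => ?_) hf hg
  revert y
  refine lin_ext (fun n q => h m n q) ?_ ?_
  · exact hf.comp (Lin.tm_right lin_id m)
  · exact hg.comp (Lin.tm_right lin_id m)

/-! #### Functoriality -/

variable {M' N' : Type v} [AddCommGroup M'] [Module k M'] [Module H M'] [IsScalarTower k H M']
  [AddCommGroup N'] [Module k N'] [Module H N'] [IsScalarTower k H N']

/-- The map `m ⊠ n ↦ f m ⊠ g n`, for `H`-linear maps `f` and `g`. -/
def map (f : M →ₗ[k] M') (g : N →ₗ[k] N') : TensorT k H M N →ₗ[k] TensorT k H M' N' :=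
  proj k H M' N' ∘ₗ TensorProduct.map f g ∘ₗ incl k H M N

theorem map_tm {f : M →ₗ[k] M'} {g : N →ₗ[k] N'} (hf : ∀ (h : H) m, f (h • m) = h • f m)
    (hg : ∀ (h : H) n, g (h • n) = h • g n) (m : M) (n : N) :
    map f g (m ⊠ n) = f m ⊠ g n := by
  rw [map, LinearMap.comp_apply, LinearMap.comp_apply, proj_eq_sw, sw_map _ _ _ (by fun_prop)
    (by fun_prop), sw_incl_tm _ _ (by fun_prop) (by fun_prop)]
  simp only [hf, hg, sw_one_tm]

theorem incl_tm (m : M) (n : N) :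
    incl k H M N (m ⊠ n) = sw (Δ 1) (fun a b => (a • m) ⊗ₜ[k] (b • n)) := by
  rw [← sw_self (incl k H M N _), sw_incl_tm _ _ (by fun_prop) (by fun_prop)]

theorem incl_smul_tm (h : H) (m : M) (n : N) :
    incl k H M N (h • (m ⊠ n)) = sw (Δ h) (fun a b => (a • m) ⊗ₜ[k] (b • n)) := by
  rw [smul_tm, WeakHopf.map_sw]
  conv_rhs => rw [← one_mul h, sw_comul_mul _ _ (by fun_prop) (by fun_prop)]
  rw [sw_comm]
  simp only [incl_tm, smul_smul]

theorem incl_map {f : M →ₗ[k] M'} {g : N →ₗ[k] N'} (hf : ∀ (h : H) m, f (h • m) = h • f m)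
    (hg : ∀ (h : H) n, g (h • n) = h • g n) (x : TensorT k H M N) :
    incl k H M' N' (map f g x) = TensorProduct.map f g (incl k H M N x) := by
  revert x
  refine lin_ext (fun m n => ?_) ?_ ?_
  · rw [map_tm hf hg, incl_tm, incl_tm, WeakHopf.map_sw]
    simp only [TensorProduct.map_tmul, hf, hg]
  · fun_prop
  · fun_prop

theorem assocFun_smul (h : H) (x : TensorT k H (TensorT k H M N) Q) :
    assocFun (h • x) = h • assocFun x := by
  revert x
  refine lin_ext₃ (fun m n q => ?_) ?_ ?_
  · rw [← smul_tm_assoc', lin_assocFun.map_sw, assocFun_tm, ← smul_tm_assoc,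
      sw_comul (f := fun a b c => (a • m) ⊠ ((b • n) ⊠ (c • q))) _ (by fun_prop) (by fun_prop)
      (by fun_prop)]
    refine sw_congr fun a b => ?_
    rw [lin_assocFun.map_sw]
    simp only [assocFun_tm]
  · fun_prop
  · fun_prop

/-- Both bracketings embed the generator as 1₁m ⊗ 1₂n ⊗ 1₃q, by coassociativity. -/
theorem incl_assocFun (x : TensorT k H (TensorT k H M N) Q) :
    (incl k H N Q).lTensor M (incl k H M _ (assocFun x)) =
      TensorProduct.assoc k M N Q ((incl k H M N).rTensor Q (incl k H _ Q x)) := by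
  revert x
  refine lin_ext₃ (fun m n q => ?_) ?_ ?_
  · rw [assocFun_tm, incl_tm, incl_tm, WeakHopf.map_sw, WeakHopf.map_sw, ← LinearEquiv.coe_coe,
      WeakHopf.map_sw]
    simp only [LinearMap.lTensor_tmul, LinearMap.rTensor_tmul, incl_smul_tm, tmul_sw, sw_tmul]
    rw [← sw_comul (f := fun a b c => (a • m) ⊗ₜ[k] ((b • n) ⊗ₜ[k] (c • q))) _ (by fun_prop)
      (by fun_prop) (by fun_prop)]
    refine sw_congr fun a b => ?_
    rw [WeakHopf.map_sw]
    rfl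
  · fun_prop
  · exact (((TensorProduct.assoc k M N Q).toLinearMap ∘ₗ (incl k H M N).rTensor Q) ∘ₗ
      incl k H _ Q).lin

end TensorT

/-! #### The target subalgebra as a module -/

section Target

variable (k : Type u) (H : Type v) [CommRing k] [Ring H] [Algebra k H] [Coalgebra k H]

/-- The target subalgebra `H_t`. -/
def Target : Type v := LinearMap.range (epsT k H)

instance : AddCommGroup (Target k H) := inferInstanceAs (AddCommGroup (LinearMap.range (epsT k H)))

instance : Module k (Target k H) := inferInstanceAs (Module k (LinearMap.range (epsT k H)))

namespace Target

/-- The inclusion of `H_t` in `H`. -/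
def val : Target k H →ₗ[k] H := (LinearMap.range (epsT k H)).subtype

/-- The target map, as a map onto `H_t`. -/
def mk : H →ₗ[k] Target k H := (epsT k H).rangeRestrict

theorem val_injective : Function.Injective (val k H) := Subtype.val_injective

theorem range_val : LinearMap.range (val k H) = LinearMap.range (epsT k H) :=
  Submodule.range_subtype _

variable {k H}

@[simp]
theorem val_mk (h : H) : val k H (mk k H h) = epsT k H h := rfl

variable [WeakBialgebra k H]

theorem isTarget (z : Target k H) : IsTarget k (val k H z) := by
  obtain ⟨_, h, rfl⟩ := z
  exact epsT_epsT h

@[simp]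
theorem mk_val (z : Target k H) : mk k H (val k H z) = z := val_injective k H z.isTarget

theorem mk_mul_epsT (g h : H) : mk k H (g * epsT k H h) = mk k H (g * h) :=
  val_injective k H (epsT_mul_epsT g h)

theorem mk_mul_epsSBar (g h : H) : mk k H (g * epsSBar k H h) = mk k H (g * h) :=
  val_injective k H (epsT_mul_epsSBar g h)

theorem mk_epsT (h : H) : mk k H (epsT k H h) = mk k H h := by
  simpa using mk_mul_epsT (k := k) 1 h

instance : SMul H (Target k H) where
  smul h z := mk k H (h * val k H z)

theorem smul_def (h : H) (z : Target k H) : h • z = mk k H (h * val k H z) := rfl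

instance : Module H (Target k H) where
  one_smul z := by rw [smul_def, one_mul, mk_val]
  mul_smul g h z := by simp only [smul_def, val_mk, mk_mul_epsT, mul_assoc]
  smul_zero h := by rw [smul_def, map_zero, mul_zero, map_zero]
  smul_add h x y := by simp only [smul_def, map_add, mul_add]
  add_smul g h x := by simp only [smul_def, add_mul, map_add]
  zero_smul x := by rw [smul_def, zero_mul, map_zero]

instance : IsScalarTower k H (Target k H) where
  smul_assoc c h x := by simp only [smul_def, smul_mul_assoc, map_smul]

theorem val_smul (h : H) (z : Target k H) : val k H (h • z) = epsT k H (h * val k H z) := rfl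

theorem smul_mk (g h : H) : g • mk k H h = mk k H (g * h) := by
  rw [smul_def, val_mk, mk_mul_epsT]

end Target

end Target

/-! ### The unit object and the monoidal category of left-left modules -/

namespace LLYD

variable {k : Type u} {H : Type v} [CommRing k] [Ring H] [Algebra k H] [Coalgebra k H]
  [WeakBialgebra k H]
variable {P : Type*} [AddCommGroup P] [Module k P]

local notation "Δ" => Coalgebra.comul (R := k) (A := H)
local notation "ε" => Coalgebra.counit (R := k) (A := H)
local infixl:70 " ⊠ " => TensorT.tm k H

/-- The coaction `z ↦ z₁ ⊗ z₂` on `H_t`. -/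
def unitCoact : Target k H →ₗ[k] H ⊗[k] Target k H :=
  Lin.toLinearMap (f := fun z => sw (Δ (Target.val k H z)) (fun a b => a ⊗ₜ[k] Target.mk k H b))
    (by fun_prop)

theorem sw_unitCoact {f : H → Target k H → P} (z : Target k H) (hl : ∀ b, Lin k (fun a => f a b))
    (hr : ∀ a, Lin k (fun b => f a b)) :
    sw (unitCoact z) f = sw (Δ (Target.val k H z)) (fun a b => f a (Target.mk k H b)) := by
  rw [unitCoact, Lin.toLinearMap_apply]
  simp (disch := fun_prop) only [sw_sw, sw_of_tmul]

/-- For z in H_t, both sides are 1₁z ⊗ 1₂. So the second leg of Δ(z) lies in H_t, and projecting it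
there in `unitCoact` loses nothing. -/
theorem sw_comul_epsT_of_isTarget {f : H → H → P} {z : H} (hz : IsTarget k z)
    (hl : ∀ b, Lin k (fun a => f a b)) (hr : ∀ a, Lin k (fun b => f a b)) :
    sw (Δ z) (fun a b => f a (epsT k H b)) = sw (Δ z) f := by
  rw [sw_comul_epsT _ hl hr, hz.sw_comul hl hr]

theorem isLeftCoaction_unitCoact : IsLeftCoaction (unitCoact (k := k) (H := H)) := by
  refine .of_sw (fun z => ?_) (fun z => ?_)
  · simp (disch := fun_prop) only [sw_unitCoact, Target.val_mk]
    rw [sw_comul_epsT_of_isTarget (f := fun a b => sw (Δ b) (fun c d =>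
        a ⊗ₜ[k] (c ⊗ₜ[k] Target.mk k H d))) z.isTarget (by fun_prop) (by fun_prop),
      sw_comul (f := fun a c d => a ⊗ₜ[k] (c ⊗ₜ[k] Target.mk k H d)) _ (by fun_prop) (by fun_prop)
      (by fun_prop)]
  · rw [sw_unitCoact _ (by fun_prop) (by fun_prop),
      sw_counit_left (f := fun b => Target.mk k H b) _ (by fun_prop), Target.mk_val]

variable (k H)

/-- The unit object `H_t`. -/
abbrev unitObj : LLYD k H where
  carrier := Target k H
  coact := unitCoact
  isCoaction := isLeftCoaction_unitCoact
  coact_mem z := by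
    refine (mem_balanced_iff (fun g h m => by simp [mul_assoc]) (fun g h m => by simp [mul_smul])
      _).2 ?_
    simp (disch := fun_prop) only [sw_unitCoact, LinearMap.mul_apply', lAct_apply, Target.smul_mk]
    rw [← sw_comul_mul (f := fun a b => a ⊗ₜ[k] Target.mk k H b) _ _ (by fun_prop) (by fun_prop),
      one_mul]
    rfl
  compat h z := by
    rw [map₂_eq_sw, sweedler_eq_sw]
    simp only [LinearMap.flip_apply, LinearMap.comp_apply, LinearMap.rTensorHom, LinearMap.coe_mk,
      AddHom.coe_mk, lAct_apply, LinearMap.mul_apply', rTensor_eq_sw]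
    simp (disch := fun_prop) only [sw_unitCoact, Target.smul_mk, Target.val_smul,
      (isTarget_epsT _).sw_comul, map_sw, sw_sw, sw_of_tmul]
    rw [← sw_comul_mul (f := fun a b => a ⊗ₜ[k] Target.mk k H b) _ _ (by fun_prop) (by fun_prop)]
    have key := sw_comul_epsT (f := fun a b => a ⊗ₜ[k] Target.mk k H b) (h * Target.val k H z)
      (by fun_prop) (by fun_prop)
    simp only [Target.mk_epsT] at key
    rw [key]
    -- Both sides are now sums over one Δ(1), and what remains is ε_t(h₁z)h₂ = hz. This follows from
    -- Δ(hz) = h₁z ⊗ h₂.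
    conv_rhs => rw [sw_comm]
    refine sw_congr fun a b => ?_
    simp only [mul_assoc]
    rw [← z.isTarget.sw_comul_mul (f := fun p q => (a * (epsT k H p * q)) ⊗ₜ[k]
      Target.mk k H b) _ (by fun_prop) (by fun_prop), ← sw_tmul, ← mul_sw, sw_epsT_mul_self]

/-! #### Constructing morphisms -/

variable {k H}

variable {M N : LLYD k H}

@[simp]
theorem id_hom (M : LLYD k H) : Hom.hom (𝟙 M) = LinearMap.id := rfl

@[simp]
theorem comp_hom {M N Q : LLYD k H} (f : M ⟶ N) (g : N ⟶ Q) :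
    Hom.hom (f ≫ g) = g.hom ∘ₗ f.hom := rfl

theorem hom_ext {f g : M ⟶ N} (h : ∀ x, f.hom x = g.hom x) : f = g :=
  Hom.ext (LinearMap.ext h)

theorem sw_hom {f : H → N → P} (g : M ⟶ N) (m : M) (hl : ∀ b, Lin k (fun a => f a b))
    (hr : ∀ a, Lin k (fun b => f a b)) :
    sw (N.coact (g.hom m)) f = sw (M.coact m) (fun a m' => f a (g.hom m')) := by
  rw [← LinearMap.comp_apply, g.map_coact, LinearMap.comp_apply, sw_lTensor _ _ hl hr]

/-- The morphism given by an `H`-linear and `H`-colinear function. -/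
def homMk (f : M → N) (hf : Lin k f) (h_act : ∀ (h : H) m, f (h • m) = h • f m)
    (h_coact : ∀ m, N.coact (f m) = sw (M.coact m) (fun a m' => a ⊗ₜ[k] f m')) : M ⟶ N where
  hom := hf.toLinearMap
  map_act := h_act
  map_coact := by
    ext m
    rw [LinearMap.comp_apply, LinearMap.comp_apply, lTensor_eq_sw]
    exact h_coact m

/-- The isomorphism given by a bijective `H`-linear and `H`-colinear function. -/
@[simps]
def isoMk (f : M → N) (g : N → M) (hf : Lin k f) (hg : Lin k g) (hgf : ∀ m, g (f m) = m)
    (hfg : ∀ n, f (g n) = n) (h_act : ∀ (h : H) m, f (h • m) = h • f m)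
    (h_coact : ∀ m, N.coact (f m) = sw (M.coact m) (fun a m' => a ⊗ₜ[k] f m')) : M ≅ N where
  hom := homMk f hf h_act h_coact
  inv := homMk g hg (fun h n => by
      conv_lhs => rw [← hfg n, ← h_act, hgf]) (fun n => by
      conv_rhs => rw [← hfg n, h_coact]
      simp (disch := fun_prop) only [sw_sw, sw_of_tmul, hgf, sw_self])
  hom_inv_id := hom_ext hgf
  inv_hom_id := hom_ext hfg

/-- The tensor product of morphisms. -/
def tensorMap {M M' N N' : LLYD k H} (f : M ⟶ M') (g : N ⟶ N') : tensor M N ⟶ tensor M' N' :=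
  homMk (TensorT.map f.hom g.hom) (by fun_prop) (fun h x => by
    revert x
    refine TensorT.lin_ext (M := M) (N := N) (fun m n => ?_) ?_ ?_
    · rw [TensorT.smul_tm, map_sw, TensorT.map_tm f.map_act g.map_act, TensorT.smul_tm]
      simp only [TensorT.map_tm f.map_act g.map_act, f.map_act, g.map_act]
    · fun_prop
    · fun_prop) (fun x => by
    revert x
    refine TensorT.lin_ext (M := M) (N := N) (fun m n => ?_) ?_ ?_
    · rw [← sw_self ((tensor M' N').coact _), sw_tensorCoact _ _ (by fun_prop) (by fun_prop),
        TensorT.map_tm f.map_act g.map_act, sw_tensorCoact _ _ (by fun_prop) (by fun_prop)]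
      simp (disch := fun_prop) only [sw_hom, TensorT.map_tm f.map_act g.map_act]
    · fun_prop
    · fun_prop)

@[simp]
theorem tensorMap_tm {M M' N N' : LLYD k H} (f : M ⟶ M') (g : N ⟶ N') (m : M) (n : N) :
    (tensorMap f g).hom (m ⊠ n) = f.hom m ⊠ g.hom n :=
  TensorT.map_tm f.map_act g.map_act m n

theorem sw_coact_tm_tm {M N Q : LLYD k H} {f : H → tensor M (tensor N Q) → P} (m : M) (n : N) (q : Q)
    (hl : ∀ b, Lin k (fun a => f a b)) (hr : ∀ a, Lin k (fun b => f a b)) :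
    sw (tensorCoact M (tensor N Q) (m ⊠ (n ⊠ q))) f =
      sw (M.coact m) (fun a m' => sw (N.coact n) (fun b n' => sw (Q.coact q) (fun c q' =>
        f (a * b * c) (m' ⊠ (n' ⊠ q'))))) := by
  rw [sw_tensorCoact _ _ hl hr]
  refine sw_congr fun a m' => (sw_tensorCoact (f := fun b y => f (a * b) (m' ⊠ y)) _ _
    (by fun_prop) (by fun_prop)).trans ?_
  simp only [mul_assoc]

theorem sw_coact_tm_tm' {M N Q : LLYD k H} {f : H → tensor (tensor M N) Q → P} (m : M) (n : N) (q : Q)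
    (hl : ∀ b, Lin k (fun a => f a b)) (hr : ∀ a, Lin k (fun b => f a b)) :
    sw (tensorCoact (tensor M N) Q ((m ⊠ n) ⊠ q)) f =
      sw (M.coact m) (fun a m' => sw (N.coact n) (fun b n' => sw (Q.coact q) (fun c q' =>
        f (a * b * c) ((m' ⊠ n') ⊠ q')))) := by
  rw [sw_tensorCoact _ _ hl hr]
  exact sw_tensorCoact (f := fun a y => sw (Q.coact q) (fun c q' => f (a * c) (y ⊠ q'))) _ _
    (by fun_prop) (by fun_prop)

/-- The associativity constraint. -/
def assocIso (M N Q : LLYD k H) : tensor (tensor M N) Q ≅ tensor M (tensor N Q) :=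
  isoMk TensorT.assocFun TensorT.assocInvFun (by fun_prop) (by fun_prop)
    (TensorT.lin_ext₃ (fun m n q => by simp) (by fun_prop) (by fun_prop))
    (TensorT.lin_ext₃' (fun m n q => by simp) (by fun_prop) (by fun_prop))
    TensorT.assocFun_smul
    (TensorT.lin_ext₃ (fun m n q => by
      refine (sw_self _).symm.trans ?_
      rw [TensorT.assocFun_tm, sw_coact_tm_tm _ _ _ (by fun_prop) (by fun_prop),
        sw_coact_tm_tm' _ _ _ (by fun_prop) (by fun_prop)]
      simp only [TensorT.assocFun_tm])
      (by fun_prop) (by fun_prop))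

@[simp]
theorem assocIso_hom_tm {M N Q : LLYD k H} (m : M) (n : N) (q : Q) :
    (assocIso M N Q).hom.hom ((m ⊠ n) ⊠ q) = m ⊠ (n ⊠ q) :=
  TensorT.assocFun_tm m n q

section Unit

variable {M : Type v} [AddCommGroup M] [Module k M] [Module H M] [IsScalarTower k H M]

/-- This is ε_t(h₁z)h₂ = hz again. At h = 1 it says that z ⊗ m ↦ zm is balanced; for general h it
gives linearity of the left unit constraint. -/
theorem sw_leftUnit_balanced (h : H) (z : Target k H) (m : M) :
    sw (Δ h) (fun a b => Target.val k H (a • z) • b • m) = (h * Target.val k H z) • m := by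
  simp only [Target.val_smul, smul_smul]
  rw [← z.isTarget.sw_comul_mul (f := fun a b => (epsT k H a * b) • m) _ (by fun_prop)
    (by fun_prop), ← sw_smul, sw_epsT_mul_self]

/-- The function `z ⊠ m ↦ zm`. -/
def leftUnitFun (x : TensorT k H (Target k H) M) : M :=
  sw (TensorT.incl k H (Target k H) M x) (fun z m => Target.val k H z • m)

@[fun_prop]
theorem lin_leftUnitFun : Lin k (leftUnitFun (k := k) (H := H) (M := M)) := by
  unfold leftUnitFun
  fun_prop

@[simp]
theorem leftUnitFun_tm (z : Target k H) (m : M) :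
    leftUnitFun (z ⊠ m) = Target.val k H z • m := by
  rw [leftUnitFun, TensorT.sw_incl_tm _ _ (by fun_prop) (by fun_prop), sw_leftUnit_balanced,
    one_mul]

/-- Inserting Δ(1) makes z follow 1₂, so it passes to 1₁ as ε̄_s(z); under ε_t this is as good as z.
Hence m ↦ 1 ⊠ m inverts the left unit constraint. -/
theorem mk_one_tm (z : Target k H) (m : M) :
    Target.mk k H 1 ⊠ (Target.val k H z • m) = z ⊠ m := by
  conv_lhs => rw [← TensorT.sw_one_tm]
  simp only [Target.smul_mk, mul_one, smul_smul]
  rw [z.isTarget.sw_one (f := fun a b => Target.mk k H a ⊠ (b • m)) (by fun_prop) (by fun_prop)]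
  simp only [Target.mk_mul_epsSBar]
  exact TensorT.sw_one_tm _ _

theorem sw_rightUnit_balanced (h : H) (m : M) (z : Target k H) :
    sw (Δ h) (fun a b => epsSBar k H (Target.val k H (b • z)) • a • m) =
      (h * epsSBar k H (Target.val k H z)) • m := by
  simp only [Target.val_smul, epsSBar_epsT, smul_smul]
  -- The extra Δ(1) places z next to 1₂, from where `IsTarget.sw_one` carries it to the first leg.
  -- Then ε̄_s(h₂)h₁ = h concludes.
  conv_lhs => rw [← mul_one h]
  rw [sw_comul_mul _ _ (by fun_prop) (by fun_prop)]
  simp only [mul_assoc]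
  calc _ = sw (Δ h) (fun a b => sw (Δ 1) (fun c d =>
        (epsSBar k H (b * d) * (a * (c * epsSBar k H (Target.val k H z)))) • m)) :=
        sw_congr fun a b => z.isTarget.sw_one
          (f := fun c d => (epsSBar k H (b * d) * (a * c)) • m) (by fun_prop) (by fun_prop)
    _ = sw (Δ (h * 1)) (fun a b => (epsSBar k H b * a * epsSBar k H (Target.val k H z)) • m) := by
        rw [sw_comul_mul _ _ (by fun_prop) (by fun_prop)]
        simp only [mul_assoc]
    _ = _ := by rw [← sw_smul, ← sw_mul, sw_epsSBar_mul_self, mul_one]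

/-- The function `m ⊠ z ↦ ε̄_s(z)m`. -/
def rightUnitFun (x : TensorT k H M (Target k H)) : M :=
  sw (TensorT.incl k H M (Target k H) x) (fun m z => epsSBar k H (Target.val k H z) • m)

@[fun_prop]
theorem lin_rightUnitFun : Lin k (rightUnitFun (k := k) (H := H) (M := M)) := by
  unfold rightUnitFun
  fun_prop

@[simp]
theorem rightUnitFun_tm (m : M) (z : Target k H) :
    rightUnitFun (m ⊠ z) = epsSBar k H (Target.val k H z) • m := by
  rw [rightUnitFun, TensorT.sw_incl_tm _ _ (by fun_prop) (by fun_prop), sw_rightUnit_balanced,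
    one_mul]

theorem tm_mk_one (m : M) (z : Target k H) :
    (epsSBar k H (Target.val k H z) • m) ⊠ Target.mk k H 1 = m ⊠ z := by
  conv_lhs => rw [← TensorT.sw_one_tm]
  simp only [Target.smul_mk, mul_one, smul_smul]
  rw [← z.isTarget.sw_one (f := fun a b => (a • m) ⊠ Target.mk k H b) (by fun_prop) (by fun_prop)]
  exact TensorT.sw_one_tm _ _

end Unit

/-- The left unit constraint. -/
def leftUnitIso (M : LLYD k H) : tensor (unitObj k H) M ≅ M :=
  isoMk leftUnitFun (fun m => Target.mk k H 1 ⊠ m) (by fun_prop) (by fun_prop)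
    (TensorT.lin_ext (fun z m => by rw [leftUnitFun_tm, mk_one_tm]) (by fun_prop) (by fun_prop))
    (fun m => by rw [leftUnitFun_tm, Target.val_mk, epsT_one, one_smul])
    (fun h => TensorT.lin_ext (fun z m => by
      rw [TensorT.smul_tm, lin_leftUnitFun.map_sw]
      simp only [leftUnitFun_tm, sw_leftUnit_balanced]
      rw [smul_smul])
      (by fun_prop) (by fun_prop))
    (TensorT.lin_ext (fun z m => by
      refine (sw_self _).symm.trans ?_
      -- On the left z leaves the coaction. On the right z₁ ⊗ z₂ = z1₁ ⊗ 1₂ has the same effect, and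
      -- the coaction of m absorbs the Δ(1).
      rw [leftUnitFun_tm, sw_coact_target _ z.isTarget _ (by fun_prop)
        (by fun_prop), sw_tensorCoact _ _ (by fun_prop) (by fun_prop),
        sw_unitCoact _ (by fun_prop) (by fun_prop)]
      simp only [leftUnitFun_tm, Target.val_mk]
      rw [sw_comul_epsT_of_isTarget (f := fun a b => sw (M.coact m) (fun c m' => (a * c) ⊗ₜ[k]
          (b • m'))) z.isTarget (by fun_prop) (by fun_prop), z.isTarget.sw_comul' (by fun_prop)
          (by fun_prop)]
      simp only [mul_assoc]
      rw [M.sw_one_coact (f := fun c m' => (Target.val k H z * c) ⊗ₜ[k] m') _ (by fun_prop)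
          (by fun_prop)]) (by fun_prop) (by fun_prop))

@[simp]
theorem leftUnitIso_hom_tm {M : LLYD k H} (z : Target k H) (m : M) :
    (leftUnitIso M).hom.hom (z ⊠ m) = Target.val k H z • m :=
  leftUnitFun_tm z m

/-- The right unit constraint. -/
def rightUnitIso (M : LLYD k H) : tensor M (unitObj k H) ≅ M :=
  isoMk rightUnitFun (fun m => m ⊠ Target.mk k H 1) (by fun_prop) (by fun_prop)
    (TensorT.lin_ext (fun z m => by rw [rightUnitFun_tm, tm_mk_one]) (by fun_prop) (by fun_prop))
    (fun m => by rw [rightUnitFun_tm, Target.val_mk, epsSBar_epsT, epsSBar_one, one_smul])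
    (fun h => TensorT.lin_ext (fun m z => by
      rw [TensorT.smul_tm, lin_rightUnitFun.map_sw]
      simp only [rightUnitFun_tm, sw_rightUnit_balanced]
      rw [smul_smul])
      (by fun_prop) (by fun_prop))
    (TensorT.lin_ext (fun m z => by
      refine (sw_self _).symm.trans ?_
      rw [rightUnitFun_tm, sw_coact_epsSBar _ z.isTarget _ (by fun_prop)
        (by fun_prop), sw_tensorCoact _ _ (by fun_prop) (by fun_prop)]
      simp (disch := fun_prop) only [sw_unitCoact, rightUnitFun_tm, Target.val_mk, epsSBar_epsT]
      conv_rhs => rw [sw_comm]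
      -- Write z = ε̄_s(z₂)z₁; the source factor ε̄_s(z₂) then crosses the coaction of m.
      calc _ = sw (M.coact m) (fun c m' => sw (Δ (Target.val k H z)) (fun a b =>
            (c * (epsSBar k H b * a)) ⊗ₜ[k] m')) := by
            simp only [← sw_tmul, ← mul_sw, sw_epsSBar_mul_self]
        _ = _ := by
            rw [sw_comm]
            refine sw_congr fun a b => ?_
            rw [← M.sw_coact_source (f := fun c m' => (c * a) ⊗ₜ[k] m') (isSource_epsSBar b) _
              (by fun_prop) (by fun_prop)]
            simp only [mul_assoc]) (by fun_prop) (by fun_prop))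

@[simp]
theorem rightUnitIso_hom_tm {M : LLYD k H} (m : M) (z : Target k H) :
    (rightUnitIso M).hom.hom (m ⊠ z) = epsSBar k H (Target.val k H z) • m :=
  rightUnitFun_tm m z

instance : MonoidalCategoryStruct (LLYD k H) where
  tensorObj := tensor
  whiskerLeft M _ _ f := tensorMap (𝟙 M) f
  whiskerRight f N := tensorMap f (𝟙 N)
  tensorHom := tensorMap
  tensorUnit := unitObj k H
  associator := assocIso
  leftUnitor := leftUnitIso
  rightUnitor := rightUnitIso

theorem tensor_hom_ext {M N Q : LLYD k H} {f g : tensor M N ⟶ Q}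
    (h : ∀ m n, f.hom (m ⊠ n) = g.hom (m ⊠ n)) : f = g :=
  hom_ext (TensorT.lin_ext h (by fun_prop) (by fun_prop))

theorem tensor_hom_ext₃ {M N Q R : LLYD k H} {f g : tensor (tensor M N) Q ⟶ R}
    (h : ∀ m n q, f.hom ((m ⊠ n) ⊠ q) = g.hom ((m ⊠ n) ⊠ q)) : f = g :=
  hom_ext (TensorT.lin_ext₃ h (by fun_prop) (by fun_prop))

theorem tensor_hom_ext₄ {M N Q R T : LLYD k H} {f g : tensor (tensor (tensor M N) Q) R ⟶ T}
    (h : ∀ m n q r, f.hom (((m ⊠ n) ⊠ q) ⊠ r) = g.hom (((m ⊠ n) ⊠ q) ⊠ r)) : f = g := by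
  refine tensor_hom_ext fun x r => ?_
  revert x
  exact TensorT.lin_ext₃ (fun m n q => h m n q r) (by fun_prop) (by fun_prop)

theorem tensorMap_comp {M M' M'' N N' N'' : LLYD k H} (f : M ⟶ M') (g : N ⟶ N') (f' : M' ⟶ M'')
    (g' : N' ⟶ N'') : tensorMap f g ≫ tensorMap f' g' = tensorMap (f ≫ f') (g ≫ g') :=
  tensor_hom_ext fun m n => by
    rw [comp_hom, LinearMap.comp_apply, tensorMap_tm, tensorMap_tm]
    exact (tensorMap_tm (f ≫ f') (g ≫ g') m n).symm

theorem assocIso_naturality {M M' N N' Q Q' : LLYD k H} (f : M ⟶ M') (g : N ⟶ N') (h : Q ⟶ Q') :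
    tensorMap (tensorMap f g) h ≫ (assocIso M' N' Q').hom =
      (assocIso M N Q).hom ≫ tensorMap f (tensorMap g h) :=
  tensor_hom_ext₃ fun m n q => by
    have h₁ : (tensorMap (tensorMap f g) h).hom ((m ⊠ n) ⊠ q) = (f.hom m ⊠ g.hom n) ⊠ h.hom q :=
      (tensorMap_tm _ _ _ _).trans (congrArg (· ⊠ h.hom q) (tensorMap_tm _ _ _ _))
    have h₂ : (tensorMap f (tensorMap g h)).hom (m ⊠ (n ⊠ q)) = f.hom m ⊠ (g.hom n ⊠ h.hom q) :=
      (tensorMap_tm _ _ _ _).trans (congrArg (f.hom m ⊠ ·) (tensorMap_tm _ _ _ _))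
    rw [comp_hom, comp_hom, LinearMap.comp_apply, LinearMap.comp_apply, h₁, assocIso_hom_tm,
      assocIso_hom_tm, h₂]

theorem pentagon_assocIso (M N Q R : LLYD k H) :
    tensorMap (assocIso M N Q).hom (𝟙 R) ≫ (assocIso M (tensor N Q) R).hom ≫
      tensorMap (𝟙 M) (assocIso N Q R).hom =
    (assocIso (tensor M N) Q R).hom ≫ (assocIso M N (tensor Q R)).hom :=
  tensor_hom_ext₄ fun m n q r => by
    have h₁ : (tensorMap (assocIso M N Q).hom (𝟙 R)).hom (((m ⊠ n) ⊠ q) ⊠ r) =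
        (m ⊠ (n ⊠ q)) ⊠ r :=
      (tensorMap_tm _ _ _ _).trans (congrArg (· ⊠ r) (assocIso_hom_tm _ _ _))
    have h₂ : (assocIso M (tensor N Q) R).hom.hom ((m ⊠ (n ⊠ q)) ⊠ r) = m ⊠ ((n ⊠ q) ⊠ r) :=
      assocIso_hom_tm _ _ _
    have h₃ : (tensorMap (𝟙 M) (assocIso N Q R).hom).hom (m ⊠ ((n ⊠ q) ⊠ r)) =
        m ⊠ (n ⊠ (q ⊠ r)) :=
      (tensorMap_tm _ _ _ _).trans (congrArg (m ⊠ ·) (assocIso_hom_tm _ _ _))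
    have h₄ : (assocIso (tensor M N) Q R).hom.hom (((m ⊠ n) ⊠ q) ⊠ r) = (m ⊠ n) ⊠ (q ⊠ r) :=
      assocIso_hom_tm _ _ _
    have h₅ : (assocIso M N (tensor Q R)).hom.hom ((m ⊠ n) ⊠ (q ⊠ r)) = m ⊠ (n ⊠ (q ⊠ r)) :=
      assocIso_hom_tm _ _ _
    rw [comp_hom, comp_hom, comp_hom, LinearMap.comp_apply, LinearMap.comp_apply,
      LinearMap.comp_apply, h₁, h₂, h₃, h₄, h₅]

/-- After inserting Δ(1), the identity m ⊠ zn = ε̄_s(z)m ⊠ n is `IsTarget.sw_one`. -/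
theorem triangle_assocIso (M N : LLYD k H) :
    (assocIso M (unitObj k H) N).hom ≫ tensorMap (𝟙 M) (leftUnitIso N).hom =
      tensorMap (rightUnitIso M).hom (𝟙 N) :=
  tensor_hom_ext₃ fun m z n => by
    have h₁ : (assocIso M (unitObj k H) N).hom.hom ((m ⊠ z) ⊠ n) = m ⊠ (z ⊠ n) :=
      assocIso_hom_tm _ _ _
    have h₂ : (tensorMap (𝟙 M) (leftUnitIso N).hom).hom (m ⊠ (z ⊠ n)) =
        m ⊠ (Target.val k H z • n) :=
      (tensorMap_tm _ _ _ _).trans (congrArg (m ⊠ ·) (leftUnitIso_hom_tm _ _))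
    have h₃ : (tensorMap (rightUnitIso M).hom (𝟙 N)).hom ((m ⊠ z) ⊠ n) =
        (epsSBar k H (Target.val k H z) • m) ⊠ n :=
      (tensorMap_tm _ _ _ _).trans (congrArg (· ⊠ n) (rightUnitIso_hom_tm _ _))
    rw [comp_hom, LinearMap.comp_apply, h₁, h₂, h₃, ← TensorT.sw_one_tm, ← TensorT.sw_one_tm]
    simp only [smul_smul]
    exact z.isTarget.sw_one (f := fun a b => (a • m) ⊠ (b • n)) (by fun_prop) (by fun_prop)

instance : MonoidalCategory (LLYD k H) :=
  MonoidalCategory.ofTensorHom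
    (id_tensorHom_id := fun M N => tensor_hom_ext fun m n => tensorMap_tm _ _ _ _)
    (tensorHom_comp_tensorHom := fun f g f' g' => tensorMap_comp f g f' g')
    (associator_naturality := assocIso_naturality)
    (leftUnitor_naturality := fun f => tensor_hom_ext fun z m => by
      change (leftUnitIso _).hom.hom ((tensorMap (𝟙 _) f).hom _) = f.hom ((leftUnitIso _).hom.hom _)
      rw [tensorMap_tm, leftUnitIso_hom_tm, id_hom]
      exact ((congrArg f.hom (leftUnitIso_hom_tm z m)).trans (f.map_act _ _)).symm)
    (rightUnitor_naturality := fun f => tensor_hom_ext fun m z => by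
      change (rightUnitIso _).hom.hom ((tensorMap f (𝟙 _)).hom _) =
        f.hom ((rightUnitIso _).hom.hom _)
      rw [tensorMap_tm, rightUnitIso_hom_tm, id_hom]
      exact ((congrArg f.hom (rightUnitIso_hom_tm m z)).trans (f.map_act _ _)).symm)
    (pentagon := pentagon_assocIso)
    (triangle := triangle_assocIso)

end LLYD

namespace LLYD

variable {k : Type u} {H : Type v} [CommRing k] [Ring H] [Algebra k H] [Coalgebra k H]
variable {P : Type*} [AddCommGroup P] [Module k P]

local notation "Δ" => Coalgebra.comul (R := k) (A := H)
local notation "ε" => Coalgebra.counit (R := k) (A := H)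
local infixl:70 " ⊠ " => TensorT.tm k H

/-! #### The braiding -/

section

variable {M N : LLYD k H}

/-- The function `m ⊠ n ↦ m₍₋₁₎n ⊠ m₍₀₎`. -/
def braidFun (x : TensorT k H M N) : TensorT k H N M :=
  sw (TensorT.incl k H M N x) (fun m n => sw (M.coact m) (fun a m' => (a • n) ⊠ m'))

@[fun_prop]
theorem lin_braidFun : Lin k (braidFun (M := M) (N := N)) := by
  unfold braidFun
  fun_prop

variable [WeakBialgebra k H]

theorem braidFun_tm (m : M) (n : N) :
    braidFun (m ⊠ n) = sw (M.coact m) (fun a m' => (a • n) ⊠ m') := by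
  rw [braidFun, TensorT.sw_incl (f := fun m n => sw (M.coact m) (fun a m' => (a • n) ⊠ m')) _ _
    (by fun_prop) (by fun_prop)]
  simp only [smul_smul]
  exact M.sw_one_coact' (f := fun a m' => (a • n) ⊠ m') _ (by fun_prop) (by fun_prop)

/-- Linearity of the braiding is the Yetter-Drinfeld condition of M, evaluated on a ⊗ m' ↦ an ⊠ m'.
-/
theorem braidFun_smul (h : H) (x : TensorT k H M N) : braidFun (h • x) = h • braidFun x := by
  revert x
  refine TensorT.lin_ext (M := M) (N := N) (fun m n => ?_) ?_ ?_
  · rw [TensorT.smul_tm, lin_braidFun.map_sw, braidFun_tm, smul_sw]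
    simp only [braidFun_tm, TensorT.smul_tm, smul_smul]
    rw [M.sw_compat (f := fun a m' => (a • n) ⊠ m') _ _ (by fun_prop) (by fun_prop), sw_comm]
  · fun_prop
  · fun_prop

/-- Colinearity: coassociativity of M turns the two coactions of m into a coproduct of m₍₋₁₎, the
condition for N is applied at h = m₍₋₁₎, and coassociativity restores the iterated coaction. -/
theorem sw_tensorCoact_braidFun {f : H → TensorT k H N M → P} (m : M) (n : N)
    (hl : ∀ b, Lin k (fun a => f a b)) (hr : ∀ a, Lin k (fun b => f a b)) :
    sw (tensorCoact N M (braidFun (m ⊠ n))) f =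
      sw (tensorCoact M N (m ⊠ n)) (fun a x => f a (braidFun x)) := by
  rw [braidFun_tm, sw_tensorCoact _ _ (by fun_prop) (by fun_prop), map_sw]
  simp (disch := fun_prop) only [sw_sw, sw_tensorCoact, braidFun_tm, (hr _).map_sw]
  calc _ = sw (M.coact m) (fun a m' => sw (M.coact m') (fun c m'' => sw (N.coact (a • n))
        (fun b n' => f (b * c) (n' ⊠ m'')))) := by
        refine sw_congr fun a m' => ?_
        rw [sw_comm]
    _ = sw (M.coact m) (fun a m' => sw (Δ a) (fun a c => sw (N.coact (a • n))
        (fun b n' => f (b * c) (n' ⊠ m')))) :=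
        M.isCoaction.sw_coassoc (f := fun a c m' => sw (N.coact (a • n))
        (fun b n' => f (b * c) (n' ⊠ m'))) _ (by fun_prop) (by fun_prop) (by fun_prop)
    _ = sw (M.coact m) (fun a m' => sw (Δ a) (fun a c => sw (N.coact n)
        (fun b n' => f (a * b) ((c • n') ⊠ m')))) :=
        sw_congr fun a m' => N.sw_compat (f := fun b n' => f b (n' ⊠ m')) _ _ (by fun_prop)
          (by fun_prop)
    _ = sw (M.coact m) (fun a m' => sw (M.coact m') (fun c m'' => sw (N.coact n)
        (fun b n' => f (a * b) ((c • n') ⊠ m'')))) :=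
        (M.isCoaction.sw_coassoc (f := fun a c m' => sw (N.coact n)
        (fun b n' => f (a * b) ((c • n') ⊠ m'))) _ (by fun_prop) (by fun_prop) (by fun_prop)).symm
    _ = _ := by
        refine sw_congr fun a m' => ?_
        rw [sw_comm]

end

section

variable [WeakHopfAlgebra k H]
  (hS : Function.Bijective (WeakHopfAlgebra.antipode (k := k) (H := H)))

local notation "T" => antipodeInv hS

variable {M N : LLYD k H}

/-- The function `n ⊠ m ↦ m₍₀₎ ⊠ S⁻¹(m₍₋₁₎)n`. -/
def braidInvFun (x : TensorT k H N M) : TensorT k H M N :=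
  sw (TensorT.incl k H N M x) (fun n m => sw (M.coact m) (fun a m' => m' ⊠ (T a • n)))

@[fun_prop]
theorem lin_braidInvFun : Lin k (braidInvFun (M := M) (N := N) hS) := by
  unfold braidInvFun
  fun_prop

/-- Balancedness: 1₂ in H_t leaves the coaction of m, and under S⁻¹ it meets 1₁ as S⁻¹(1₂)1₁ =
ε̄_t(1) = 1. -/
theorem braidInvFun_tm (m : M) (n : N) :
    braidInvFun hS (n ⊠ m) = sw (M.coact m) (fun a m' => m' ⊠ (T a • n)) := by
  rw [braidInvFun, TensorT.sw_incl (f := fun n m => sw (M.coact m) (fun a m' => m' ⊠ (T a • n))) _ _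
    (by fun_prop) (by fun_prop)]
  rw [← sw_one_epsT (by fun_prop) (by fun_prop)]
  simp (disch := fun_prop) only [sw_coact_target _ (isTarget_epsT _)]
  rw [sw_one_epsT (f := fun p q => sw (M.coact m) (fun a m' => m' ⊠ (T (q * a) • p • n)))
    (by fun_prop) (by fun_prop), sw_comm]
  refine sw_congr fun a m' => ?_
  simp only [antipodeInv_mul, smul_smul, mul_assoc]
  rw [← (Lin.tm_right lin_id _).map_sw, ← sw_smul, ← mul_sw, sw_antipodeInv_mul hS,
    epsTBar_one, mul_one]

/-- Coassociativity produces S⁻¹(h₂)h₁ = ε̄_t(h) with h = m₍₋₁₎. Expanding ε̄_t yields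
ε(m₍₋₁₎1₁)m₍₀₎ ⊠ 1₂n, and since 1₁ lies in H_s it crosses the coaction, giving 1₁m ⊠ 1₂n. -/
theorem braidInvFun_braidFun (x : TensorT k H M N) : braidInvFun hS (braidFun x) = x := by
  revert x
  refine TensorT.lin_ext (M := M) (N := N) (fun m n => ?_) (by fun_prop) (by fun_prop)
  rw [braidFun_tm, (lin_braidInvFun hS).map_sw]
  simp only [braidInvFun_tm, smul_smul]
  calc _ = sw (M.coact m) (fun a m' => sw (Δ a) (fun a c => m' ⊠ ((T c * a) • n))) :=
        M.isCoaction.sw_coassoc (f := fun a c m' => m' ⊠ ((T c * a) • n)) _ (by fun_prop)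
          (by fun_prop) (by fun_prop)
    _ = sw (M.coact m) (fun a m' => m' ⊠ (epsTBar k H a • n)) := by
        refine sw_congr fun a m' => ?_
        rw [← sw_antipodeInv_mul hS, sw_smul, (Lin.tm_right lin_id _).map_sw]
    _ = sw (Δ 1) (fun p q => sw (M.coact m) (fun a m' => ε (a * p) • (m' ⊠ (q • n)))) := by
        rw [sw_comm]
        refine sw_congr fun a m' => ?_
        rw [epsTBar_eq, sw_smul, (Lin.tm_right lin_id _).map_sw]
        refine sw_congr fun p q => ?_
        rw [smul_assoc, (Lin.tm_right (k := k) lin_id _).map_smul]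
    _ = sw (Δ 1) (fun p q => (p • m) ⊠ (q • n)) := by
        rw [← sw_one_epsS (by fun_prop) (by fun_prop), ← sw_one_epsS (f := fun p q =>
          (p • m) ⊠ (q • n)) (by fun_prop) (by fun_prop)]
        refine sw_congr fun p q => ?_
        rw [M.sw_coact_source (f := fun a m' => ε a • (m' ⊠ (q • n))) (isSource_epsS p) _
          (by fun_prop) (by fun_prop), M.isCoaction.sw_counit
          (f := fun m' => (epsS k H p • m') ⊠ (q • n)) _ (by fun_prop)]
    _ = m ⊠ n := TensorT.sw_one_tm _ _

/-- Here h₂S⁻¹(h₁) = ε̄_s(h) appears instead, and 1₂ in H_t is carried into the coaction of m. -/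
theorem braidFun_braidInvFun (x : TensorT k H N M) : braidFun (braidInvFun hS x) = x := by
  revert x
  refine TensorT.lin_ext (M := N) (N := M) (fun n m => ?_) (by fun_prop) (by fun_prop)
  rw [braidInvFun_tm, lin_braidFun.map_sw]
  simp only [braidFun_tm, smul_smul]
  calc _ = sw (M.coact m) (fun a m' => sw (Δ a) (fun a c => ((c * T a) • n) ⊠ m')) :=
        M.isCoaction.sw_coassoc (f := fun a c m' => ((c * T a) • n) ⊠ m') _ (by fun_prop)
          (by fun_prop) (by fun_prop)
    _ = sw (M.coact m) (fun a m' => (epsSBar k H a • n) ⊠ m') := by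
        refine sw_congr fun a m' => ?_
        rw [← sw_mul_antipodeInv hS, sw_smul, (Lin.tm_left lin_id _).map_sw]
    _ = sw (Δ 1) (fun p q => sw (M.coact m) (fun a m' => ε (q * a) • ((p • n) ⊠ m'))) := by
        rw [sw_comm]
        refine sw_congr fun a m' => ?_
        rw [epsSBar_eq, sw_smul, (Lin.tm_left lin_id _).map_sw]
        refine sw_congr fun p q => ?_
        rw [smul_assoc, (Lin.tm_left (k := k) lin_id _).map_smul]
    _ = sw (Δ 1) (fun p q => (p • n) ⊠ (q • m)) := by
        rw [← sw_one_epsT (by fun_prop) (by fun_prop), ← sw_one_epsT (f := fun p q =>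
          (p • n) ⊠ (q • m)) (by fun_prop) (by fun_prop)]
        refine sw_congr fun p q => ?_
        rw [← M.sw_coact_target (f := fun a m' => ε a • ((p • n) ⊠ m')) (isTarget_epsT q) _
          (by fun_prop) (by fun_prop), M.isCoaction.sw_counit
          (f := fun m' => (p • n) ⊠ m') _ (by fun_prop)]
    _ = n ⊠ m := TensorT.sw_one_tm _ _

variable (M N) in
/-- The braiding. -/
def braidIso : tensor M N ≅ tensor N M :=
  isoMk braidFun (braidInvFun hS) (by fun_prop) (by fun_prop) (braidInvFun_braidFun hS)
    (braidFun_braidInvFun hS) braidFun_smul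
    (TensorT.lin_ext (fun m n => (sw_self _).symm.trans
      (sw_tensorCoact_braidFun _ _ (by fun_prop) (by fun_prop))) (by fun_prop) (by fun_prop))

theorem braidIso_hom_tm (m : M) (n : N) :
    (braidIso hS M N).hom.hom (m ⊠ n) = sw (M.coact m) (fun a m' => (a • n) ⊠ m') :=
  braidFun_tm m n

theorem braidIso_naturality {M' N' : LLYD k H} (f : M ⟶ M') (g : N ⟶ N') :
    tensorMap f g ≫ (braidIso hS M' N').hom = (braidIso hS M N).hom ≫ tensorMap g f :=
  tensor_hom_ext fun m n => by
    rw [comp_hom, comp_hom, LinearMap.comp_apply, LinearMap.comp_apply, tensorMap_tm,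
      braidIso_hom_tm, braidIso_hom_tm, map_sw, sw_hom _ _ (by fun_prop) (by fun_prop)]
    refine sw_congr fun a m' => ?_
    rw [tensorMap_tm, g.map_act]

theorem assocIso_inv_tm {M N Q : LLYD k H} (m : M) (n : N) (q : Q) :
    (assocIso M N Q).inv.hom (m ⊠ (n ⊠ q)) = (m ⊠ n) ⊠ q :=
  TensorT.assocInvFun_tm m n q

theorem tensor_hom_ext₃' {M N Q R : LLYD k H} {f g : tensor M (tensor N Q) ⟶ R}
    (h : ∀ m n q, f.hom (m ⊠ (n ⊠ q)) = g.hom (m ⊠ (n ⊠ q))) : f = g :=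
  hom_ext (TensorT.lin_ext₃' h (by fun_prop) (by fun_prop))

/-- The element m₍₋₁₎ acts on n ⊠ q through its coproduct, while braiding twice uses the iterated
coaction of m; coassociativity identifies the two. -/
theorem hexagon_forward_braidIso (M N Q : LLYD k H) :
    (assocIso M N Q).hom ≫ (braidIso hS M (tensor N Q)).hom ≫ (assocIso N Q M).hom =
      tensorMap (braidIso hS M N).hom (𝟙 Q) ≫ (assocIso N M Q).hom ≫
        tensorMap (𝟙 N) (braidIso hS M Q).hom :=
  tensor_hom_ext₃ fun m n q => by
    have h₁ : (assocIso M N Q).hom.hom ((m ⊠ n) ⊠ q) = m ⊠ (n ⊠ q) := assocIso_hom_tm _ _ _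
    have h₂ : (braidIso hS M (tensor N Q)).hom.hom (m ⊠ (n ⊠ q)) =
        sw (M.coact m) (fun a m' => sw (Δ a) (fun b c => ((b • n) ⊠ (c • q)) ⊠ m')) := by
      refine (braidIso_hom_tm _ _ _).trans (sw_congr fun a m' => ?_)
      rw [TensorT.smul_tm, (Lin.tm_left lin_id _).map_sw]
    have h₃ : (tensorMap (braidIso hS M N).hom (𝟙 Q)).hom ((m ⊠ n) ⊠ q) =
        sw (M.coact m) (fun a m' => ((a • n) ⊠ m') ⊠ q) := by
      refine (tensorMap_tm _ _ _ _).trans ?_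
      rw [braidIso_hom_tm]
      exact (Lin.tm_left lin_id _).map_sw _ _
    have h₄ (n : N) (m : M) : (tensorMap (𝟙 N) (braidIso hS M Q).hom).hom (n ⊠ (m ⊠ q)) =
        sw (M.coact m) (fun a m' => n ⊠ ((a • q) ⊠ m')) := by
      refine (tensorMap_tm _ _ _ _).trans ?_
      rw [braidIso_hom_tm]
      exact (Lin.tm_right lin_id _).map_sw _ _
    simp only [comp_hom, LinearMap.comp_apply]
    rw [h₁, h₂, h₃, map_sw, map_sw, map_sw]
    refine (sw_congr fun a m' => ?_).trans ((M.isCoaction.sw_coassoc (f := fun a c m' => (a • n) ⊠ ((c • q) ⊠ m')) _ (by fun_prop)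
      (by fun_prop) (by fun_prop)).symm.trans (sw_congr fun a m' =>
        ((congrArg _ (assocIso_hom_tm _ _ _)).trans (h₄ _ _)).symm))
    rw [map_sw]
    exact sw_congr fun b c => assocIso_hom_tm _ _ _

/-- The coaction of m ⊠ n has H-leg m₍₋₁₎n₍₋₁₎, and acting by this product on q is acting twice. -/
theorem hexagon_reverse_braidIso (M N Q : LLYD k H) :
    (assocIso M N Q).inv ≫ (braidIso hS (tensor M N) Q).hom ≫ (assocIso Q M N).inv =
      tensorMap (𝟙 M) (braidIso hS N Q).hom ≫ (assocIso M Q N).inv ≫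
        tensorMap (braidIso hS M Q).hom (𝟙 N) :=
  tensor_hom_ext₃' fun m n q => by
    have h₁ : (assocIso M N Q).inv.hom (m ⊠ (n ⊠ q)) = (m ⊠ n) ⊠ q := assocIso_inv_tm _ _ _
    have h₂ : (braidIso hS (tensor M N) Q).hom.hom ((m ⊠ n) ⊠ q) =
        sw (M.coact m) (fun a m' => sw (N.coact n) (fun b n' => ((a * b) • q) ⊠ (m' ⊠ n'))) :=
      (braidIso_hom_tm _ _ _).trans (sw_tensorCoact (f := fun a x => (a • q) ⊠ x) _ _ (by fun_prop)
        (by fun_prop))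
    have h₃ : (tensorMap (𝟙 M) (braidIso hS N Q).hom).hom (m ⊠ (n ⊠ q)) =
        sw (N.coact n) (fun b n' => m ⊠ ((b • q) ⊠ n')) := by
      refine (tensorMap_tm _ _ _ _).trans ?_
      rw [braidIso_hom_tm]
      exact (Lin.tm_right lin_id _).map_sw _ _
    have h₄ (q : Q) (n : N) : (tensorMap (braidIso hS M Q).hom (𝟙 N)).hom ((m ⊠ q) ⊠ n) =
        sw (M.coact m) (fun a m' => ((a • q) ⊠ m') ⊠ n) := by
      refine (tensorMap_tm _ _ _ _).trans ?_
      rw [braidIso_hom_tm]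
      exact (Lin.tm_left lin_id _).map_sw _ _
    simp only [comp_hom, LinearMap.comp_apply]
    rw [h₁, h₂, h₃, map_sw, map_sw, map_sw]
    refine (sw_congr fun a m' => ?_).trans ((sw_comm _ _ (fun a m' b n' =>
      ((a • b • q) ⊠ m') ⊠ n')).trans (sw_congr fun b n' =>
        ((congrArg _ (assocIso_inv_tm _ _ _)).trans (h₄ _ _)).symm))
    rw [map_sw]
    refine sw_congr fun b n' => (assocIso_inv_tm _ _ _).trans ?_
    rw [mul_smul]

/-- The braiding of the category of left-left Yetter-Drinfeld modules. -/
abbrev braidedCategory : BraidedCategory (LLYD k H) where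
  braiding := braidIso hS
  braiding_naturality_right := fun _ _ _ f => braidIso_naturality hS (𝟙 _) f
  braiding_naturality_left := fun f _ => braidIso_naturality hS f (𝟙 _)
  hexagon_forward := hexagon_forward_braidIso hS
  hexagon_reverse := hexagon_reverse_braidIso hS

end

end LLYD

section

variable {k : Type*} [CommRing k] {P : Type*} [AddCommGroup P] [Module k P]

theorem apply_tmul_eq_sw {A B C D : Type*} [AddCommGroup A] [Module k A] [AddCommGroup B]
    [Module k B] [AddCommGroup C] [Module k C] [AddCommGroup D] [Module k D]
    (g : (A ⊗[k] B) ⊗[k] (C ⊗[k] D) →ₗ[k] P) (x : A ⊗[k] B) (y : C ⊗[k] D) :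
    g (x ⊗ₜ[k] y) = sw x (fun a b => sw y (fun c d => g ((a ⊗ₜ[k] b) ⊗ₜ[k] (c ⊗ₜ[k] d)))) :=
  (apply_eq_sw (g ∘ₗ (TensorProduct.mk k _ _).flip y) x).trans
    (sw_congr fun a b => apply_eq_sw (g ∘ₗ TensorProduct.mk k _ _ (a ⊗ₜ[k] b)) y)

end

namespace LLYD

variable {k : Type u} {H : Type v} [CommRing k] [Ring H] [Algebra k H] [Coalgebra k H]
variable {P : Type*} [AddCommGroup P] [Module k P]

local notation "Δ" => Coalgebra.comul (R := k) (A := H)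
local notation "ε" => Coalgebra.counit (R := k) (A := H)
local infixl:70 " ⊠ " => TensorT.tm k H

/-! #### Comparison with the standard structure -/

theorem codiag_eq_sw (M N : LLYD k H) (x : M ⊗[k] N) :
    codiag M N x = sw x (fun m n => sw (M.coact m) (fun a m' => sw (N.coact n) (fun b n' =>
      (a * b) ⊗ₜ[k] (m' ⊗ₜ[k] n')))) := by
  rw [apply_eq_sw (codiag M N)]
  refine sw_congr fun m n => ?_
  exact apply_tmul_eq_sw ((LinearMap.mul' k H).rTensor (M ⊗[k] N) ∘ₗ
    (TensorProduct.tensorTensorTensorComm k H M H N).toLinearMap) _ _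

theorem eq_tm_of_incl {M N : Type v} [AddCommGroup M] [Module k M] [Module H M]
    [IsScalarTower k H M] [AddCommGroup N] [Module k N] [Module H N] [IsScalarTower k H N]
    {x : TensorT k H M N} {m : M} {n : N}
    (h : TensorT.incl k H M N x = balance (lAct k H M) (lAct k H N) (m ⊗ₜ[k] n)) : x = m ⊠ n :=
  TensorT.incl_injective k H M N h

/-- The codiagonal formula already lands in H ⊗ (M ⊗_t N): a Δ(1) applied to m₍₀₎ ⊗ n₍₀₎ is absorbed
after 1₁ in H_s crosses the coaction of m and stands before n₍₋₁₎. -/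
theorem lTensor_incl_tensorCoact [WeakBialgebra k H] (M N : LLYD k H) :
    (TensorT.incl k H M N).lTensor H ∘ₗ tensorCoact M N = codiag M N ∘ₗ TensorT.incl k H M N := by
  ext x
  rw [LinearMap.comp_apply, LinearMap.comp_apply]
  revert x
  refine TensorT.lin_ext (M := M) (N := N) (fun m n => ?_) (by fun_prop) (by fun_prop)
  rw [lTensor_eq_sw, sw_tensorCoact _ _ (by fun_prop) (by fun_prop), TensorT.incl_tm, map_sw]
  simp only [codiag_eq_sw]
  simp (disch := fun_prop) only [sw_of_tmul]
  rw [tensorCoact_balanced (f := fun a m n => a ⊗ₜ[k] (m ⊗ₜ[k] n)) _ _ (by fun_prop)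
    (by fun_prop) (by fun_prop)]
  simp only [TensorT.incl_tm, tmul_sw]
  calc _ = sw (Δ 1) (fun p q => sw (M.coact m) (fun a m' => sw (N.coact n) (fun b n' =>
        (a * b) ⊗ₜ[k] ((p • m') ⊗ₜ[k] (q • n'))))) := by
        conv_rhs => rw [sw_comm]
        refine sw_congr fun a m' => ?_
        conv_rhs => rw [sw_comm]
    _ = sw (Δ 1) (fun p q => sw (M.coact m) (fun a m' => sw (N.coact n) (fun b n' =>
        (a * (p * b)) ⊗ₜ[k] (m' ⊗ₜ[k] (q • n'))))) := by
        rw [← sw_one_epsS (by fun_prop) (by fun_prop), ← sw_one_epsS (f := fun p q =>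
          sw (M.coact m) (fun a m' => sw (N.coact n) (fun b n' =>
          (a * (p * b)) ⊗ₜ[k] (m' ⊗ₜ[k] (q • n'))))) (by fun_prop) (by fun_prop)]
        refine sw_congr fun p q => ?_
        rw [← M.sw_coact_source (f := fun a m' => sw (N.coact n) (fun b n' =>
          (a * b) ⊗ₜ[k] (m' ⊗ₜ[k] (q • n')))) (isSource_epsS p) _ (by fun_prop) (by fun_prop)]
        simp only [mul_assoc]
    _ = _ := by
        rw [sw_comm]
        refine sw_congr fun a m' => ?_
        exact N.sw_one_coact (f := fun b n' => (a * b) ⊗ₜ[k] (m' ⊗ₜ[k] n')) _ (by fun_prop)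
          (by fun_prop)

variable [WeakHopfAlgebra k H]
  (hS : Function.Bijective (WeakHopfAlgebra.antipode (k := k) (H := H)))

/-- The braided monoidal structure on left-left Yetter-Drinfeld modules is the standard one. -/
def standardBraided : letI := braidedCategory hS; StandardBraided k H :=
  letI := braidedCategory hS
  { tens := fun M N => TensorT.incl k H M N
    tens_injective := fun M N => TensorT.incl_injective k H M N
    range_tens := fun M N => TensorT.range_incl k H M N
    tens_act := fun _ _ h x => TensorT.incl_smul h x
    tens_coact := lTensor_incl_tensorCoact
    tens_hom := fun f g => LinearMap.ext fun x => TensorT.incl_map f.map_act g.map_act x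
    unit := Target.val k H
    unit_injective := Target.val_injective k H
    range_unit := Target.range_val k H
    unit_act := fun h z => Target.val_smul h z
    unit_coact := fun z => by
      change (Target.val k H).lTensor H (unitCoact z) = _
      rw [lTensor_eq_sw, sw_unitCoact _ (by fun_prop) (by fun_prop)]
      simp only [Target.val_mk]
      rw [sw_comul_epsT_of_isTarget (f := fun a b => a ⊗ₜ[k] b) z.isTarget (by fun_prop)
        (by fun_prop), sw_self]
    associator := fun _ _ _ => LinearMap.ext fun x => TensorT.incl_assocFun x
    leftUnitor := fun M z m x hx => by
      obtain rfl : x = z ⊠ m := eq_tm_of_incl hx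
      exact leftUnitIso_hom_tm z m
    rightUnitor := fun M m z x hx => by
      obtain rfl : x = m ⊠ z := eq_tm_of_incl hx
      exact rightUnitIso_hom_tm m z
    braiding := fun M N m n x hx => by
      obtain rfl : x = m ⊠ n := eq_tm_of_incl hx
      change TensorT.incl k H N M ((braidIso hS M N).hom.hom (m ⊠ n)) = _
      rw [braidIso_hom_tm, map_sw]
      simp only [TensorT.incl_tm, smul_smul, rTensor_eq_sw]
      rw [sw_comm]
      exact M.sw_one_coact (f := fun a m' => (a • n) ⊗ₜ[k] m') _ (by fun_prop) (by fun_prop) }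

end LLYD

/-! ### Right coactions and changes of side -/

section Twist

variable {k : Type u} {H : Type v} [CommRing k] [Ring H] [Algebra k H] [Coalgebra k H]
variable {M : Type v} {P : Type*} [AddCommGroup M] [Module k M] [AddCommGroup P] [Module k P]

local notation "Δ" => Coalgebra.comul (R := k) (A := H)
local notation "ε" => Coalgebra.counit (R := k) (A := H)

theorem IsRightCoaction.sw_coassoc {δ : M →ₗ[k] M ⊗[k] H} (hδ : IsRightCoaction δ)
    {f : M → H → H → P} (m : M) (h₁ : ∀ b c, Lin k (fun a => f a b c))
    (h₂ : ∀ a c, Lin k (fun b => f a b c)) (h₃ : ∀ a b, Lin k (fun c => f a b c)) :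
    sw (δ m) (fun n b => sw (δ n) (fun n a => f n a b)) =
      sw (δ m) (fun n a => sw (Δ a) (fun b c => f n b c)) := by
  have := congrArg (fun y => sw y (fun a y => sw y (fun c d => f a c d)))
    (LinearMap.congr_fun hδ.coassoc m)
  simp only [LinearMap.comp_apply, LinearEquiv.coe_coe] at this
  rw [sw_lTensor _ _ (by fun_prop) (by fun_prop), sw_assoc _ h₁ h₂ h₃,
    sw_rTensor _ _ (by fun_prop) (by fun_prop)] at this
  exact this.symm

theorem IsRightCoaction.sw_counit {δ : M →ₗ[k] M ⊗[k] H} (hδ : IsRightCoaction δ)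
    {f : M → P} (m : M) (hf : Lin k f) : sw (δ m) (fun n a => ε a • f n) = f m := by
  conv_rhs => rw [← LinearMap.id_apply (R := k) m, ← hδ.counit]
  simp only [LinearMap.comp_apply, LinearEquiv.coe_coe]
  rw [lTensor_eq_sw, rid_eq_sw, sw_sw _ _ (by fun_prop) (by fun_prop), hf.map_sw]
  refine sw_congr fun a n => ?_
  rw [sw_of_tmul _ _ (by fun_prop) (by fun_prop), hf.map_smul]

theorem IsRightCoaction.of_sw {δ : M →ₗ[k] M ⊗[k] H}
    (h₁ : ∀ m, sw (δ m) (fun n b => sw (δ n) (fun n a => n ⊗ₜ[k] (a ⊗ₜ[k] b))) =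
      sw (δ m) (fun n a => sw (Δ a) (fun b c => n ⊗ₜ[k] (b ⊗ₜ[k] c))))
    (h₂ : ∀ m, sw (δ m) (fun n a => ε a • n) = m) :
    IsRightCoaction δ where
  coassoc := by
    ext m
    simp only [LinearMap.comp_apply, LinearEquiv.coe_coe]
    rw [lTensor_eq_sw, rTensor_eq_sw, assoc_eq_sw]
    simp (disch := fun_prop) only [sw_sw, sw_of_tmul]
    rw [h₁]
    refine sw_congr fun a n => ?_
    rw [← tmul_sw, sw_self]
  counit := by
    ext m
    simp only [LinearMap.comp_apply, LinearEquiv.coe_coe]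
    rw [lTensor_eq_sw, rid_eq_sw]
    simp (disch := fun_prop) only [sw_sw, sw_of_tmul]
    exact h₂ m

/-- The right coaction `m ↦ m₍₀₎ ⊗ φ(m₍₋₁₎)`. -/
def coactToRight (φ : H →ₗ[k] H) (δ : M →ₗ[k] H ⊗[k] M) : M →ₗ[k] M ⊗[k] H :=
  Lin.toLinearMap (f := fun m => sw (δ m) (fun a n => n ⊗ₜ[k] φ a)) (by fun_prop)

/-- The left coaction `m ↦ φ(m₍₁₎) ⊗ m₍₀₎`. -/
def coactToLeft (φ : H →ₗ[k] H) (δ : M →ₗ[k] M ⊗[k] H) : M →ₗ[k] H ⊗[k] M :=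
  Lin.toLinearMap (f := fun m => sw (δ m) (fun n a => φ a ⊗ₜ[k] n)) (by fun_prop)

theorem sw_coactToRight (φ : H →ₗ[k] H) (δ : M →ₗ[k] H ⊗[k] M) {f : M → H → P} (m : M)
    (hl : ∀ b, Lin k (fun a => f a b)) (hr : ∀ a, Lin k (fun b => f a b)) :
    sw (coactToRight φ δ m) f = sw (δ m) (fun a n => f n (φ a)) := by
  rw [coactToRight, Lin.toLinearMap_apply]
  simp (disch := fun_prop) only [sw_sw, sw_of_tmul]

theorem sw_coactToLeft (φ : H →ₗ[k] H) (δ : M →ₗ[k] M ⊗[k] H) {f : H → M → P} (m : M)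
    (hl : ∀ b, Lin k (fun a => f a b)) (hr : ∀ a, Lin k (fun b => f a b)) :
    sw (coactToLeft φ δ m) f = sw (δ m) (fun n a => f (φ a) n) := by
  rw [coactToLeft, Lin.toLinearMap_apply]
  simp (disch := fun_prop) only [sw_sw, sw_of_tmul]

theorem coactToLeft_coactToRight {φ ψ : H →ₗ[k] H} (h : ∀ a, ψ (φ a) = a)
    (δ : M →ₗ[k] H ⊗[k] M) : coactToLeft ψ (coactToRight φ δ) = δ := by
  ext m
  refine (sw_coactToRight (f := fun n a => ψ a ⊗ₜ[k] n) _ _ _ (by fun_prop) (by fun_prop)).trans ?_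
  simp only [h, sw_self]

theorem coactToRight_coactToLeft {φ ψ : H →ₗ[k] H} (h : ∀ a, ψ (φ a) = a)
    (δ : M →ₗ[k] M ⊗[k] H) : coactToRight ψ (coactToLeft φ δ) = δ := by
  ext m
  refine (sw_coactToLeft (f := fun a n => n ⊗ₜ[k] ψ a) _ _ _ (by fun_prop) (by fun_prop)).trans ?_
  simp only [h, sw_self]

/-- An anti-homomorphism of coalgebras. -/
structure IsAntiCoalgHom (φ : H →ₗ[k] H) : Prop where
  comul : ∀ h, Δ (φ h) = sw (Δ h) (fun a b => φ b ⊗ₜ[k] φ a)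
  counit : ∀ h, ε (φ h) = ε h

theorem IsAntiCoalgHom.sw_comul {φ : H →ₗ[k] H} (hφ : IsAntiCoalgHom φ) {f : H → H → P} (h : H)
    (hl : ∀ b, Lin k (fun a => f a b)) (hr : ∀ a, Lin k (fun b => f a b)) :
    sw (Δ (φ h)) f = sw (Δ h) (fun a b => f (φ b) (φ a)) := by
  rw [hφ.comul]
  simp (disch := fun_prop) only [sw_sw, sw_of_tmul]

/-- Moving the H-leg to the other side reverses the order of iterated coactions, which the reversal
of coproducts by φ compensates. -/
theorem IsLeftCoaction.toRight {φ : H →ₗ[k] H} (hφ : IsAntiCoalgHom φ) {δ : M →ₗ[k] H ⊗[k] M}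
    (hδ : IsLeftCoaction δ) : IsRightCoaction (coactToRight φ δ) := by
  refine .of_sw (fun m => ?_) (fun m => ?_)
  · simp (disch := fun_prop) only [sw_coactToRight, hφ.sw_comul]
    exact hδ.sw_coassoc (f := fun b a n => n ⊗ₜ[k] (φ a ⊗ₜ[k] φ b)) _ (by fun_prop) (by fun_prop)
      (by fun_prop)
  · rw [sw_coactToRight _ _ _ (by fun_prop) (by fun_prop)]
    simp only [hφ.counit]
    exact hδ.sw_counit (f := fun n => n) _ (by fun_prop)

theorem IsRightCoaction.toLeft {φ : H →ₗ[k] H} (hφ : IsAntiCoalgHom φ) {δ : M →ₗ[k] M ⊗[k] H}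
    (hδ : IsRightCoaction δ) : IsLeftCoaction (coactToLeft φ δ) := by
  refine .of_sw (fun m => ?_) (fun m => ?_)
  · simp (disch := fun_prop) only [sw_coactToLeft, hφ.sw_comul]
    exact hδ.sw_coassoc (f := fun n b a => φ a ⊗ₜ[k] (φ b ⊗ₜ[k] n)) _ (by fun_prop) (by fun_prop)
      (by fun_prop)
  · rw [sw_coactToLeft _ _ _ (by fun_prop) (by fun_prop)]
    simp only [hφ.counit]
    exact hδ.sw_counit (f := fun n => n) _ (by fun_prop)

variable [WeakHopfAlgebra k H]
  (hS : Function.Bijective (WeakHopfAlgebra.antipode (k := k) (H := H)))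

theorem isAntiCoalgHom_antipode
    (hS : Function.Bijective (WeakHopfAlgebra.antipode (k := k) (H := H))) :
    IsAntiCoalgHom (WeakHopfAlgebra.antipode (k := k) (H := H)) where
  comul := comul_antipode
  counit := counit_antipode hS

theorem isAntiCoalgHom_antipodeInv : IsAntiCoalgHom (antipodeInv hS) where
  comul := comul_antipodeInv hS
  counit := counit_antipodeInv hS

@[simp]
theorem rAct_apply [Module Hᵐᵒᵖ M] [IsScalarTower k Hᵐᵒᵖ M] (h : H) (m : M) :
    rAct k H M h m = MulOpposite.op h • m := rfl

/-- The right action `mh = S⁻¹(h)m`, as a ring homomorphism. -/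
def antipodeInvHom : Hᵐᵒᵖ →+* H where
  toFun h := antipodeInv hS h.unop
  map_one' := antipodeInv_one hS
  map_mul' _ _ := antipodeInv_mul hS _ _
  map_zero' := map_zero _
  map_add' _ _ := map_add _ _ _

variable (k H) in
/-- The left action `hm = mS(h)`, as a ring homomorphism. -/
def antipodeHom : H →+* Hᵐᵒᵖ where
  toFun h := MulOpposite.op (WeakHopfAlgebra.antipode (k := k) h)
  map_one' := by rw [antipode_one]; rfl
  map_mul' _ _ := by rw [antipode_mul]; rfl
  map_zero' := by rw [map_zero]; rfl
  map_add' _ _ := by rw [map_add]; rfl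

end Twist

/-! ### The Yetter-Drinfeld conditions on the other three sides -/

section Compat

variable {k : Type u} {H : Type v} [CommRing k] [Ring H] [Algebra k H] [Coalgebra k H]
variable {P : Type*} [AddCommGroup P] [Module k P]

local notation "Δ" => Coalgebra.comul (R := k) (A := H)

theorem RRYD.sw_compat (M : RRYD k H) {f : M → H → P} (h : H) (m : M)
    (hl : ∀ b, Lin k (fun a => f a b)) (hr : ∀ a, Lin k (fun b => f a b)) :
    sw (Δ h) (fun a b => sw (M.coact (MulOpposite.op b • m)) (fun n c => f n (a * c))) =
      sw (Δ h) (fun a b => sw (M.coact m) (fun n c => f (MulOpposite.op a • n) (c * b))) := by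
  have := congrArg (fun y : M ⊗[k] H => sw y f) (M.compat h m)
  rw [map₂_eq_sw, sweedler_eq_sw] at this
  simp (disch := fun_prop) only [sw_sw, sw_of_tmul, LinearMap.mul_apply', rAct_apply,
    LinearMap.flip_apply] at this
  rw [this]
  refine sw_congr fun a b => ?_
  simp only [LinearMap.flip_apply, LinearMap.comp_apply, LinearMap.lTensorHom, LinearMap.coe_mk,
    AddHom.coe_mk, lAct_apply, rAct_apply]
  rw [sw_lTensor _ _ hl hr]
  rfl

theorem RRYD.sw_coact_one [WeakBialgebra k H] (M : RRYD k H) {f : M → H → P} (m : M)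
    (hl : ∀ b, Lin k (fun a => f a b)) (hr : ∀ a, Lin k (fun b => f a b)) :
    sw (Δ 1) (fun a b => sw (M.coact m) (fun n c => f (MulOpposite.op a • n) (c * b))) =
      sw (M.coact m) f := by
  have := (mem_balanced_iff' (fun g h m => by simp [mul_smul]) (fun g h m => by simp [mul_assoc])
    _).1 (M.coact_mem m)
  conv_rhs => rw [← this]
  simp (disch := fun_prop) only [sw_sw, sw_of_tmul, LinearMap.mul_apply', rAct_apply,
    LinearMap.flip_apply]

theorem RLYD.sw_compat (M : RLYD k H) {f : H → M → P} (h : H) (m : M)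
    (hl : ∀ b, Lin k (fun a => f a b)) (hr : ∀ a, Lin k (fun b => f a b)) :
    sw (Δ h) (fun a b => sw (M.coact (MulOpposite.op a • m)) (fun c n => f (b * c) n)) =
      sw (Δ h) (fun a b => sw (M.coact m) (fun c n => f (c * a) (MulOpposite.op b • n))) := by
  have := congrArg (fun y : H ⊗[k] M => sw y f) (M.compat h m)
  rw [map₂_eq_sw, sweedler_eq_sw] at this
  simp (disch := fun_prop) only [sw_sw, sw_of_tmul, LinearMap.mul_apply', rAct_apply,
    LinearMap.flip_apply] at this
  rw [this]
  refine sw_congr fun a b => ?_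
  simp only [LinearMap.flip_apply, LinearMap.comp_apply, LinearMap.rTensorHom, LinearMap.coe_mk,
    AddHom.coe_mk, lAct_apply, rAct_apply]
  rw [sw_rTensor _ _ hl hr]
  rfl

theorem RLYD.sw_coact_one [WeakBialgebra k H] (M : RLYD k H) {f : H → M → P} (m : M)
    (hl : ∀ b, Lin k (fun a => f a b)) (hr : ∀ a, Lin k (fun b => f a b)) :
    sw (Δ 1) (fun a b => sw (M.coact m) (fun c n => f (c * a) (MulOpposite.op b • n))) =
      sw (M.coact m) f := by
  have := (mem_balanced_iff' (fun g h m => by simp [mul_assoc]) (fun g h m => by simp [mul_smul])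
    _).1 (M.coact_mem m)
  conv_rhs => rw [← this]
  simp (disch := fun_prop) only [sw_sw, sw_of_tmul, LinearMap.mul_apply', rAct_apply,
    LinearMap.flip_apply]

theorem LRYD.sw_compat (M : LRYD k H) {f : M → H → P} (h : H) (m : M)
    (hl : ∀ b, Lin k (fun a => f a b)) (hr : ∀ a, Lin k (fun b => f a b)) :
    sw (Δ h) (fun a b => sw (M.coact (b • m)) (fun n c => f n (c * a))) =
      sw (Δ h) (fun a b => sw (M.coact m) (fun n c => f (a • n) (b * c))) := by
  have := congrArg (fun y : M ⊗[k] H => sw y f) (M.compat h m)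
  rw [map₂_eq_sw, sweedler_eq_sw] at this
  simp (disch := fun_prop) only [sw_sw, sw_of_tmul, LinearMap.mul_apply', lAct_apply,
    LinearMap.flip_apply] at this
  rw [this]
  refine sw_congr fun a b => ?_
  simp only [LinearMap.flip_apply, LinearMap.comp_apply, LinearMap.lTensorHom, LinearMap.coe_mk,
    AddHom.coe_mk, lAct_apply, rAct_apply]
  rw [sw_lTensor _ _ hl hr]
  rfl

theorem LRYD.sw_coact_one [WeakBialgebra k H] (M : LRYD k H) {f : M → H → P} (m : M)
    (hl : ∀ b, Lin k (fun a => f a b)) (hr : ∀ a, Lin k (fun b => f a b)) :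
    sw (Δ 1) (fun a b => sw (M.coact m) (fun n c => f (a • n) (b * c))) =
      sw (M.coact m) f := by
  have := (mem_balanced_iff (fun g h m => by simp [mul_smul]) (fun g h m => by simp [mul_assoc])
    _).1 (M.coact_mem m)
  conv_rhs => rw [← this]
  simp (disch := fun_prop) only [sw_sw, sw_of_tmul, LinearMap.mul_apply', lAct_apply]

end Compat

/-! ### Antipode forms of the Yetter-Drinfeld conditions -/

section Exchange

variable {k : Type u} {H : Type v} [CommRing k] [Ring H] [Algebra k H] [Coalgebra k H]
variable {P : Type*} [AddCommGroup P] [Module k P]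

local notation "Δ" => Coalgebra.comul (R := k) (A := H)

theorem sw_comul₄ {f : H → H → H → H → P} (h : H) (h₁ : ∀ b c d, Lin k (fun a => f a b c d))
    (h₂ : ∀ a c d, Lin k (fun b => f a b c d)) (h₃ : ∀ a b d, Lin k (fun c => f a b c d))
    (h₄ : ∀ a b c, Lin k (fun d => f a b c d)) :
    sw (Δ h) (fun a g => sw (Δ g) (fun x d => sw (Δ x) (fun b c => f a b c d))) =
      sw (Δ h) (fun y d => sw (Δ y) (fun z c => sw (Δ z) (fun a b => f a b c d))) := by
  rw [← sw_comul (f := fun a x d => sw (Δ x) (fun b c => f a b c d)) _ (by fun_prop) (by fun_prop)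
    (by fun_prop)]
  exact sw_congr fun y d => (sw_comul (f := fun a b c => f a b c d) _ (by fun_prop) (by fun_prop)
    (by fun_prop)).symm

theorem LRYD.sw_coact_one' [WeakBialgebra k H] (M : LRYD k H) {f : M → H → P} (m : M)
    (hl : ∀ b, Lin k (fun a => f a b)) (hr : ∀ a, Lin k (fun b => f a b)) :
    sw (Δ 1) (fun a b => sw (M.coact (b • m)) (fun n c => f n (c * a))) = sw (M.coact m) f := by
  rw [M.sw_compat _ _ hl hr, M.sw_coact_one _ hl hr]

/-- The counterpart of `LLYD.sw_coact_source`. For left-right modules it is H_t whose elements cross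
the coaction, since the condition pairs h₂m with h₁. -/
theorem LRYD.sw_coact_target [WeakBialgebra k H] (M : LRYD k H) {f : M → H → P} {z : H}
    (hz : IsTarget k z) (m : M)
    (hl : ∀ b, Lin k (fun a => f a b)) (hr : ∀ a, Lin k (fun b => f a b)) :
    sw (M.coact m) (fun n c => f n (c * z)) = sw (M.coact m) (fun n c => f (z • n) c) := by
  rw [← M.sw_coact_one' (f := fun n c => f n (c * z)) _ (by fun_prop) (by fun_prop)]
  simp only [mul_assoc]
  rw [← hz.sw_comul (f := fun a b => sw (M.coact (b • m)) (fun n c => f n (c * a))) (by fun_prop)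
    (by fun_prop), M.sw_compat _ _ hl hr, hz.sw_comul' (by fun_prop) (by fun_prop),
    ← M.sw_coact_one (f := fun n c => f (z • n) c) _ (by fun_prop) (by fun_prop)]
  simp only [mul_smul]

theorem RLYD.sw_coact_one' [WeakBialgebra k H] (M : RLYD k H) {f : H → M → P} (m : M)
    (hl : ∀ b, Lin k (fun a => f a b)) (hr : ∀ a, Lin k (fun b => f a b)) :
    sw (Δ 1) (fun a b => sw (M.coact (MulOpposite.op a • m)) (fun c n => f (b * c) n)) =
      sw (M.coact m) f := by
  rw [M.sw_compat _ _ hl hr, M.sw_coact_one _ hl hr]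

theorem RLYD.sw_coact_source [WeakBialgebra k H] (M : RLYD k H) {f : H → M → P} {y : H}
    (hy : IsSource k y) (m : M)
    (hl : ∀ b, Lin k (fun a => f a b)) (hr : ∀ a, Lin k (fun b => f a b)) :
    sw (M.coact m) (fun c n => f (y * c) n) =
      sw (M.coact m) (fun c n => f c (MulOpposite.op y • n)) := by
  rw [← M.sw_coact_one' (f := fun c n => f (y * c) n) _ (by fun_prop) (by fun_prop)]
  simp only [← mul_assoc]
  rw [← hy.sw_comul' (f := fun a b => sw (M.coact (MulOpposite.op a • m)) (fun c n => f (b * c) n))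
    (by fun_prop) (by fun_prop), M.sw_compat _ _ hl hr, hy.sw_comul (by fun_prop) (by fun_prop),
    ← M.sw_coact_one (f := fun c n => f c (MulOpposite.op y • n)) _ (by fun_prop) (by fun_prop)]
  simp only [MulOpposite.op_mul, mul_smul]

variable [WeakHopfAlgebra k H]

local notation "S" => WeakHopfAlgebra.antipode (k := k) (H := H)

/-- The coaction of gm is g₁m₍₋₁₎S(g₃) ⊗ g₂m₍₀₎. Inserting Δ(1) gives (g₁m)₍₋₁₎ε_t(g₂) ⊗ (g₁m)₍₀₎;
then ε_t(g₂) is opened as g₂S(g₃) and the condition is applied to the first two legs. -/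
theorem LLYD.sw_coact_smul (M : LLYD k H) {f : H → M → P} (g : H) (m : M)
    (hl : ∀ b, Lin k (fun a => f a b)) (hr : ∀ a, Lin k (fun b => f a b)) :
    sw (M.coact (g • m)) f = sw (Δ g) (fun x d => sw (Δ x) (fun a b => sw (M.coact m)
      (fun c n => f (a * c * S d) (b • n)))) := by
  rw [← M.sw_one_coact' _ hl hr]
  simp only [smul_smul]
  rw [← sw_comul_epsT (f := fun a b => sw (M.coact (a • m)) (fun c n => f (c * b) n)) _
    (by fun_prop) (by fun_prop)]
  calc _ = sw (Δ g) (fun a y => sw (Δ y) (fun b d => sw (M.coact (a • m))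
        (fun c n => f (c * b * S d) n))) := by
        refine sw_congr fun a y => ?_
        rw [← sw_mul_antipode, Lin.map_sw (g := fun e => sw (M.coact (a • m))
          (fun c n => f (c * e) n)) (by fun_prop)]
        simp only [mul_assoc]
    _ = _ := by
        rw [← sw_comul (f := fun a b d => sw (M.coact (a • m))
          (fun c n => f (c * b * S d) n)) _ (by fun_prop) (by fun_prop) (by fun_prop)]
        exact sw_congr fun x d => M.sw_compat (f := fun c n => f (c * S d) n) _ _ (by fun_prop)
          (by fun_prop)

/-- Substitute the formula for the coaction of h₂m, collapse S(h₁)h₂ to a source element, and use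
ε_s(h₁) ⊗ h₂ = 1₁ ⊗ h1₂ to absorb it. This is the form of the condition needed when only the action
or only the coaction changes side. -/
theorem LLYD.sw_antipode_coact (M : LLYD k H) {f : H → M → P} (h : H) (m : M)
    (hl : ∀ b, Lin k (fun a => f a b)) (hr : ∀ a, Lin k (fun b => f a b)) :
    sw (Δ h) (fun a b => sw (M.coact (b • m)) (fun c n => f (S a * c) n)) =
      sw (Δ h) (fun a b => sw (M.coact m) (fun c n => f (c * S b) (a • n))) := by
  calc _ = sw (Δ h) (fun a g => sw (Δ g) (fun x d => sw (Δ x) (fun b e => sw (M.coact m)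
        (fun c n => f (S a * b * c * S d) (e • n))))) := by
        refine sw_congr fun a g => ?_
        rw [M.sw_coact_smul (f := fun c n => f (S a * c) n) _ _ (by fun_prop) (by fun_prop)]
        simp only [mul_assoc]
    _ = sw (Δ h) (fun y d => sw (Δ y) (fun z e => sw (Δ z) (fun a b => sw (M.coact m)
        (fun c n => f (S a * b * c * S d) (e • n))))) :=
        sw_comul₄ _ (by fun_prop) (by fun_prop) (by fun_prop) (by fun_prop)
    _ = sw (Δ h) (fun y d => sw (Δ y) (fun z e => sw (M.coact m)
        (fun c n => f (epsS k H z * c * S d) (e • n)))) := by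
        refine sw_congr fun y d => sw_congr fun z e => ?_
        rw [← sw_antipode_mul, Lin.map_sw (g := fun t => sw (M.coact m)
          (fun c n => f (t * c * S d) (e • n))) (by fun_prop)]
    _ = _ := by
        refine sw_congr fun y d => ?_
        rw [sw_comul_epsS (f := fun z e => sw (M.coact m)
          (fun c n => f (z * c * S d) (e • n))) _ (by fun_prop) (by fun_prop),
          ← M.sw_one_coact (f := fun c n => f (c * S d) (y • n)) _ (by fun_prop) (by fun_prop)]
        simp only [mul_smul]

variable (hS : Function.Bijective (WeakHopfAlgebra.antipode (k := k) (H := H)))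

local notation "T" => antipodeInv hS

/-- The coaction of mg is S⁻¹(g₃)m₍₋₁₎g₁ ⊗ m₍₀₎g₂. The inverse antipode occurs because the inserted
Δ(1) yields ε̄_t(g₂) = S⁻¹(g₃)g₂. -/
theorem RLYD.sw_coact_smul (M : RLYD k H) {f : H → M → P} (g : H) (m : M)
    (hl : ∀ b, Lin k (fun a => f a b)) (hr : ∀ a, Lin k (fun b => f a b)) :
    sw (M.coact (MulOpposite.op g • m)) f = sw (Δ g) (fun x d => sw (Δ x) (fun a b =>
      sw (M.coact m) (fun c n => f (T d * c * a) (MulOpposite.op b • n)))) := by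
  rw [← M.sw_coact_one' _ hl hr]
  simp only [smul_smul, ← MulOpposite.op_mul]
  rw [← sw_comul_epsTBar (f := fun a b => sw (M.coact (MulOpposite.op a • m))
    (fun c n => f (b * c) n)) _ (by fun_prop) (by fun_prop)]
  calc _ = sw (Δ g) (fun a y => sw (Δ y) (fun b d => sw (M.coact (MulOpposite.op a • m))
        (fun c n => f (T d * (b * c)) n))) := by
        refine sw_congr fun a y => ?_
        rw [← sw_antipodeInv_mul hS, Lin.map_sw (g := fun e => sw (M.coact (MulOpposite.op a • m))
          (fun c n => f (e * c) n)) (by fun_prop)]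
        simp only [mul_assoc]
    _ = _ := by
        rw [← sw_comul (f := fun a b d => sw (M.coact (MulOpposite.op a • m))
          (fun c n => f (T d * (b * c)) n)) _ (by fun_prop) (by fun_prop) (by fun_prop)]
        simp only [mul_assoc]
        exact sw_congr fun x d => M.sw_compat (f := fun c n => f (T d * c) n) _ _ (by fun_prop)
          (by fun_prop)

theorem RLYD.sw_coact_antipodeInv (M : RLYD k H) {f : H → M → P} (h : H) (m : M)
    (hl : ∀ b, Lin k (fun a => f a b)) (hr : ∀ a, Lin k (fun b => f a b)) :
    sw (Δ h) (fun a b => sw (M.coact (MulOpposite.op b • m)) (fun c n => f (c * T a) n)) =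
      sw (Δ h) (fun a b => sw (M.coact m) (fun c n => f (T b * c) (MulOpposite.op a • n))) := by
  calc _ = sw (Δ h) (fun a g => sw (Δ g) (fun x d => sw (Δ x) (fun b e => sw (M.coact m)
        (fun c n => f (T d * c * (b * T a)) (MulOpposite.op e • n))))) := by
        refine sw_congr fun a g => ?_
        rw [M.sw_coact_smul hS (f := fun c n => f (c * T a) n) _ _ (by fun_prop) (by fun_prop)]
        simp only [mul_assoc]
    _ = sw (Δ h) (fun y d => sw (Δ y) (fun z e => sw (Δ z) (fun a b => sw (M.coact m)
        (fun c n => f (T d * c * (b * T a)) (MulOpposite.op e • n))))) :=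
        sw_comul₄ _ (by fun_prop) (by fun_prop) (by fun_prop) (by fun_prop)
    _ = sw (Δ h) (fun y d => sw (Δ y) (fun z e => sw (M.coact m)
        (fun c n => f (T d * c * epsSBar k H z) (MulOpposite.op e • n)))) := by
        refine sw_congr fun y d => sw_congr fun z e => ?_
        rw [← sw_mul_antipodeInv hS, Lin.map_sw (g := fun t => sw (M.coact m)
          (fun c n => f (T d * c * t) (MulOpposite.op e • n))) (by fun_prop)]
    _ = _ := by
        refine sw_congr fun y d => ?_
        rw [sw_comul_epsSBar (f := fun z e => sw (M.coact m)
          (fun c n => f (T d * c * z) (MulOpposite.op e • n))) _ (by fun_prop) (by fun_prop),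
          ← M.sw_coact_one (f := fun c n => f (T d * c) (MulOpposite.op y • n)) _ (by fun_prop)
            (by fun_prop)]
        simp only [MulOpposite.op_mul, mul_smul, mul_assoc]

/-- The coaction of gm is g₂m₍₀₎ ⊗ g₃m₍₁₎S⁻¹(g₁), from ε̄_s(g₁) opened as g₂S⁻¹(g₁). -/
theorem LRYD.sw_coact_smul (M : LRYD k H) {f : M → H → P} (g : H) (m : M)
    (hl : ∀ b, Lin k (fun a => f a b)) (hr : ∀ a, Lin k (fun b => f a b)) :
    sw (M.coact (g • m)) f = sw (Δ g) (fun d x => sw (Δ x) (fun a b => sw (M.coact m)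
      (fun n c => f (a • n) (b * c * T d)))) := by
  rw [← M.sw_coact_one' _ hl hr]
  simp only [smul_smul]
  rw [← sw_comul_epsSBar (f := fun a b => sw (M.coact (b • m)) (fun n c => f n (c * a))) _
    (by fun_prop) (by fun_prop)]
  calc _ = sw (Δ g) (fun y a => sw (Δ y) (fun d b => sw (M.coact (a • m))
        (fun n c => f n (c * b * T d)))) := by
        refine sw_congr fun y a => ?_
        rw [← sw_mul_antipodeInv hS, Lin.map_sw (g := fun e => sw (M.coact (a • m))
          (fun n c => f n (c * e))) (by fun_prop)]
        simp only [mul_assoc]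
    _ = _ := by
        rw [sw_comul (f := fun d b a => sw (M.coact (a • m))
          (fun n c => f n (c * b * T d))) _ (by fun_prop) (by fun_prop) (by fun_prop)]
        exact sw_congr fun d x => M.sw_compat (f := fun n c => f n (c * T d)) _ _ (by fun_prop)
          (by fun_prop)

theorem LRYD.sw_antipodeInv_coact (M : LRYD k H) {f : M → H → P} (h : H) (m : M)
    (hl : ∀ b, Lin k (fun a => f a b)) (hr : ∀ a, Lin k (fun b => f a b)) :
    sw (Δ h) (fun a b => sw (M.coact (a • m)) (fun n c => f n (T b * c))) =
      sw (Δ h) (fun a b => sw (M.coact m) (fun n c => f (b • n) (c * T a))) := by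
  calc _ = sw (Δ h) (fun g e => sw (Δ g) (fun d x => sw (Δ x) (fun a b => sw (M.coact m)
        (fun n c => f (a • n) (T e * b * c * T d))))) := by
        refine sw_congr fun a g => ?_
        rw [M.sw_coact_smul hS (f := fun n c => f n (T g * c)) _ _ (by fun_prop) (by fun_prop)]
        simp only [mul_assoc]
    _ = sw (Δ h) (fun d y => sw (Δ y) (fun a z => sw (Δ z) (fun b e => sw (M.coact m)
        (fun n c => f (a • n) (T e * b * c * T d))))) := by
        rw [sw_comul (f := fun d x e => sw (Δ x) (fun a b => sw (M.coact m)
          (fun n c => f (a • n) (T e * b * c * T d)))) _ (by fun_prop) (by fun_prop) (by fun_prop)]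
        exact sw_congr fun d y => sw_comul (f := fun a b e => sw (M.coact m)
          (fun n c => f (a • n) (T e * b * c * T d))) _ (by fun_prop) (by fun_prop) (by fun_prop)
    _ = sw (Δ h) (fun d y => sw (Δ y) (fun a z => sw (M.coact m)
        (fun n c => f (a • n) (epsTBar k H z * c * T d)))) := by
        refine sw_congr fun y d => sw_congr fun z e => ?_
        rw [← sw_antipodeInv_mul hS, Lin.map_sw (g := fun t => sw (M.coact m)
          (fun n c => f (z • n) (t * c * T y))) (by fun_prop)]
    _ = _ := by
        refine sw_congr fun d y => ?_
        rw [sw_comul_epsTBar (f := fun a z => sw (M.coact m)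
          (fun n c => f (a • n) (z * c * T d))) _ (by fun_prop) (by fun_prop),
          ← M.sw_coact_one (f := fun n c => f (y • n) (c * T d)) _ (by fun_prop) (by fun_prop)]
        simp only [mul_smul]

end Exchange

/-! ### The isomorphisms of categories -/

section Objects

variable {k : Type u} {H : Type v} [CommRing k] [Ring H] [Algebra k H] [Coalgebra k H]
  [WeakHopfAlgebra k H]
  (hS : Function.Bijective (WeakHopfAlgebra.antipode (k := k) (H := H)))

local notation "Δ" => Coalgebra.comul (R := k) (A := H)
local notation "S" => WeakHopfAlgebra.antipode (k := k) (H := H)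
local notation "T" => antipodeInv hS

/-- The substitution of S(h) for h in a Sweedler sum. With its inverse below, it turns the condition
on one side at h into the condition on the other side at S(h) or S⁻¹(h). -/
theorem sw_comul_eq_antipode {P : Type*} [AddCommGroup P] [Module k P] {f : H → H → P} (h : H)
    (hl : ∀ b, Lin k (fun a => f a b)) (hr : ∀ a, Lin k (fun b => f a b)) :
    sw (Δ h) f = sw (Δ (S h)) (fun a b => f (T b) (T a)) := by
  rw [sw_comul_antipode _ (by fun_prop) (by fun_prop)]
  simp only [antipodeInv_antipode]

theorem sw_comul_eq_antipodeInv {P : Type*} [AddCommGroup P] [Module k P] {f : H → H → P} (h : H)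
    (hl : ∀ b, Lin k (fun a => f a b)) (hr : ∀ a, Lin k (fun b => f a b)) :
    sw (Δ h) f = sw (Δ (T h)) (fun a b => f (S b) (S a)) := by
  rw [sw_comul_antipodeInv hS _ (by fun_prop) (by fun_prop)]
  simp only [antipode_antipodeInv]

section RightModule

variable (M : Type v) [AddCommGroup M] [Module k M]

/-- The right module structure `mh = S⁻¹(h)m` on a left module. -/
abbrev rightModule [Module H M] : Module Hᵐᵒᵖ M := Module.compHom M (antipodeInvHom hS)

variable (k H) in
/-- The left module structure `hm = mS(h)` on a right module. -/
abbrev leftModule [Module Hᵐᵒᵖ M] : Module H M := Module.compHom M (antipodeHom k H)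

theorem rightModule_isScalarTower [Module H M] [IsScalarTower k H M] :
    letI := rightModule hS M; IsScalarTower k Hᵐᵒᵖ M :=
  letI := rightModule hS M
  ⟨fun c h m => by
    change T (c • h.unop) • m = c • (T h.unop • m)
    rw [map_smul, smul_assoc]⟩

variable (k H) in
theorem leftModule_isScalarTower [Module Hᵐᵒᵖ M] [IsScalarTower k Hᵐᵒᵖ M] :
    letI := leftModule k H M; IsScalarTower k H M :=
  letI := leftModule k H M
  ⟨fun c h m => by
    change MulOpposite.op (S (c • h)) • m = c • (MulOpposite.op (S h) • m)
    rw [map_smul, MulOpposite.op_smul, smul_assoc]⟩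

end RightModule

/-- The right-right module with `mh = S⁻¹(h)m` and coaction `m₍₀₎ ⊗ S(m₍₋₁₎)`. -/
abbrev LLYD.toRR (M : LLYD k H) : RRYD k H where
  carrier := M
  module := rightModule hS M
  isScalarTower := rightModule_isScalarTower hS M
  coact := coactToRight S M.coact
  isCoaction := M.isCoaction.toRight (isAntiCoalgHom_antipode hS)
  coact_mem m := by
    letI := rightModule hS M
    haveI := rightModule_isScalarTower hS M
    refine (mem_balanced_iff' (fun g h m => by simp [mul_smul]) (fun g h m => by simp [mul_assoc])
      _).2 ?_
    calc _ = sw (Δ 1) (fun a b => sw (M.coact m) (fun c n => (T a • n) ⊗ₜ[k] (S c * b))) :=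
          sw_congr fun a b => sw_coactToRight (f := fun n c => (T a • n) ⊗ₜ[k] (c * b)) _ _ _
            (by fun_prop) (by fun_prop)
      _ = sw (Δ 1) (fun a b => sw (M.coact m) (fun c n => (b • n) ⊗ₜ[k] S (a * c))) := by
          rw [sw_comul_eq_antipodeInv hS _ (by fun_prop) (by fun_prop), antipodeInv_one]
          simp only [antipodeInv_antipode, antipode_mul]
      _ = _ := M.sw_one_coact (f := fun c n => n ⊗ₜ[k] S c) _ (by fun_prop) (by fun_prop)
  compat h m := by
    letI := rightModule hS M
    haveI := rightModule_isScalarTower hS M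
    rw [map₂_eq_sw, sweedler_eq_sw]
    calc _ = sw (Δ h) (fun a b => sw (M.coact m) (fun c n => (T a • n) ⊗ₜ[k] (S c * b))) :=
          sw_congr fun a b => sw_coactToRight (f := fun n c => (T a • n) ⊗ₜ[k] (c * b)) _ _ _
            (by fun_prop) (by fun_prop)
      _ = sw (Δ (T h)) (fun a b => sw (M.coact m) (fun c n => (b • n) ⊗ₜ[k] S (a * c))) := by
          rw [sw_comul_eq_antipodeInv hS _ (by fun_prop) (by fun_prop)]
          simp only [antipodeInv_antipode, antipode_mul]
      _ = sw (Δ (T h)) (fun a b => sw (M.coact (a • m)) (fun c n => n ⊗ₜ[k] S (c * b))) :=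
          (M.sw_compat (f := fun c n => n ⊗ₜ[k] S c) _ _ (by fun_prop) (by fun_prop)).symm
      _ = sw (Δ h) (fun a b => sw (M.coact (T b • m)) (fun c n => n ⊗ₜ[k] (a * S c))) := by
          rw [sw_comul_eq_antipodeInv hS h (by fun_prop) (by fun_prop)]
          simp only [antipodeInv_antipode, antipode_mul]
      _ = _ := sw_congr fun a b => ((lTensor_eq_sw _ _).trans (sw_coactToRight
          (f := fun n c => n ⊗ₜ[k] (a * c)) _ _ _ (by fun_prop) (by fun_prop))).symm

/-- The left-left module with `hm = mS(h)` and coaction `S⁻¹(m₍₁₎) ⊗ m₍₀₎`. -/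
abbrev RRYD.toLL (M : RRYD k H) : LLYD k H where
  carrier := M
  module := leftModule k H M
  isScalarTower := leftModule_isScalarTower k H M
  coact := coactToLeft (T) M.coact
  isCoaction := M.isCoaction.toLeft (isAntiCoalgHom_antipodeInv hS)
  coact_mem m := by
    letI := leftModule k H M
    haveI := leftModule_isScalarTower k H M
    refine (mem_balanced_iff (fun g h m => by simp [mul_assoc]) (fun g h m => by simp [mul_smul])
      _).2 ?_
    calc _ = sw (Δ 1) (fun a b => sw (M.coact m) (fun n c => (a * T c) ⊗ₜ[k]
          (MulOpposite.op (S b) • n))) :=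
          sw_congr fun a b => sw_coactToLeft (f := fun c n => (a * c) ⊗ₜ[k]
            (MulOpposite.op (S b) • n)) _ _ _ (by fun_prop) (by fun_prop)
      _ = sw (Δ 1) (fun a b => sw (M.coact m) (fun n c => T (c * b) ⊗ₜ[k]
          (MulOpposite.op a • n))) := by
          rw [sw_comul_eq_antipode hS _ (by fun_prop) (by fun_prop), antipode_one]
          simp only [antipode_antipodeInv, antipodeInv_mul]
      _ = _ := M.sw_coact_one (f := fun n c => T c ⊗ₜ[k] n) _ (by fun_prop) (by fun_prop)
  compat h m := by
    letI := leftModule k H M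
    haveI := leftModule_isScalarTower k H M
    rw [map₂_eq_sw, sweedler_eq_sw]
    calc _ = sw (Δ h) (fun a b => sw (M.coact m) (fun n c => (a * T c) ⊗ₜ[k]
          (MulOpposite.op (S b) • n))) :=
          sw_congr fun a b => sw_coactToLeft (f := fun c n => (a * c) ⊗ₜ[k]
            (MulOpposite.op (S b) • n)) _ _ _ (by fun_prop) (by fun_prop)
      _ = sw (Δ (S h)) (fun a b => sw (M.coact m) (fun n c => T (c * b) ⊗ₜ[k]
          (MulOpposite.op a • n))) := by
          rw [sw_comul_eq_antipode hS _ (by fun_prop) (by fun_prop)]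
          simp only [antipode_antipodeInv, antipodeInv_mul]
      _ = sw (Δ (S h)) (fun a b => sw (M.coact (MulOpposite.op b • m)) (fun n c =>
          T (a * c) ⊗ₜ[k] n)) :=
          (M.sw_compat (f := fun n c => T c ⊗ₜ[k] n) _ _ (by fun_prop) (by fun_prop)).symm
      _ = sw (Δ h) (fun a b => sw (M.coact (MulOpposite.op (S a) • m)) (fun n c =>
          (T c * b) ⊗ₜ[k] n)) := by
          rw [sw_comul_eq_antipode hS h (by fun_prop) (by fun_prop)]
          simp only [antipode_antipodeInv, antipodeInv_mul]
      _ = _ := sw_congr fun a b => ((rTensor_eq_sw _ _).trans (sw_coactToLeft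
          (f := fun c n => (c * b) ⊗ₜ[k] n) _ _ _ (by fun_prop) (by fun_prop))).symm

/-- The right-left module with `mh = S⁻¹(h)m` and the same coaction. -/
abbrev LLYD.toRL (M : LLYD k H) : RLYD k H where
  carrier := M
  module := rightModule hS M
  isScalarTower := rightModule_isScalarTower hS M
  coact := M.coact
  isCoaction := M.isCoaction
  coact_mem m := by
    letI := rightModule hS M
    haveI := rightModule_isScalarTower hS M
    refine (mem_balanced_iff' (fun g h m => by simp [mul_assoc]) (fun g h m => by simp [mul_smul])
      _).2 ?_
    calc _ = sw (Δ 1) (fun a b => sw (M.coact m) (fun c n => (c * a) ⊗ₜ[k] (T b • n))) := rfl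
      _ = sw (Δ 1) (fun a b => sw (M.coact m) (fun c n => (c * (epsSBar k H b * a)) ⊗ₜ[k] n)) := by
          -- Taking 1₂ in H_t makes S⁻¹(1₂) = ε̄_s(1₂) a source element, which crosses the coaction.
          -- The sum then collapses by ε̄_s(1₂)1₁ = 1.
          rw [← sw_one_epsT (by fun_prop) (by fun_prop)]
          refine sw_congr fun a b => ?_
          rw [antipodeInv_epsT, ← M.sw_coact_source (f := fun c n => (c * a) ⊗ₜ[k] n)
            (isSource_epsSBar b) _ (by fun_prop) (by fun_prop)]
          simp only [mul_assoc]
      _ = _ := by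
          rw [sw_comm]
          simp only [← sw_tmul, ← mul_sw, sw_epsSBar_mul_self, mul_one, sw_self]
  compat h m := by
    letI := rightModule hS M
    haveI := rightModule_isScalarTower hS M
    rw [map₂_eq_sw, sweedler_eq_sw]
    calc _ = sw (Δ h) (fun a b => sw (M.coact m) (fun c n => (c * a) ⊗ₜ[k] (T b • n))) := rfl
      -- Only the action is twisted, so after the substitution an antipode remains and
      -- `LLYD.sw_antipode_coact` replaces the plain condition.
      _ = sw (Δ (T h)) (fun a b => sw (M.coact m) (fun c n => (c * S b) ⊗ₜ[k] (a • n))) := by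
          rw [sw_comul_eq_antipodeInv hS _ (by fun_prop) (by fun_prop)]
          simp only [antipodeInv_antipode]
      _ = sw (Δ (T h)) (fun a b => sw (M.coact (b • m)) (fun c n => (S a * c) ⊗ₜ[k] n)) :=
          (M.sw_antipode_coact (f := fun c n => c ⊗ₜ[k] n) _ _ (by fun_prop) (by fun_prop)).symm
      _ = sw (Δ h) (fun a b => sw (M.coact (T a • m)) (fun c n => (b * c) ⊗ₜ[k] n)) := by
          rw [sw_comul_eq_antipodeInv hS h (by fun_prop) (by fun_prop)]
          simp only [antipodeInv_antipode]
      _ = _ := sw_congr fun a b => (rTensor_eq_sw (LinearMap.mul k H b) (M.coact (T a • m))).symm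

/-- The left-left module with `hm = mS(h)` and the same coaction. -/
abbrev RLYD.toLL (M : RLYD k H) : LLYD k H where
  carrier := M
  module := leftModule k H M
  isScalarTower := leftModule_isScalarTower k H M
  coact := M.coact
  isCoaction := M.isCoaction
  coact_mem m := by
    letI := leftModule k H M
    haveI := leftModule_isScalarTower k H M
    refine (mem_balanced_iff (fun g h m => by simp [mul_assoc]) (fun g h m => by simp [mul_smul])
      _).2 ?_
    calc _ = sw (Δ 1) (fun a b => sw (M.coact m) (fun c n => (a * c) ⊗ₜ[k]
          (MulOpposite.op (S b) • n))) := rfl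
      _ = sw (Δ 1) (fun a b => sw (M.coact m) (fun c n => (a * S b * c) ⊗ₜ[k] n)) := by
          -- For 1₂ in H_t the element S(1₂) is a source element and crosses the coaction of a
          -- right-left module; then 1₁S(1₂) = ε_t(1) = 1.
          rw [← sw_one_epsT (by fun_prop) (by fun_prop), ← sw_one_epsT (f := fun a b =>
            sw (M.coact m) (fun c n => (a * S b * c) ⊗ₜ[k] n)) (by fun_prop) (by fun_prop)]
          refine sw_congr fun a b => ?_
          have hb : IsSource k (S (epsT k H b)) := by
            rw [antipode_of_isTarget (isTarget_epsT b)]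
            exact isSource_epsS _
          rw [← M.sw_coact_source (f := fun c n => (a * c) ⊗ₜ[k] n) hb _ (by fun_prop)
            (by fun_prop)]
          simp only [mul_assoc]
      _ = _ := by
          rw [sw_comm]
          simp only [← sw_tmul, ← sw_mul, sw_mul_antipode, epsT_one, one_mul, sw_self]
  compat h m := by
    letI := leftModule k H M
    haveI := leftModule_isScalarTower k H M
    rw [map₂_eq_sw, sweedler_eq_sw]
    calc _ = sw (Δ h) (fun a b => sw (M.coact m) (fun c n => (a * c) ⊗ₜ[k]
          (MulOpposite.op (S b) • n))) := rfl
      _ = sw (Δ (S h)) (fun a b => sw (M.coact m) (fun c n => (T b * c) ⊗ₜ[k]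
          (MulOpposite.op a • n))) := by
          rw [sw_comul_eq_antipode hS _ (by fun_prop) (by fun_prop)]
          simp only [antipode_antipodeInv]
      _ = sw (Δ (S h)) (fun a b => sw (M.coact (MulOpposite.op b • m)) (fun c n =>
          (c * T a) ⊗ₜ[k] n)) :=
          (M.sw_coact_antipodeInv hS (f := fun c n => c ⊗ₜ[k] n) _ _ (by fun_prop)
            (by fun_prop)).symm
      _ = sw (Δ h) (fun a b => sw (M.coact (MulOpposite.op (S a) • m)) (fun c n =>
          (c * b) ⊗ₜ[k] n)) := by
          rw [sw_comul_eq_antipode hS h (by fun_prop) (by fun_prop)]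
          simp only [antipode_antipodeInv]
      _ = _ := sw_congr fun a b => (rTensor_eq_sw ((LinearMap.mul k H).flip b)
          (M.coact (MulOpposite.op (S a) • m))).symm

/-- The left-right module with the same action and coaction `m₍₀₎ ⊗ S⁻¹(m₍₋₁₎)`. -/
abbrev LLYD.toLR (M : LLYD k H) : LRYD k H where
  carrier := M
  coact := coactToRight (T) M.coact
  isCoaction := M.isCoaction.toRight (isAntiCoalgHom_antipodeInv hS)
  coact_mem m := by
    refine (mem_balanced_iff (fun g h m => by simp [mul_smul]) (fun g h m => by simp [mul_assoc])
      _).2 ?_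
    calc _ = sw (Δ 1) (fun a b => sw (M.coact m) (fun c n => (a • n) ⊗ₜ[k] (b * T c))) :=
          sw_congr fun a b => sw_coactToRight (f := fun n c => (a • n) ⊗ₜ[k] (b * c)) _ _ _
            (by fun_prop) (by fun_prop)
      _ = sw (Δ 1) (fun a b => sw (M.coact m) (fun c n => ((a * S b) • n) ⊗ₜ[k] T c)) := by
          -- Write 1₂S⁻¹(m₍₋₁₎) as S⁻¹(m₍₋₁₎S(1₂)). The source element S(1₂) crosses to the module
          -- leg, where 1₁S(1₂) = 1.
          rw [← sw_one_epsT (by fun_prop) (by fun_prop), ← sw_one_epsT (f := fun a b =>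
            sw (M.coact m) (fun c n => ((a * S b) • n) ⊗ₜ[k] T c)) (by fun_prop) (by fun_prop)]
          refine sw_congr fun a b => ?_
          have hb : IsSource k (S (epsT k H b)) := by
            rw [antipode_of_isTarget (isTarget_epsT b)]
            exact isSource_epsS _
          simp only [mul_smul]
          rw [← M.sw_coact_source (f := fun c n => (a • n) ⊗ₜ[k] T c) hb _ (by fun_prop)
            (by fun_prop)]
          simp only [antipodeInv_mul, antipodeInv_antipode]
      _ = sw (M.coact m) (fun c n => n ⊗ₜ[k] T c) := by
          rw [sw_comm]
          simp only [← sw_tmul, ← sw_smul, sw_mul_antipode, epsT_one, one_smul]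
  compat h m := by
    rw [map₂_eq_sw, sweedler_eq_sw]
    calc _ = sw (Δ h) (fun a b => sw (M.coact m) (fun c n => (a • n) ⊗ₜ[k] (b * T c))) :=
          sw_congr fun a b => sw_coactToRight (f := fun n c => (a • n) ⊗ₜ[k] (b * c)) _ _ _
            (by fun_prop) (by fun_prop)
      _ = sw (Δ h) (fun a b => sw (M.coact m) (fun c n => (a • n) ⊗ₜ[k] T (c * S b))) := by
          simp only [antipodeInv_mul, antipodeInv_antipode]
      _ = sw (Δ h) (fun a b => sw (M.coact (b • m)) (fun c n => n ⊗ₜ[k] T (S a * c))) :=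
          (M.sw_antipode_coact (f := fun c n => n ⊗ₜ[k] T c) _ _ (by fun_prop) (by fun_prop)).symm
      _ = sw (Δ h) (fun a b => sw (M.coact (b • m)) (fun c n => n ⊗ₜ[k] (T c * a))) := by
          simp only [antipodeInv_mul, antipodeInv_antipode]
      _ = _ := sw_congr fun a b => ((lTensor_eq_sw _ _).trans (sw_coactToRight
          (f := fun n c => n ⊗ₜ[k] (c * a)) _ _ _ (by fun_prop) (by fun_prop))).symm

/-- The left-left module with the same action and coaction `S(m₍₁₎) ⊗ m₍₀₎`. -/
abbrev LRYD.toLL (M : LRYD k H) : LLYD k H where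
  carrier := M
  coact := coactToLeft S M.coact
  isCoaction := M.isCoaction.toLeft (isAntiCoalgHom_antipode hS)
  coact_mem m := by
    refine (mem_balanced_iff (fun g h m => by simp [mul_assoc]) (fun g h m => by simp [mul_smul])
      _).2 ?_
    calc _ = sw (Δ 1) (fun a b => sw (M.coact m) (fun n c => (a * S c) ⊗ₜ[k] (b • n))) :=
          sw_congr fun a b => sw_coactToLeft (f := fun c n => (a * c) ⊗ₜ[k] (b • n)) _ _ _
            (by fun_prop) (by fun_prop)
      _ = sw (Δ 1) (fun a b => sw (M.coact m) (fun n c => (a * S b * S c) ⊗ₜ[k] n)) := by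
          rw [← sw_one_epsT (by fun_prop) (by fun_prop), ← sw_one_epsT (f := fun a b =>
            sw (M.coact m) (fun n c => (a * S b * S c) ⊗ₜ[k] n)) (by fun_prop) (by fun_prop)]
          refine sw_congr fun a b => ?_
          rw [← M.sw_coact_target (f := fun n c => (a * S c) ⊗ₜ[k] n) (isTarget_epsT b) _
            (by fun_prop) (by fun_prop)]
          simp only [antipode_mul, mul_assoc]
      _ = sw (M.coact m) (fun n c => S c ⊗ₜ[k] n) := by
          rw [sw_comm]
          simp only [← sw_tmul, ← sw_mul, sw_mul_antipode, epsT_one, one_mul]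
  compat h m := by
    rw [map₂_eq_sw, sweedler_eq_sw]
    calc _ = sw (Δ h) (fun a b => sw (M.coact m) (fun n c => (a * S c) ⊗ₜ[k] (b • n))) :=
          sw_congr fun a b => sw_coactToLeft (f := fun c n => (a * c) ⊗ₜ[k] (b • n)) _ _ _
            (by fun_prop) (by fun_prop)
      _ = sw (Δ h) (fun a b => sw (M.coact m) (fun n c => S (c * T a) ⊗ₜ[k] (b • n))) := by
          simp only [antipode_mul, antipode_antipodeInv]
      _ = sw (Δ h) (fun a b => sw (M.coact (a • m)) (fun n c => S (T b * c) ⊗ₜ[k] n)) :=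
          (M.sw_antipodeInv_coact hS (f := fun n c => S c ⊗ₜ[k] n) _ _ (by fun_prop)
            (by fun_prop)).symm
      _ = sw (Δ h) (fun a b => sw (M.coact (a • m)) (fun n c => (S c * b) ⊗ₜ[k] n)) := by
          simp only [antipode_mul, antipode_antipodeInv]
      _ = _ := sw_congr fun a b => ((rTensor_eq_sw _ _).trans (sw_coactToLeft
          (f := fun c n => (c * b) ⊗ₜ[k] n) _ _ _ (by fun_prop) (by fun_prop))).symm

end Objects

/-- The equivalence given by a pair of mutually inverse functors. -/
def equivalenceOfEq {C D : Type*} [Category* C] [Category* D] (F : C ⥤ D) (G : D ⥤ C)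
    (h : F ⋙ G = 𝟭 C) (h' : G ⋙ F = 𝟭 D) : C ≌ D where
  functor := F
  inverse := G
  unitIso := eqToIso h.symm
  counitIso := eqToIso h'
  functor_unitIso_comp X := by simp [eqToHom_map]

/-! ### Strictly inverse functors between the categories -/

section Functors

variable {k : Type u} {H : Type v} [CommRing k] [Ring H] [Algebra k H] [Coalgebra k H]

section Naturality

variable {M N : Type v} [AddCommGroup M] [Module k M] [AddCommGroup N] [Module k N]

theorem coactToRight_comp (φ : H →ₗ[k] H) {δ : M →ₗ[k] H ⊗[k] M} {δ' : N →ₗ[k] H ⊗[k] N}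
    {f : M →ₗ[k] N} (h : δ' ∘ₗ f = f.lTensor H ∘ₗ δ) :
    coactToRight φ δ' ∘ₗ f = f.rTensor H ∘ₗ coactToRight φ δ := by
  ext m
  have hm : δ' (f m) = f.lTensor H (δ m) := LinearMap.congr_fun h m
  change sw (δ' (f m)) (fun a n => n ⊗ₜ[k] φ a) = _
  rw [hm, sw_lTensor _ _ (by fun_prop) (by fun_prop)]
  refine Eq.trans ?_ (rTensor_eq_sw f (coactToRight φ δ m)).symm
  rw [sw_coactToRight _ _ _ (by fun_prop) (by fun_prop)]

theorem coactToLeft_comp (φ : H →ₗ[k] H) {δ : M →ₗ[k] M ⊗[k] H} {δ' : N →ₗ[k] N ⊗[k] H}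
    {f : M →ₗ[k] N} (h : δ' ∘ₗ f = f.rTensor H ∘ₗ δ) :
    coactToLeft φ δ' ∘ₗ f = f.lTensor H ∘ₗ coactToLeft φ δ := by
  ext m
  have hm : δ' (f m) = f.rTensor H (δ m) := LinearMap.congr_fun h m
  change sw (δ' (f m)) (fun n a => φ a ⊗ₜ[k] n) = _
  rw [hm, sw_rTensor _ _ (by fun_prop) (by fun_prop)]
  refine Eq.trans ?_ (lTensor_eq_sw f (coactToLeft φ δ m)).symm
  rw [sw_coactToLeft _ _ _ (by fun_prop) (by fun_prop)]

end Naturality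

namespace LLYD

/-- The carrier with its k-module structure is kept, so equality of actions and of coactions is
equality of objects. This makes the functors inverse on the nose rather than up to isomorphism. -/
theorem mk_eq (M : LLYD k H) {m : Module H M} {t : IsScalarTower k H M}
    {δ : M →ₗ[k] H ⊗[k] M} {h₁ h₂ h₃} (hm : m = M.module) (hδ : δ = M.coact) :
    LLYD.mk (module := m) (isScalarTower := t) M δ h₁ h₂ h₃ = M := by
  subst hm hδ; rfl

/-- The unit and counit of a strict equivalence are `eqToHom`s; on elements they do nothing. -/
theorem eqToHom_hom {M N : LLYD k H} (h : M = N) (x : M) : HEq ((eqToHom h).hom x) x := by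
  subst h; rfl

theorem hom_heq {M M' N N' : LLYD k H} (hM : M = M') (hN : N = N') {f : M ⟶ N} {g : M' ⟶ N'}
    (h : HEq f.hom g.hom) : HEq f g := by
  subst hM hN; exact heq_of_eq (Hom.ext (eq_of_heq h))

end LLYD

namespace LRYD

theorem mk_eq (M : LRYD k H) {m : Module H M} {t : IsScalarTower k H M}
    {δ : M →ₗ[k] M ⊗[k] H} {h₁ h₂ h₃} (hm : m = M.module) (hδ : δ = M.coact) :
    LRYD.mk (module := m) (isScalarTower := t) M δ h₁ h₂ h₃ = M := by
  subst hm hδ; rfl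

theorem eqToHom_hom {M N : LRYD k H} (h : M = N) (x : M) : HEq ((eqToHom h).hom x) x := by
  subst h; rfl

theorem hom_heq {M M' N N' : LRYD k H} (hM : M = M') (hN : N = N') {f : M ⟶ N} {g : M' ⟶ N'}
    (h : HEq f.hom g.hom) : HEq f g := by
  subst hM hN; exact heq_of_eq (Hom.ext (eq_of_heq h))

end LRYD

namespace RRYD

theorem mk_eq (M : RRYD k H) {m : Module Hᵐᵒᵖ M} {t : IsScalarTower k Hᵐᵒᵖ M}
    {δ : M →ₗ[k] M ⊗[k] H} {h₁ h₂ h₃} (hm : m = M.module) (hδ : δ = M.coact) :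
    RRYD.mk (module := m) (isScalarTower := t) M δ h₁ h₂ h₃ = M := by
  subst hm hδ; rfl

theorem eqToHom_hom {M N : RRYD k H} (h : M = N) (x : M) : HEq ((eqToHom h).hom x) x := by
  subst h; rfl

theorem hom_heq {M M' N N' : RRYD k H} (hM : M = M') (hN : N = N') {f : M ⟶ N} {g : M' ⟶ N'}
    (h : HEq f.hom g.hom) : HEq f g := by
  subst hM hN; exact heq_of_eq (Hom.ext (eq_of_heq h))

end RRYD

namespace RLYD

theorem mk_eq (M : RLYD k H) {m : Module Hᵐᵒᵖ M} {t : IsScalarTower k Hᵐᵒᵖ M}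
    {δ : M →ₗ[k] H ⊗[k] M} {h₁ h₂ h₃} (hm : m = M.module) (hδ : δ = M.coact) :
    RLYD.mk (module := m) (isScalarTower := t) M δ h₁ h₂ h₃ = M := by
  subst hm hδ; rfl

theorem eqToHom_hom {M N : RLYD k H} (h : M = N) (x : M) : HEq ((eqToHom h).hom x) x := by
  subst h; rfl

theorem hom_heq {M M' N N' : RLYD k H} (hM : M = M') (hN : N = N') {f : M ⟶ N} {g : M' ⟶ N'}
    (h : HEq f.hom g.hom) : HEq f g := by
  subst hM hN; exact heq_of_eq (Hom.ext (eq_of_heq h))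

end RLYD

variable [WeakHopfAlgebra k H]
  (hS : Function.Bijective (WeakHopfAlgebra.antipode (k := k) (H := H)))

local notation "S" => WeakHopfAlgebra.antipode (k := k) (H := H)
local notation "T" => antipodeInv hS

theorem leftModule_rightModule (M : Type v) [AddCommGroup M] [Module k M] [m : Module H M] :
    @leftModule k H _ _ _ _ _ M _ (rightModule hS M) = m := by
  refine Module.ext' _ _ fun h x => ?_
  change T (S h) • x = h • x
  rw [antipodeInv_antipode]

theorem rightModule_leftModule (M : Type v) [AddCommGroup M] [Module k M] [m : Module Hᵐᵒᵖ M] :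
    @rightModule k H _ _ _ _ _ hS M _ (leftModule k H M) = m := by
  refine Module.ext' _ _ fun h x => ?_
  change MulOpposite.op (S (T h.unop)) • x = h • x
  rw [antipode_antipodeInv, MulOpposite.op_unop]

/-- The functor `M ↦ M.toRR`. -/
def functorRR : LLYD k H ⥤ RRYD k H where
  obj M := M.toRR hS
  map f := ⟨f.hom, fun h m => f.map_act (T h) m, coactToRight_comp S f.map_coact⟩

/-- The functor `M ↦ M.toLL`. -/
def inverseRR : RRYD k H ⥤ LLYD k H where
  obj M := M.toLL hS
  map f := ⟨f.hom, fun h m => f.map_act (S h) m, coactToLeft_comp (T) f.map_coact⟩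

theorem functorRR_inverseRR : functorRR hS ⋙ inverseRR hS = 𝟭 (LLYD k H) := by
  have (M : LLYD k H) : (M.toRR hS).toLL hS = M :=
    LLYD.mk_eq M (leftModule_rightModule hS M) (coactToLeft_coactToRight (antipodeInv_antipode hS) _)
  exact Functor.hext this fun M N f => LLYD.hom_heq (this M) (this N) HEq.rfl

theorem inverseRR_functorRR : inverseRR hS ⋙ functorRR hS = 𝟭 (RRYD k H) := by
  have (M : RRYD k H) : (M.toLL hS).toRR hS = M :=
    RRYD.mk_eq M (rightModule_leftModule hS M) (coactToRight_coactToLeft (antipode_antipodeInv hS) _)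
  exact Functor.hext this fun M N f => RRYD.hom_heq (this M) (this N) HEq.rfl

/-- The functor `M ↦ M.toRL`. -/
def functorRL : LLYD k H ⥤ RLYD k H where
  obj M := M.toRL hS
  map f := ⟨f.hom, fun h m => f.map_act (T h) m, f.map_coact⟩

/-- The functor `M ↦ M.toLL`. -/
def inverseRL : RLYD k H ⥤ LLYD k H where
  obj M := M.toLL hS
  map f := ⟨f.hom, fun h m => f.map_act (S h) m, f.map_coact⟩

theorem functorRL_inverseRL : functorRL hS ⋙ inverseRL hS = 𝟭 (LLYD k H) := by
  have (M : LLYD k H) : (M.toRL hS).toLL hS = M :=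
    LLYD.mk_eq M (leftModule_rightModule hS M) rfl
  exact Functor.hext this fun M N f => LLYD.hom_heq (this M) (this N) HEq.rfl

theorem inverseRL_functorRL : inverseRL hS ⋙ functorRL hS = 𝟭 (RLYD k H) := by
  have (M : RLYD k H) : (M.toLL hS).toRL hS = M :=
    RLYD.mk_eq M (rightModule_leftModule hS M) rfl
  exact Functor.hext this fun M N f => RLYD.hom_heq (this M) (this N) HEq.rfl

/-- The functor `M ↦ M.toLR`. -/
def functorLR : LLYD k H ⥤ LRYD k H where
  obj M := M.toLR hS
  map f := ⟨f.hom, f.map_act, coactToRight_comp (T) f.map_coact⟩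

/-- The functor `M ↦ M.toLL`. -/
def inverseLR : LRYD k H ⥤ LLYD k H where
  obj M := M.toLL hS
  map f := ⟨f.hom, f.map_act, coactToLeft_comp S f.map_coact⟩

theorem functorLR_inverseLR : functorLR hS ⋙ inverseLR hS = 𝟭 (LLYD k H) := by
  have (M : LLYD k H) : (M.toLR hS).toLL hS = M :=
    LLYD.mk_eq M rfl (coactToLeft_coactToRight (antipode_antipodeInv hS) _)
  exact Functor.hext this fun M N f => LLYD.hom_heq (this M) (this N) HEq.rfl

theorem inverseLR_functorLR : inverseLR hS ⋙ functorLR hS = 𝟭 (LRYD k H) := by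
  have (M : LRYD k H) : (M.toLL hS).toLR hS = M :=
    LRYD.mk_eq M rfl (coactToRight_coactToLeft (antipodeInv_antipode hS) _)
  exact Functor.hext this fun M N f => LRYD.hom_heq (this M) (this N) HEq.rfl

/-- The isomorphism of categories between left-left and left-right Yetter-Drinfeld modules. -/
def equivLR : LLYD k H ≌ LRYD k H :=
  equivalenceOfEq _ _ (functorLR_inverseLR hS) (inverseLR_functorLR hS)

end Functors

/-! ### The standard structure on left-right Yetter-Drinfeld modules -/

namespace LLYD

variable {k : Type u} {H : Type v} [CommRing k] [Ring H] [Algebra k H] [Coalgebra k H]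
  [WeakBialgebra k H]

/-- Transported constraints contain the unit of the equivalence, whiskered with an object. Being an
`eqToHom`, it leaves the underlying tensor unchanged, as the heterogeneous equality records. -/
theorem incl_tensorMap_eqToHom {X Y : LLYD k H} (N : LLYD k H) {f : X ⟶ Y} {h : X = Y}
    (hf : f = eqToHom h) (x : tensor X N) :
    HEq (TensorT.incl k H Y N ((tensorMap f (𝟙 N)).hom x)) (TensorT.incl k H X N x) := by
  subst h hf
  exact heq_of_eq (congrArg (fun f => TensorT.incl k H X N (Hom.hom f x))
    (MonoidalCategory.id_tensorHom_id X N))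

theorem incl_tensorMap_eqToHom' {X Y : LLYD k H} (N : LLYD k H) {f : X ⟶ Y} {h : X = Y}
    (hf : f = eqToHom h) (x : tensor N X) :
    HEq (TensorT.incl k H N Y ((tensorMap (𝟙 N) f).hom x)) (TensorT.incl k H N X x) := by
  subst h hf
  exact heq_of_eq (congrArg (fun f => TensorT.incl k H N X (Hom.hom f x))
    (MonoidalCategory.id_tensorHom_id N X))

end LLYD

section

variable {k : Type u} {H : Type v} [CommRing k] [Ring H] [Algebra k H] [Coalgebra k H]
  [WeakHopfAlgebra k H]
  (hS : Function.Bijective (WeakHopfAlgebra.antipode (k := k) (H := H)))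

local notation "Δ" => Coalgebra.comul (R := k) (A := H)
local notation "S" => WeakHopfAlgebra.antipode (k := k) (H := H)
local notation "T" => antipodeInv hS
local infixl:70 " ⊠ " => TensorT.tm k H

theorem equivLR_counit_hom (M : LRYD k H) :
    (((equivLR hS).counitIso.hom.app M).hom : M →ₗ[k] M) = LinearMap.id :=
  LinearMap.ext fun x => eq_of_heq ((heq_of_eq (congrArg (fun f => LRYD.Hom.hom f x)
    (eqToHom_app (inverseLR_functorLR hS) M))).trans (LRYD.eqToHom_hom _ x))

namespace LRYD

/-- The monoidal structure transported from left-left Yetter-Drinfeld modules. -/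
abbrev monoidalCategory : MonoidalCategory (LRYD k H) := Monoidal.transport (equivLR hS)

/-- The inverse of the braiding transported from left-left Yetter-Drinfeld modules. -/
abbrev braidedCategory : letI := monoidalCategory hS; BraidedCategory (LRYD k H) :=
  letI := LLYD.braidedCategory hS
  reverseBraiding (Monoidal.Transported (equivLR hS))

theorem codiag_eq_sw (M N : LRYD k H) (x : M ⊗[k] N) :
    codiag M N x = sw x (fun m n => sw (M.coact m) (fun m' a => sw (N.coact n) (fun n' b =>
      (m' ⊗ₜ[k] n') ⊗ₜ[k] (b * a)))) := by
  rw [apply_eq_sw (codiag M N)]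
  refine sw_congr fun m n => ?_
  exact apply_tmul_eq_sw ((mulRev k H).lTensor (M ⊗[k] N) ∘ₗ
    (TensorProduct.tensorTensorTensorComm k M H N H).toLinearMap) _ _

/-- S⁻¹(S(a)S(b)) = ba, whence the order n₍₁₎m₍₁₎ in the codiagonal coaction. -/
theorem coactToRight_codiag (M N : LRYD k H) :
    coactToRight (T) (LLYD.codiag (M.toLL hS) (N.toLL hS)) = codiag M N := by
  refine LinearMap.ext fun x => ?_
  change sw (LLYD.codiag (M.toLL hS) (N.toLL hS) x) (fun a n => n ⊗ₜ[k] T a) = _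
  rw [LLYD.codiag_eq_sw, codiag_eq_sw, sw_sw _ _ (by fun_prop) (by fun_prop)]
  refine sw_congr fun m n => ?_
  rw [sw_coactToLeft _ _ _ (by fun_prop) (by fun_prop), sw_sw _ _ (by fun_prop) (by fun_prop)]
  refine sw_congr fun m' a => ?_
  rw [sw_coactToLeft _ _ _ (by fun_prop) (by fun_prop), sw_sw _ _ (by fun_prop) (by fun_prop)]
  refine sw_congr fun n' b => ?_
  rw [sw_of_tmul _ _ (by fun_prop) (by fun_prop), antipodeInv_mul, antipodeInv_antipode,
    antipodeInv_antipode]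

theorem tens_coact (M N : LRYD k H) :
    (TensorT.incl k H M N).rTensor H ∘ₗ
      coactToRight (T) (LLYD.tensorCoact (M.toLL hS) (N.toLL hS)) =
    codiag M N ∘ₗ TensorT.incl k H M N :=
  (coactToRight_comp (T) (LLYD.lTensor_incl_tensorCoact (M.toLL hS) (N.toLL hS)).symm).symm.trans
    (congrArg (· ∘ₗ TensorT.incl k H M N) (coactToRight_codiag hS M N))

/-- Substituting along S⁻¹(1) = 1 turns 1₂ ⊗ S⁻¹(1₁) into S(1₁) ⊗ 1₂, and S is ε_t on H_s. -/
theorem sw_one_antipodeInv {P : Type*} [AddCommGroup P] [Module k P] {f : H → H → P}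
    (hl : ∀ b, Lin k (fun a => f a b)) (hr : ∀ a, Lin k (fun b => f a b)) :
    sw (Δ 1) (fun a b => f b (T a)) = sw (Δ 1) (fun a b => f (epsT k H a) b) := by
  rw [sw_comul_eq_antipodeInv hS _ (by fun_prop) (by fun_prop), antipodeInv_one]
  simp only [antipodeInv_antipode]
  rw [← sw_one_epsS (by fun_prop) (by fun_prop),
    ← sw_one_epsS (f := fun a b => f (epsT k H a) b) (by fun_prop) (by fun_prop)]
  simp only [antipode_of_isSource (isSource_epsS _)]

/-- From Δ(z) = z1₁ ⊗ 1₂ the twisted coaction is 1₂ ⊗ S⁻¹(1₁)S⁻¹(z), where S⁻¹(z) = ε̄_s(z). -/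
theorem rTensor_unitCoact (z : Target k H) :
    (Target.val k H).rTensor H (coactToRight (T) LLYD.unitCoact z) =
      TensorProduct.map (epsT k H) (LinearMap.mulRight k (epsSBar k H (Target.val k H z))) (Δ 1) := by
  rw [rTensor_eq_sw, sw_coactToRight _ _ _ (by fun_prop) (by fun_prop),
    LLYD.sw_unitCoact _ (by fun_prop) (by fun_prop)]
  simp only [Target.val_mk]
  rw [LLYD.sw_comul_epsT_of_isTarget (f := fun a b => b ⊗ₜ[k] T a) z.isTarget (by fun_prop)
    (by fun_prop), z.isTarget.sw_comul' (by fun_prop) (by fun_prop)]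
  simp only [antipodeInv_mul]
  rw [sw_one_antipodeInv hS (f := fun a b => a ⊗ₜ[k] (b * T (Target.val k H z))) (by fun_prop)
    (by fun_prop), map_eq_sw]
  have hz : T (Target.val k H z) = epsSBar k H (Target.val k H z) := by
    rw [← antipodeInv_epsT hS, z.isTarget]
  rw [hz]
  rfl

theorem incl_whisker_unit_inv (X N : LLYD k H) (x : TensorT k H X N) :
    TensorT.incl k H X N ((LLYD.tensorMap ((equivLR hS).unitIso.inv.app X) (𝟙 N)).hom x) =
      TensorT.incl k H X N x :=
  eq_of_heq (LLYD.incl_tensorMap_eqToHom N (eqToHom_app (functorLR_inverseLR hS).symm.symm X) x)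

theorem incl_whisker_unit_hom (X N : LLYD k H) (x : TensorT k H N X) :
    TensorT.incl k H N X ((LLYD.tensorMap (𝟙 N) ((equivLR hS).unitIso.hom.app X)).hom x) =
      TensorT.incl k H N X x :=
  eq_of_heq (LLYD.incl_tensorMap_eqToHom' N (eqToHom_app (functorLR_inverseLR hS).symm X) x)

theorem incl_whisker_unit_inv' (X N : LLYD k H) (x : TensorT k H N X) :
    TensorT.incl k H N X ((LLYD.tensorMap (𝟙 N) ((equivLR hS).unitIso.inv.app X)).hom x) =
      TensorT.incl k H N X x :=
  eq_of_heq (LLYD.incl_tensorMap_eqToHom' N (eqToHom_app (functorLR_inverseLR hS).symm.symm X) x)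

/-- The transported associator is the left-left one surrounded by whiskered unit isomorphisms, and
these are invisible after inclusion. -/
theorem tens_associator (M N P : LRYD k H)
    (x : TensorT k H (TensorT k H M N) P) :
    letI := monoidalCategory hS
    (TensorT.incl k H N P).lTensor M (TensorT.incl k H M (TensorT k H N P)
      ((MonoidalCategory.associator M N P).hom.hom x)) =
    TensorProduct.assoc k M N P ((TensorT.incl k H M N).rTensor P
      (TensorT.incl k H (TensorT k H M N) P x)) := by
  have h₁ := incl_whisker_unit_inv hS (LLYD.tensor (M.toLL hS) (N.toLL hS)) (P.toLL hS) x
  have h₂ := incl_whisker_unit_hom hS (LLYD.tensor (N.toLL hS) (P.toLL hS)) (M.toLL hS)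
  have h₃ := TensorT.incl_injective k H (TensorT k H M N) P h₁
  refine (congrArg ((TensorT.incl k H N P).lTensor M) (h₂ _)).trans ?_
  refine (TensorT.incl_assocFun _).trans ?_
  exact congrArg (fun y => TensorProduct.assoc k M N P ((TensorT.incl k H M N).rTensor P y)) h₁

theorem leftUnitor_hom (M : LRYD k H) (z : Target k H) (m : M) (x : TensorT k H (Target k H) M)
    (hx : TensorT.incl k H _ M x = balance (lAct k H (Target k H)) (lAct k H M) (z ⊗ₜ[k] m)) :
    letI := monoidalCategory hS
    (MonoidalCategory.leftUnitor M).hom.hom x = Target.val k H z • m := by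
  have h₁ : (LLYD.tensorMap ((equivLR hS).unitIso.inv.app (LLYD.unitObj k H))
      (𝟙 (M.toLL hS))).hom x = z ⊠ m :=
    LLYD.eq_tm_of_incl ((incl_whisker_unit_inv hS (LLYD.unitObj k H) (M.toLL hS) x).trans hx)
  have h₂ : (LLYD.leftUnitIso (M.toLL hS)).hom.hom
      ((LLYD.tensorMap ((equivLR hS).unitIso.inv.app (LLYD.unitObj k H)) (𝟙 (M.toLL hS))).hom x) =
      Target.val k H z • m :=
    (congrArg (LLYD.leftUnitIso (M.toLL hS)).hom.hom h₁).trans (LLYD.leftUnitIso_hom_tm (M := M.toLL hS) z m)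
  exact (LinearMap.congr_fun (equivLR_counit_hom hS M) _).trans h₂

theorem rightUnitor_hom (M : LRYD k H) (m : M) (z : Target k H) (x : TensorT k H M (Target k H))
    (hx : TensorT.incl k H M _ x = balance (lAct k H M) (lAct k H (Target k H)) (m ⊗ₜ[k] z)) :
    letI := monoidalCategory hS
    (MonoidalCategory.rightUnitor M).hom.hom x = epsSBar k H (Target.val k H z) • m := by
  have h₁ : (LLYD.tensorMap (𝟙 (M.toLL hS))
      ((equivLR hS).unitIso.inv.app (LLYD.unitObj k H))).hom x = m ⊠ z :=
    LLYD.eq_tm_of_incl ((incl_whisker_unit_inv' hS (LLYD.unitObj k H) (M.toLL hS) x).trans hx)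
  have h₂ : (LLYD.rightUnitIso (M.toLL hS)).hom.hom
      ((LLYD.tensorMap (𝟙 (M.toLL hS)) ((equivLR hS).unitIso.inv.app (LLYD.unitObj k H))).hom x) =
      epsSBar k H (Target.val k H z) • m :=
    (congrArg (LLYD.rightUnitIso (M.toLL hS)).hom.hom h₁).trans (LLYD.rightUnitIso_hom_tm (M := M.toLL hS) m z)
  exact (LinearMap.congr_fun (equivLR_counit_hom hS M) _).trans h₂

/-- The inverse left-left braiding sends m ⊠ n to n₍₀₎ ⊠ S⁻¹(n₍₋₁₎)m. With n₍₋₁₎ = S(n₍₁₎) this is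
the standard left-right braiding, and the coaction of n absorbs the Δ(1). -/
theorem incl_braidInvFun (M N : LRYD k H) (m : M) (n : N) :
    TensorT.incl k H N M (LLYD.braidInvFun (M := N.toLL hS) (N := M.toLL hS) hS (m ⊠ n)) =
      ((lAct k H M).flip m).lTensor N (N.coact n) := by
  rw [LLYD.braidInvFun_tm, map_sw, sw_coactToLeft _ _ _ (by fun_prop) (by fun_prop), lTensor_eq_sw]
  simp only [TensorT.incl_tm, antipodeInv_antipode, smul_smul]
  rw [sw_comm]
  exact N.sw_coact_one (f := fun n' a => n' ⊗ₜ[k] (a • m)) _ (by fun_prop) (by fun_prop)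

/-- The braided monoidal structure on left-right Yetter-Drinfeld modules is the standard one. -/
def standardBraided :
    letI := monoidalCategory hS; letI := braidedCategory hS; StandardBraided k H :=
  letI := monoidalCategory hS
  letI := braidedCategory hS
  { tens := fun M N => TensorT.incl k H M N
    tens_injective := fun M N => TensorT.incl_injective k H M N
    range_tens := fun M N => TensorT.range_incl k H M N
    tens_act := fun _ _ h x => TensorT.incl_smul h x
    tens_coact := tens_coact hS
    tens_hom := fun f g => LinearMap.ext fun x => TensorT.incl_map f.map_act g.map_act x
    unit := Target.val k H
    unit_injective := Target.val_injective k H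
    range_unit := Target.range_val k H
    unit_act := fun h z => Target.val_smul h z
    unit_coact := rTensor_unitCoact hS
    associator := fun M N P => LinearMap.ext fun x => tens_associator hS M N P x
    leftUnitor := leftUnitor_hom hS
    rightUnitor := rightUnitor_hom hS
    braiding := fun M N m n x hx => by
      obtain rfl : x = m ⊠ n := LLYD.eq_tm_of_incl hx
      exact incl_braidInvFun hS M N m n }

end LRYD

end

/-! ### The standard structure on right Yetter-Drinfeld modules -/

section Mop

variable {C D : Type*} [Category* C] [Category* D]

theorem unmop_eqToHom {X Y : MonoidalOpposite C} (h : X = Y) :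
    (eqToHom h).unmop = eqToHom (congrArg MonoidalOpposite.unmop h) := by
  subst h; rfl

theorem unmopFunctor_comp_eq {F : C ⥤ D} {G : D ⥤ C} (h : F ⋙ G = 𝟭 C) :
    (unmopFunctor C ⋙ F) ⋙ G ⋙ mopFunctor C = 𝟭 (MonoidalOpposite C) :=
  congrArg (fun K => unmopFunctor C ⋙ K ⋙ mopFunctor C) h

/-- The equivalence between the reverse of `C` and `D` given by mutually inverse functors between
`C` and `D`. -/
def mopEquivalenceOfEq (F : C ⥤ D) (G : D ⥤ C) (h : F ⋙ G = 𝟭 C) (h' : G ⋙ F = 𝟭 D) :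
    MonoidalOpposite C ≌ D :=
  equivalenceOfEq (unmopFunctor C ⋙ F) (G ⋙ mopFunctor C) (unmopFunctor_comp_eq h) h'

theorem mopEquivalenceOfEq_unit_hom {F : C ⥤ D} {G : D ⥤ C} (h : F ⋙ G = 𝟭 C)
    (h' : G ⋙ F = 𝟭 D) (X : C) :
    ((mopEquivalenceOfEq F G h h').unitIso.hom.app (.mop X)).unmop =
      eqToHom (Functor.congr_obj h X).symm :=
  (congrArg Quiver.Hom.unmop (eqToHom_app (unmopFunctor_comp_eq h).symm (.mop X))).trans
    (unmop_eqToHom _)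

theorem mopEquivalenceOfEq_unit_inv {F : C ⥤ D} {G : D ⥤ C} (h : F ⋙ G = 𝟭 C)
    (h' : G ⋙ F = 𝟭 D) (X : C) :
    ((mopEquivalenceOfEq F G h h').unitIso.inv.app (.mop X)).unmop =
      eqToHom (Functor.congr_obj h X) :=
  (congrArg Quiver.Hom.unmop (eqToHom_app (unmopFunctor_comp_eq h).symm.symm (.mop X))).trans
    (unmop_eqToHom _)

end Mop

section

variable {k : Type u} {H : Type v} [CommRing k] [Ring H] [Algebra k H] [Coalgebra k H]

local notation "Δ" => Coalgebra.comul (R := k) (A := H)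
local infixl:70 " ⊠ " => TensorT.tm k H

namespace LLYD

/-- Pure linear algebra: flipping every tensor product turns the associator into its inverse with
the factors reversed. It identifies the associator of the reversed category. -/
theorem comm_assoc_of_assoc {A B C X Y : Type*} [AddCommGroup A] [Module k A] [AddCommGroup B]
    [Module k B] [AddCommGroup C] [Module k C] [AddCommGroup X] [Module k X] [AddCommGroup Y]
    [Module k Y] {i : X →ₗ[k] A ⊗[k] B} {j : Y →ₗ[k] B ⊗[k] C} {x : X ⊗[k] C} {y : A ⊗[k] Y}
    (h : j.lTensor A y = TensorProduct.assoc k A B C (i.rTensor C x)) :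
    ((TensorProduct.comm k A B).toLinearMap ∘ₗ i).lTensor C (TensorProduct.comm k X C x) =
      TensorProduct.assoc k C B A (((TensorProduct.comm k B C).toLinearMap ∘ₗ j).rTensor A
        (TensorProduct.comm k A Y y)) := by
  have h₁ (x : X ⊗[k] C) :
      ((TensorProduct.comm k A B).toLinearMap ∘ₗ i).lTensor C (TensorProduct.comm k X C x) =
      (TensorProduct.comm k A B).toLinearMap.lTensor C
        (TensorProduct.comm k _ C (i.rTensor C x)) := by
    induction x with
    | zero => simp
    | add x y hx hy => simp only [map_add, hx, hy]
    | tmul a b => rfl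
  have h₂ (y : A ⊗[k] Y) :
      ((TensorProduct.comm k B C).toLinearMap ∘ₗ j).rTensor A (TensorProduct.comm k A Y y) =
      (TensorProduct.comm k B C).toLinearMap.rTensor A
        (TensorProduct.comm k A _ (j.lTensor A y)) := by
    induction y with
    | zero => simp
    | add x y hx hy => simp only [map_add, hx, hy]
    | tmul a b => rfl
  rw [h₁, h₂, h]
  generalize i.rTensor C x = w
  induction w with
  | zero => simp
  | add x y hx hy => simp only [map_add, hx, hy]
  | tmul w c =>
    induction w with
    | zero => simp
    | add x y hx hy => simp only [map_add, TensorProduct.add_tmul, hx, hy]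
    | tmul a b => rfl

variable [WeakBialgebra k H]

theorem comm_incl_assocIso_inv (M N Q : LLYD k H) (x : tensor M (tensor N Q)) :
    ((TensorProduct.comm k M N).toLinearMap ∘ₗ TensorT.incl k H M N).lTensor Q
      (TensorProduct.comm k _ Q (TensorT.incl k H (tensor M N) Q ((assocIso M N Q).inv.hom x))) =
    TensorProduct.assoc k Q N M
      (((TensorProduct.comm k N Q).toLinearMap ∘ₗ TensorT.incl k H N Q).rTensor M
        (TensorProduct.comm k M _ (TensorT.incl k H M (tensor N Q) x))) := by
  refine comm_assoc_of_assoc ?_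
  rw [← TensorT.incl_assocFun]
  have : (assocIso M N Q).hom.hom ((assocIso M N Q).inv.hom x) = x :=
    congrArg (fun f => Hom.hom f x) (assocIso M N Q).inv_hom_id
  exact congrArg (fun y => (TensorT.incl k H N Q).lTensor M (TensorT.incl k H M (tensor N Q) y))
    this.symm

theorem lTensor_comm_incl_tensorCoact (M N : LLYD k H) :
    ((TensorProduct.comm k M N).toLinearMap ∘ₗ TensorT.incl k H M N).lTensor H ∘ₗ
      tensorCoact M N =
    ((TensorProduct.comm k M N).toLinearMap.lTensor H ∘ₗ codiag M N ∘ₗ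
      (TensorProduct.comm k N M).toLinearMap) ∘ₗ
      (TensorProduct.comm k M N).toLinearMap ∘ₗ TensorT.incl k H M N := by
  rw [LinearMap.lTensor_comp, LinearMap.comp_assoc, lTensor_incl_tensorCoact]
  ext x
  simp

end LLYD

variable [WeakHopfAlgebra k H]

local notation "S" => WeakHopfAlgebra.antipode (k := k) (H := H)

section Twisted

variable (M N : Type v) [AddCommGroup M] [Module k M] [AddCommGroup N] [Module k N]
  [Module Hᵐᵒᵖ M] [IsScalarTower k Hᵐᵒᵖ M] [Module Hᵐᵒᵖ N] [IsScalarTower k Hᵐᵒᵖ N]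

/-- Under hm = mS(h), the action of h on n ⊗ m is nS(h₁) ⊗ mS(h₂). As Δ(S(h)) = S(h₂) ⊗ S(h₁), it
becomes the diagonal right action of S(h) only after the flip, which is why the tensor product is
reversed. -/
theorem comm_map₂_leftModule (h : H) (x : N ⊗[k] M) :
    letI := leftModule k H M; haveI := leftModule_isScalarTower k H M
    letI := leftModule k H N; haveI := leftModule_isScalarTower k H N
    TensorProduct.comm k N M (TensorProduct.map₂ (lAct k H N) (lAct k H M) (Δ h) x) =
      TensorProduct.map₂ (rAct k H M) (rAct k H N) (Δ (S h)) (TensorProduct.comm k N M x) := by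
  letI := leftModule k H M
  haveI := leftModule_isScalarTower k H M
  letI := leftModule k H N
  haveI := leftModule_isScalarTower k H N
  induction x with
  | zero => simp
  | add x y hx hy => simp only [map_add, hx, hy]
  | tmul n m =>
    rw [map₂_eq_sw, ← LinearEquiv.coe_coe, map_sw, LinearEquiv.coe_coe, TensorProduct.comm_tmul,
      map₂_eq_sw, sw_comul_antipode _ (by fun_prop) (by fun_prop)]
    refine sw_congr fun a b => ?_
    rw [sw_of_tmul _ _ (by fun_prop) (by fun_prop), sw_of_tmul _ _ (by fun_prop) (by fun_prop)]
    rfl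

theorem comm_balance_leftModule (x : N ⊗[k] M) :
    letI := leftModule k H M; haveI := leftModule_isScalarTower k H M
    letI := leftModule k H N; haveI := leftModule_isScalarTower k H N
    TensorProduct.comm k N M (balance (lAct k H N) (lAct k H M) x) =
      balance (rAct k H M) (rAct k H N) (TensorProduct.comm k N M x) := by
  have := comm_map₂_leftModule M N (1 : H) x
  rw [antipode_one] at this
  exact this

theorem range_comm_incl :
    letI := leftModule k H M; haveI := leftModule_isScalarTower k H M
    letI := leftModule k H N; haveI := leftModule_isScalarTower k H N
    LinearMap.range ((TensorProduct.comm k N M).toLinearMap ∘ₗ TensorT.incl k H N M) =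
      balanced (rAct k H M) (rAct k H N) := by
  letI := leftModule k H M
  haveI := leftModule_isScalarTower k H M
  letI := leftModule k H N
  haveI := leftModule_isScalarTower k H N
  rw [LinearMap.range_comp, TensorT.range_incl]
  ext x
  constructor
  · rintro ⟨_, ⟨y, rfl⟩, rfl⟩
    exact ⟨_, (comm_balance_leftModule M N y).symm⟩
  · rintro ⟨y, rfl⟩
    refine ⟨_, ⟨TensorProduct.comm k M N y, rfl⟩, ?_⟩
    refine (comm_balance_leftModule M N _).trans ?_
    simp

variable {M N}

end Twisted

theorem antipode_epsT (h : H) : S (epsT k H h) = epsS k H (S h) := by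
  rw [← sw_mul_antipode, map_sw, ← sw_antipode_mul, sw_comul_antipode _ (by fun_prop) (by fun_prop)]
  simp only [antipode_mul]

variable (k H) in
/-- The map `S : H_t → H_s`. -/
def unitMap : Target k H →ₗ[k] H := S ∘ₗ Target.val k H

/-- S agrees with ε_s on H_t. -/
theorem range_unitMap : LinearMap.range (unitMap k H) = LinearMap.range (epsS k H) := by
  refine le_antisymm ?_ ?_
  · rintro _ ⟨z, rfl⟩
    exact ⟨_, (antipode_of_isTarget z.isTarget).symm⟩
  · rintro _ ⟨h, rfl⟩
    -- The preimage comes from S ∘ ε̄_t = ε_s.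
    refine ⟨Target.mk k H (epsTBar k H h), ?_⟩
    change S (epsT k H (epsTBar k H h)) = _
    rw [epsT_epsTBar, antipode_epsTBar]

/-- The map ε̄_t undoes S : H_t → H_s, which explains its appearance in the unit constraint and the
unit coaction on the right. -/
theorem epsTBar_unitMap (z : Target k H) : epsTBar k H (unitMap k H z) = Target.val k H z := by
  change epsTBar k H (S (Target.val k H z)) = _
  rw [antipode_of_isTarget z.isTarget, epsTBar_epsS, z.isTarget.epsTBar]

theorem unitMap_injective (hS : Function.Bijective (WeakHopfAlgebra.antipode (k := k) (H := H))) :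
    Function.Injective (unitMap k H) :=
  hS.1.comp (Target.val_injective k H)

theorem unitMap_smul (hS : Function.Bijective (WeakHopfAlgebra.antipode (k := k) (H := H))) (h : H) (z : Target k H) :
    unitMap k H (antipodeInv hS h • z) = epsS k H (unitMap k H z * h) := by
  change S (epsT k H _) = epsS k H (S _ * h)
  rw [antipode_epsT, antipode_mul, antipode_antipodeInv]

theorem rTensor_unitMap_unitCoact (z : Target k H) :
    (unitMap k H).rTensor H (coactToRight S LLYD.unitCoact z) = Δ (unitMap k H z) := by
  rw [rTensor_eq_sw, sw_coactToRight _ _ _ (by fun_prop) (by fun_prop),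
    LLYD.sw_unitCoact _ (by fun_prop) (by fun_prop)]
  refine (LLYD.sw_comul_epsT_of_isTarget (f := fun a b => S b ⊗ₜ[k] S a) z.isTarget (by fun_prop)
    (by fun_prop)).trans ?_
  rw [← comul_antipode]
  rfl

/-- z₁ ⊗ S(z₂) = z1₁ ⊗ S(1₂), where S(1₂) = ε_s(1₂) as 1₂ lies in H_t, and z = ε̄_t(S(z)). -/
theorem lTensor_unitMap_unitCoact (z : Target k H) :
    (unitMap k H).lTensor H (LLYD.unitCoact z) =
      TensorProduct.map (LinearMap.mulLeft k (epsTBar k H (unitMap k H z))) (epsS k H) (Δ 1) := by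
  rw [lTensor_eq_sw, LLYD.sw_unitCoact _ (by fun_prop) (by fun_prop), epsTBar_unitMap, map_eq_sw]
  refine (LLYD.sw_comul_epsT_of_isTarget (f := fun a b => a ⊗ₜ[k] S b) z.isTarget (by fun_prop)
    (by fun_prop)).trans ?_
  rw [z.isTarget.sw_comul' (by fun_prop) (by fun_prop), ← sw_one_epsT (by fun_prop) (by fun_prop)]
  conv_rhs => rw [← sw_one_epsT (by fun_prop) (by fun_prop)]
  simp only [antipode_of_isTarget (isTarget_epsT _)]
  rfl

end

/-! ### Right-right modules: the transported structure is the standard one -/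

section

variable {k : Type u} {H : Type v} [CommRing k] [Ring H] [Algebra k H] [Coalgebra k H]

local notation "Δ" => Coalgebra.comul (R := k) (A := H)
local infixl:70 " ⊠ " => TensorT.tm k H

namespace RRYD

theorem codiag_eq_sw (M N : RRYD k H) (x : M ⊗[k] N) :
    codiag M N x = sw x (fun m n => sw (M.coact m) (fun m' a => sw (N.coact n) (fun n' b =>
      (m' ⊗ₜ[k] n') ⊗ₜ[k] (a * b)))) := by
  rw [apply_eq_sw (codiag M N)]
  refine sw_congr fun m n => ?_
  exact apply_tmul_eq_sw ((LinearMap.mul' k H).lTensor (M ⊗[k] N) ∘ₗ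
    (TensorProduct.tensorTensorTensorComm k M H N H).toLinearMap) _ _

end RRYD

variable [WeakHopfAlgebra k H]
  (hS : Function.Bijective (WeakHopfAlgebra.antipode (k := k) (H := H)))

local notation "S" => WeakHopfAlgebra.antipode (k := k) (H := H)
local notation "T" => antipodeInv hS
local notation "F" => Prefunctor.obj (Functor.toPrefunctor (functorRR hS))
local notation "G" => Prefunctor.obj (Functor.toPrefunctor (inverseRR hS))

/-- The isomorphism of categories between the reverse of left-left Yetter-Drinfeld modules and
right-right Yetter-Drinfeld modules. -/
def equivRR : MonoidalOpposite (LLYD k H) ≌ RRYD k H :=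
  mopEquivalenceOfEq _ _ (functorRR_inverseRR hS) (inverseRR_functorRR hS)

namespace RRYD

/-- The monoidal structure transported from the reverse of left-left Yetter-Drinfeld modules. -/
abbrev monoidalCategory : MonoidalCategory (RRYD k H) := Monoidal.transport (equivRR hS)

/-- The braiding transported from the reverse of left-left Yetter-Drinfeld modules. -/
abbrev braidedCategory : letI := monoidalCategory hS; BraidedCategory (RRYD k H) :=
  letI := LLYD.braidedCategory hS
  inferInstanceAs (BraidedCategory (Monoidal.Transported (equivRR hS)))

theorem counit_hom (M : RRYD k H) (m : M) :
    (((equivRR hS).counitIso.hom.app M).hom m : M) = m :=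
  have h : (equivRR hS).counitIso.hom.app M =
      eqToHom (Functor.congr_obj (inverseRR_functorRR hS) M) :=
    eqToHom_app (inverseRR_functorRR hS) M
  (congrArg (fun f : F (G M) ⟶ M => f.hom m) h).trans (eq_of_heq
    (RRYD.eqToHom_hom (Functor.congr_obj (inverseRR_functorRR hS) M) m))

/-- The inverse of the unit of the equivalence. -/
def unitInv (X : LLYD k H) : G (F X) ⟶ X := ((equivRR hS).unitIso.inv.app (.mop X)).unmop

/-- The unit of the equivalence. -/
def unitHom (X : LLYD k H) : X ⟶ G (F X) := ((equivRR hS).unitIso.hom.app (.mop X)).unmop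

theorem unitInv_eq (X : LLYD k H) :
    unitInv hS X = eqToHom (Functor.congr_obj (functorRR_inverseRR hS) X) :=
  mopEquivalenceOfEq_unit_inv (functorRR_inverseRR hS) (inverseRR_functorRR hS) X

theorem unitHom_eq (X : LLYD k H) :
    unitHom hS X = eqToHom (Functor.congr_obj (functorRR_inverseRR hS) X).symm :=
  mopEquivalenceOfEq_unit_hom (functorRR_inverseRR hS) (inverseRR_functorRR hS) X

theorem unitInv_hom (X : LLYD k H) (x : G (F X)) : (unitInv hS X).hom x = x := by
  rw [unitInv_eq]
  exact eq_of_heq (LLYD.eqToHom_hom _ x)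

/-- The inclusion of the tensor product, `n ⊠ m ↦ m1₁ ⊗ n1₂`. -/
abbrev tens (M N : RRYD k H) : LLYD.tensor (G N) (G M) →ₗ[k] M ⊗[k] N :=
  (TensorProduct.comm k N M).toLinearMap ∘ₗ TensorT.incl k H (G N) (G M)

theorem tens_smul (M N : RRYD k H) (h : H) (x : LLYD.tensor (G N) (G M)) :
    tens hS M N (T h • x) =
      TensorProduct.map₂ (rAct k H M) (rAct k H N) (Δ h) (tens hS M N x) := by
  refine (congrArg (TensorProduct.comm k N M) (TensorT.incl_smul (M := G N) (N := G M)
    (T h) x)).trans ?_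
  refine (comm_map₂_leftModule M N (T h) _).trans ?_
  rw [antipode_antipodeInv]
  rfl

/-- S(S⁻¹(b)S⁻¹(a)) = ab: the flip of the factors and the reversal by S cancel, leaving m₍₁₎n₍₁₎. -/
theorem coactToRight_codiag (M N : RRYD k H) :
    coactToRight S ((TensorProduct.comm k N M).toLinearMap.lTensor H ∘ₗ
      LLYD.codiag (N.toLL hS) (M.toLL hS) ∘ₗ (TensorProduct.comm k M N).toLinearMap) =
    codiag M N := by
  refine TensorProduct.ext' fun m n => ?_
  change sw ((TensorProduct.comm k N M).toLinearMap.lTensor H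
    (LLYD.codiag (N.toLL hS) (M.toLL hS) (n ⊗ₜ[k] m))) (fun a n => n ⊗ₜ[k] S a) = _
  rw [sw_lTensor _ _ (by fun_prop) (by fun_prop), LLYD.codiag_eq_sw, codiag_eq_sw,
    sw_of_tmul _ _ (by fun_prop) (by fun_prop), sw_of_tmul _ _ (by fun_prop) (by fun_prop),
    sw_coactToLeft _ _ _ (by fun_prop) (by fun_prop), sw_sw _ _ (by fun_prop) (by fun_prop),
    sw_comm]
  refine sw_congr fun n' b => ?_
  rw [sw_coactToLeft _ _ _ (by fun_prop) (by fun_prop), sw_sw _ _ (by fun_prop) (by fun_prop)]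
  refine sw_congr fun m' a => ?_
  rw [sw_of_tmul _ _ (by fun_prop) (by fun_prop), antipode_mul, antipode_antipodeInv,
    antipode_antipodeInv]
  rfl

theorem tens_coact (M N : RRYD k H) :
    (tens hS M N).rTensor H ∘ₗ
      coactToRight S (LLYD.tensorCoact (G N) (G M)) =
    codiag M N ∘ₗ tens hS M N :=
  (coactToRight_comp S
    (LLYD.lTensor_comm_incl_tensorCoact (G N) (G M)).symm).symm.trans
    (congrArg (· ∘ₗ tens hS M N) (coactToRight_codiag hS M N))

theorem tens_hom {M M' N N' : RRYD k H} (f : M ⟶ M') (g : N ⟶ N')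
    (x : LLYD.tensor (G N) (G M)) :
    tens hS M' N' ((LLYD.tensorMap ((inverseRR hS).map g) ((inverseRR hS).map f)).hom x) =
      TensorProduct.map f.hom g.hom (tens hS M N x) := by
  refine (congrArg (TensorProduct.comm k N' M') (TensorT.incl_map ((inverseRR hS).map g).map_act
    ((inverseRR hS).map f).map_act x)).trans ?_
  exact (TensorProduct.map_comm _ _ _).symm

theorem incl_unitInv (X N : LLYD k H) (x : LLYD.tensor N (G (F X))) :
    TensorT.incl k H N X ((LLYD.tensorMap (𝟙 N) (unitInv hS X)).hom x) =
      TensorT.incl k H N (G (F X)) x :=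
  eq_of_heq (LLYD.incl_tensorMap_eqToHom' N (unitInv_eq hS X) x)

theorem incl_unitHom (X N : LLYD k H) (x : LLYD.tensor X N) :
    TensorT.incl k H (G (F X)) N ((LLYD.tensorMap (unitHom hS X) (𝟙 N)).hom x) =
      TensorT.incl k H X N x :=
  eq_of_heq (LLYD.incl_tensorMap_eqToHom N (unitHom_eq hS X) x)

theorem tens_associator (M N P : RRYD k H)
    (x : LLYD.tensor (G P) (G (F (LLYD.tensor (G N) (G M))))) :
    letI := monoidalCategory hS
    (tens hS N P).lTensor M (tens hS M (F (LLYD.tensor (G P) (G N)))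
      ((MonoidalCategory.associator M N P).hom.hom x)) =
    TensorProduct.assoc k M N P ((tens hS M N).rTensor P
      (tens hS (F (LLYD.tensor (G N) (G M))) P x)) := by
  have h₁ := incl_unitInv hS (LLYD.tensor (G N) (G M)) (G P) x
  have h₂ := incl_unitHom hS (LLYD.tensor (G P) (G N)) (G M)
  refine (congrArg (fun y => (tens hS N P).lTensor M
    (TensorProduct.comm k (LLYD.tensor (G P) (G N)) M y)) (h₂ _)).trans ?_
  refine (LLYD.comm_incl_assocIso_inv (G P) (G N) (G M) _).trans ?_
  exact congrArg (fun y => TensorProduct.assoc k M N P ((tens hS M N).rTensor P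
    (TensorProduct.comm k P (LLYD.tensor (G N) (G M)) y))) h₁

theorem incl_of_tens {M N : RRYD k H} {m : M} {n : N}
    {x : LLYD.tensor (G N) (G M)}
    (h : tens hS M N x = balance (rAct k H M) (rAct k H N) (m ⊗ₜ[k] n)) :
    TensorT.incl k H (G N) (G M) x =
      balance (lAct k H (G N)) (lAct k H (G M)) (n ⊗ₜ[k] m) :=
  (TensorProduct.comm k N M).injective
    (h.trans (comm_balance_leftModule M N (n ⊗ₜ[k] m)).symm)

theorem eq_tm_of_tens {M N : RRYD k H} {m : M} {n : N}
    {x : LLYD.tensor (G N) (G M)}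
    (h : tens hS M N x = balance (rAct k H M) (rAct k H N) (m ⊗ₜ[k] n)) :
    x = TensorT.tm k H (M := G N) (N := G M) n m :=
  LLYD.eq_tm_of_incl (incl_of_tens hS h)

/-- Reversal makes it the right unit constraint of left-left modules, ε̄_s(z)m. As a right action
this is mS(ε̄_s(z)) = mε_t(z) = mz, and z = ε̄_t(S(z)). -/
theorem leftUnitor_hom (M : RRYD k H) (z : Target k H) (m : M) :
    letI := monoidalCategory hS
    (MonoidalCategory.leftUnitor M).hom.hom
        (TensorT.tm k H (M := G M) (N := G (F (LLYD.unitObj k H))) m z) =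
      MulOpposite.op (epsTBar k H (unitMap k H z)) • m := by
  have h₁ : (LLYD.tensorMap (𝟙 (G M)) (unitInv hS (LLYD.unitObj k H))).hom
      (TensorT.tm k H (M := G M) (N := G (F (LLYD.unitObj k H))) m z) =
      TensorT.tm k H (M := G M) (N := LLYD.unitObj k H) m z :=
    (LLYD.tensorMap_tm _ _ _ _).trans (congrArg (fun z => TensorT.tm k H (M := G M)
      (N := LLYD.unitObj k H) m z) (unitInv_hom hS (LLYD.unitObj k H) z))
  have h₂ := (congrArg (LLYD.rightUnitIso (G M)).hom.hom h₁).trans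
    (LLYD.rightUnitIso_hom_tm (M := G M) m z)
  refine (counit_hom hS M _).trans (h₂.trans ?_)
  rw [epsTBar_unitMap]
  change MulOpposite.op (S (epsSBar k H (Target.val k H z))) • m = _
  rw [antipode_epsSBar, z.isTarget]

theorem rightUnitor_hom (M : RRYD k H) (m : M) (z : Target k H) :
    letI := monoidalCategory hS
    (MonoidalCategory.rightUnitor M).hom.hom
        (TensorT.tm k H (M := G (F (LLYD.unitObj k H))) (N := G M) z m) =
      MulOpposite.op (unitMap k H z) • m := by
  have h₁ : (LLYD.tensorMap (unitInv hS (LLYD.unitObj k H)) (𝟙 (G M))).hom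
      (TensorT.tm k H (M := G (F (LLYD.unitObj k H))) (N := G M) z m) =
      TensorT.tm k H (M := LLYD.unitObj k H) (N := G M) z m :=
    (LLYD.tensorMap_tm _ _ _ _).trans (congrArg (fun z => TensorT.tm k H
      (M := LLYD.unitObj k H) (N := G M) z m) (unitInv_hom hS (LLYD.unitObj k H) z))
  have h₂ := (congrArg (LLYD.leftUnitIso (G M)).hom.hom h₁).trans
    (LLYD.leftUnitIso_hom_tm (M := G M) z m)
  exact (counit_hom hS M _).trans h₂

/-- The left-left braiding n ⊠ m ↦ n₍₋₁₎m ⊠ n₍₀₎ has n₍₋₁₎ = S⁻¹(n₍₁₎), which acts as right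
multiplication by n₍₁₎. -/
theorem tens_braiding (M N : RRYD k H) (m : M) (n : N)
    (x : LLYD.tensor (G N) (G M))
    (hx : tens hS M N x = balance (rAct k H M) (rAct k H N) (m ⊗ₜ[k] n)) :
    tens hS N M ((LLYD.braidIso hS (G N) (G M)).hom.hom x) =
      ((rAct k H M).flip m).lTensor N (N.coact n) := by
  letI := LLYD.braidedCategory hS
  refine (congrArg (TensorProduct.comm k M N) ((LLYD.standardBraided hS).braiding (G N)
    (G M) n m x (incl_of_tens hS hx))).trans ?_
  refine (congrArg (TensorProduct.comm k M N) (rTensor_eq_sw _ _)).trans ?_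
  change TensorProduct.comm k M N (sw (coactToLeft (T) N.coact n) (fun a n' =>
    (MulOpposite.op (S a) • m) ⊗ₜ[k] n')) = _
  rw [sw_coactToLeft _ _ _ (by fun_prop) (by fun_prop), lTensor_eq_sw, ← LinearEquiv.coe_coe,
    map_sw]
  simp only [antipode_antipodeInv]
  rfl

/-- The braided monoidal structure on right-right Yetter-Drinfeld modules is the standard one. -/
def standardBraided :
    letI := monoidalCategory hS; letI := braidedCategory hS; StandardBraided k H :=
  letI := monoidalCategory hS
  letI := braidedCategory hS
  { tens := fun M N => tens hS M N
    tens_injective := fun M N => (TensorProduct.comm k N M).injective.comp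
      (TensorT.incl_injective k H (G N) (G M))
    range_tens := fun M N => range_comm_incl M N
    tens_act := fun M N h x => tens_smul hS M N h x
    tens_coact := tens_coact hS
    tens_hom := fun f g => LinearMap.ext fun x => tens_hom hS f g x
    unit := unitMap k H
    unit_injective := unitMap_injective hS
    range_unit := range_unitMap
    unit_act := fun h z => unitMap_smul hS h z
    unit_coact := rTensor_unitMap_unitCoact
    associator := fun M N P => LinearMap.ext fun x => tens_associator hS M N P x
    leftUnitor := fun M z m x hx =>
      (congrArg _ (eq_tm_of_tens hS hx)).trans (leftUnitor_hom hS M z m)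
    rightUnitor := fun M m z x hx =>
      (congrArg _ (eq_tm_of_tens hS hx)).trans (rightUnitor_hom hS M m z)
    braiding := fun M N m n x hx => tens_braiding hS M N m n x hx }

end RRYD

end

/-! ### Right-left modules: the transported structure is the standard one -/

section

variable {k : Type u} {H : Type v} [CommRing k] [Ring H] [Algebra k H] [Coalgebra k H]

local notation "Δ" => Coalgebra.comul (R := k) (A := H)
local infixl:70 " ⊠ " => TensorT.tm k H

namespace RLYD

theorem codiag_eq_sw (M N : RLYD k H) (x : M ⊗[k] N) :
    codiag M N x = sw x (fun m n => sw (M.coact m) (fun a m' => sw (N.coact n) (fun b n' =>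
      (b * a) ⊗ₜ[k] (m' ⊗ₜ[k] n')))) := by
  rw [apply_eq_sw (codiag M N)]
  refine sw_congr fun m n => ?_
  exact apply_tmul_eq_sw ((mulRev k H).rTensor (M ⊗[k] N) ∘ₗ
    (TensorProduct.tensorTensorTensorComm k H M H N).toLinearMap) _ _

end RLYD

variable [WeakHopfAlgebra k H]
  (hS : Function.Bijective (WeakHopfAlgebra.antipode (k := k) (H := H)))

local notation "S" => WeakHopfAlgebra.antipode (k := k) (H := H)
local notation "T" => antipodeInv hS
local notation "F" => Prefunctor.obj (Functor.toPrefunctor (functorRL hS))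
local notation "G" => Prefunctor.obj (Functor.toPrefunctor (inverseRL hS))

/-- The isomorphism of categories between the reverse of left-left Yetter-Drinfeld modules and
right-left Yetter-Drinfeld modules. -/
def equivRL : MonoidalOpposite (LLYD k H) ≌ RLYD k H :=
  mopEquivalenceOfEq _ _ (functorRL_inverseRL hS) (inverseRL_functorRL hS)

namespace RLYD

/-- The monoidal structure transported from the reverse of left-left Yetter-Drinfeld modules. -/
abbrev monoidalCategory : MonoidalCategory (RLYD k H) := Monoidal.transport (equivRL hS)

/-- The inverse of the braiding transported from the reverse of left-left Yetter-Drinfeld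
modules. -/
abbrev braidedCategory : letI := monoidalCategory hS; BraidedCategory (RLYD k H) :=
  letI := LLYD.braidedCategory hS
  reverseBraiding (Monoidal.Transported (equivRL hS))

theorem counit_hom (M : RLYD k H) (m : M) :
    (((equivRL hS).counitIso.hom.app M).hom m : M) = m :=
  have h : (equivRL hS).counitIso.hom.app M =
      eqToHom (Functor.congr_obj (inverseRL_functorRL hS) M) :=
    eqToHom_app (inverseRL_functorRL hS) M
  (congrArg (fun f : F (G M) ⟶ M => f.hom m) h).trans (eq_of_heq
    (RLYD.eqToHom_hom (Functor.congr_obj (inverseRL_functorRL hS) M) m))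

/-- The inverse of the unit of the equivalence. -/
def unitInv (X : LLYD k H) : G (F X) ⟶ X := ((equivRL hS).unitIso.inv.app (.mop X)).unmop

/-- The unit of the equivalence. -/
def unitHom (X : LLYD k H) : X ⟶ G (F X) := ((equivRL hS).unitIso.hom.app (.mop X)).unmop

theorem unitInv_eq (X : LLYD k H) :
    unitInv hS X = eqToHom (Functor.congr_obj (functorRL_inverseRL hS) X) :=
  mopEquivalenceOfEq_unit_inv (functorRL_inverseRL hS) (inverseRL_functorRL hS) X

theorem unitHom_eq (X : LLYD k H) :
    unitHom hS X = eqToHom (Functor.congr_obj (functorRL_inverseRL hS) X).symm :=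
  mopEquivalenceOfEq_unit_hom (functorRL_inverseRL hS) (inverseRL_functorRL hS) X

theorem unitInv_hom (X : LLYD k H) (x : G (F X)) : (unitInv hS X).hom x = x := by
  rw [unitInv_eq]
  exact eq_of_heq (LLYD.eqToHom_hom _ x)

/-- The inclusion of the tensor product, `n ⊠ m ↦ m1₁ ⊗ n1₂`. -/
abbrev tens (M N : RLYD k H) : LLYD.tensor (G N) (G M) →ₗ[k] M ⊗[k] N :=
  (TensorProduct.comm k N M).toLinearMap ∘ₗ TensorT.incl k H (G N) (G M)

theorem tens_smul (M N : RLYD k H) (h : H) (x : LLYD.tensor (G N) (G M)) :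
    tens hS M N (T h • x) =
      TensorProduct.map₂ (rAct k H M) (rAct k H N) (Δ h) (tens hS M N x) := by
  refine (congrArg (TensorProduct.comm k N M) (TensorT.incl_smul (M := G N) (N := G M)
    (T h) x)).trans ?_
  refine (comm_map₂_leftModule M N (T h) _).trans ?_
  rw [antipode_antipodeInv]
  rfl

/-- The coaction is not twisted, so the flip of the factors alone gives n₍₋₁₎m₍₋₁₎. -/
theorem lTensor_comm_codiag (M N : RLYD k H) :
    (TensorProduct.comm k N M).toLinearMap.lTensor H ∘ₗ
      LLYD.codiag (N.toLL hS) (M.toLL hS) ∘ₗ (TensorProduct.comm k M N).toLinearMap =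
    codiag M N := by
  refine TensorProduct.ext' fun m n => ?_
  change (TensorProduct.comm k N M).toLinearMap.lTensor H
    (LLYD.codiag (N.toLL hS) (M.toLL hS) (n ⊗ₜ[k] m)) = _
  rw [lTensor_eq_sw, LLYD.codiag_eq_sw, codiag_eq_sw,
    sw_of_tmul _ _ (by fun_prop) (by fun_prop), sw_of_tmul _ _ (by fun_prop) (by fun_prop),
    sw_sw _ _ (by fun_prop) (by fun_prop), sw_comm]
  refine sw_congr fun b n' => ?_
  rw [sw_sw _ _ (by fun_prop) (by fun_prop)]
  refine sw_congr fun a m' => ?_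
  rw [sw_of_tmul _ _ (by fun_prop) (by fun_prop)]
  rfl

theorem tens_coact (M N : RLYD k H) :
    (tens hS M N).lTensor H ∘ₗ LLYD.tensorCoact (G N) (G M) = codiag M N ∘ₗ tens hS M N :=
  (LLYD.lTensor_comm_incl_tensorCoact (G N) (G M)).trans
    (congrArg (· ∘ₗ tens hS M N) (lTensor_comm_codiag hS M N))

theorem tens_hom {M M' N N' : RLYD k H} (f : M ⟶ M') (g : N ⟶ N')
    (x : LLYD.tensor (G N) (G M)) :
    tens hS M' N' ((LLYD.tensorMap ((inverseRL hS).map g) ((inverseRL hS).map f)).hom x) =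
      TensorProduct.map f.hom g.hom (tens hS M N x) := by
  refine (congrArg (TensorProduct.comm k N' M') (TensorT.incl_map ((inverseRL hS).map g).map_act
    ((inverseRL hS).map f).map_act x)).trans ?_
  exact (TensorProduct.map_comm _ _ _).symm

theorem incl_unitInv (X N : LLYD k H) (x : LLYD.tensor N (G (F X))) :
    TensorT.incl k H N X ((LLYD.tensorMap (𝟙 N) (unitInv hS X)).hom x) =
      TensorT.incl k H N (G (F X)) x :=
  eq_of_heq (LLYD.incl_tensorMap_eqToHom' N (unitInv_eq hS X) x)

theorem incl_unitHom (X N : LLYD k H) (x : LLYD.tensor X N) :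
    TensorT.incl k H (G (F X)) N ((LLYD.tensorMap (unitHom hS X) (𝟙 N)).hom x) =
      TensorT.incl k H X N x :=
  eq_of_heq (LLYD.incl_tensorMap_eqToHom N (unitHom_eq hS X) x)

theorem tens_associator (M N P : RLYD k H)
    (x : LLYD.tensor (G P) (G (F (LLYD.tensor (G N) (G M))))) :
    letI := monoidalCategory hS
    (tens hS N P).lTensor M (tens hS M (F (LLYD.tensor (G P) (G N)))
      ((MonoidalCategory.associator M N P).hom.hom x)) =
    TensorProduct.assoc k M N P ((tens hS M N).rTensor P
      (tens hS (F (LLYD.tensor (G N) (G M))) P x)) := by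
  have h₁ := incl_unitInv hS (LLYD.tensor (G N) (G M)) (G P) x
  have h₂ := incl_unitHom hS (LLYD.tensor (G P) (G N)) (G M)
  refine (congrArg (fun y => (tens hS N P).lTensor M
    (TensorProduct.comm k (LLYD.tensor (G P) (G N)) M y)) (h₂ _)).trans ?_
  refine (LLYD.comm_incl_assocIso_inv (G P) (G N) (G M) _).trans ?_
  exact congrArg (fun y => TensorProduct.assoc k M N P ((tens hS M N).rTensor P
    (TensorProduct.comm k P (LLYD.tensor (G N) (G M)) y))) h₁

theorem incl_of_tens {M N : RLYD k H} {m : M} {n : N}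
    {x : LLYD.tensor (G N) (G M)}
    (h : tens hS M N x = balance (rAct k H M) (rAct k H N) (m ⊗ₜ[k] n)) :
    TensorT.incl k H (G N) (G M) x =
      balance (lAct k H (G N)) (lAct k H (G M)) (n ⊗ₜ[k] m) :=
  (TensorProduct.comm k N M).injective
    (h.trans (comm_balance_leftModule M N (n ⊗ₜ[k] m)).symm)

theorem eq_tm_of_tens {M N : RLYD k H} {m : M} {n : N}
    {x : LLYD.tensor (G N) (G M)}
    (h : tens hS M N x = balance (rAct k H M) (rAct k H N) (m ⊗ₜ[k] n)) :
    x = TensorT.tm k H (M := G N) (N := G M) n m :=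
  LLYD.eq_tm_of_incl (incl_of_tens hS h)

theorem leftUnitor_hom (M : RLYD k H) (z : Target k H) (m : M) :
    letI := monoidalCategory hS
    (MonoidalCategory.leftUnitor M).hom.hom
        (TensorT.tm k H (M := G M) (N := G (F (LLYD.unitObj k H))) m z) =
      MulOpposite.op (epsTBar k H (unitMap k H z)) • m := by
  have h₁ : (LLYD.tensorMap (𝟙 (G M)) (unitInv hS (LLYD.unitObj k H))).hom
      (TensorT.tm k H (M := G M) (N := G (F (LLYD.unitObj k H))) m z) =
      TensorT.tm k H (M := G M) (N := LLYD.unitObj k H) m z :=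
    (LLYD.tensorMap_tm _ _ _ _).trans (congrArg (fun z => TensorT.tm k H (M := G M)
      (N := LLYD.unitObj k H) m z) (unitInv_hom hS (LLYD.unitObj k H) z))
  have h₂ := (congrArg (LLYD.rightUnitIso (G M)).hom.hom h₁).trans
    (LLYD.rightUnitIso_hom_tm (M := G M) m z)
  refine (counit_hom hS M _).trans (h₂.trans ?_)
  rw [epsTBar_unitMap]
  change MulOpposite.op (S (epsSBar k H (Target.val k H z))) • m = _
  rw [antipode_epsSBar, z.isTarget]

theorem rightUnitor_hom (M : RLYD k H) (m : M) (z : Target k H) :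
    letI := monoidalCategory hS
    (MonoidalCategory.rightUnitor M).hom.hom
        (TensorT.tm k H (M := G (F (LLYD.unitObj k H))) (N := G M) z m) =
      MulOpposite.op (unitMap k H z) • m := by
  have h₁ : (LLYD.tensorMap (unitInv hS (LLYD.unitObj k H)) (𝟙 (G M))).hom
      (TensorT.tm k H (M := G (F (LLYD.unitObj k H))) (N := G M) z m) =
      TensorT.tm k H (M := LLYD.unitObj k H) (N := G M) z m :=
    (LLYD.tensorMap_tm _ _ _ _).trans (congrArg (fun z => TensorT.tm k H
      (M := LLYD.unitObj k H) (N := G M) z m) (unitInv_hom hS (LLYD.unitObj k H) z))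
  have h₂ := (congrArg (LLYD.leftUnitIso (G M)).hom.hom h₁).trans
    (LLYD.leftUnitIso_hom_tm (M := G M) z m)
  exact (counit_hom hS M _).trans h₂

theorem tens_tm (M N : RLYD k H) (m : M) (n : N) :
    tens hS M N (TensorT.tm k H (M := G N) (N := G M) n m) =
      sw (Δ 1) (fun a b => (MulOpposite.op a • m) ⊗ₜ[k] (MulOpposite.op b • n)) := by
  refine (comm_balance_leftModule M N (n ⊗ₜ[k] m)).trans ?_
  refine (map₂_eq_sw _ _ _ _).trans (sw_congr fun a b => ?_)
  exact sw_of_tmul (f := fun m n => (MulOpposite.op a • m) ⊗ₜ[k] (MulOpposite.op b • n)) _ _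
    (by fun_prop) (by fun_prop)

/-- The inverse left-left braiding yields m₍₀₎ ⊠ S⁻¹(m₍₋₁₎)n, where S⁻¹(m₍₋₁₎) acts as right
multiplication by m₍₋₁₎; the coaction of m absorbs the Δ(1). -/
theorem tens_braiding (M N : RLYD k H) (m : M) (n : N) :
    tens hS N M (LLYD.braidInvFun (M := G M) (N := G N) hS
      (TensorT.tm k H (M := G N) (N := G M) n m)) =
      ((rAct k H N).flip n).rTensor M (M.coact m) := by
  rw [rTensor_eq_sw]
  refine (congrArg (tens hS N M)
    (LLYD.braidInvFun_tm (M := G M) (N := G N) hS m n)).trans ((map_sw _ _ _).trans ?_)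
  calc _ = sw (M.coact m) (fun c m' => tens hS N M (TensorT.tm k H (M := G M) (N := G N) m'
          (MulOpposite.op (S (T c)) • n))) := rfl
    _ = sw (M.coact m) (fun c m' => sw (Δ 1) (fun a b =>
          (MulOpposite.op (c * a) • n) ⊗ₜ[k] (MulOpposite.op b • m'))) := by
        refine sw_congr fun c m' => (tens_tm hS N M _ m').trans (sw_congr fun a b => ?_)
        rw [antipode_antipodeInv, smul_smul, MulOpposite.op_mul]
    _ = _ := by
        rw [sw_comm]
        exact M.sw_coact_one (f := fun c m' => (MulOpposite.op c • n) ⊗ₜ[k] m') _ (by fun_prop)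
          (by fun_prop)

/-- The braided monoidal structure on right-left Yetter-Drinfeld modules is the standard one. -/
def standardBraided :
    letI := monoidalCategory hS; letI := braidedCategory hS; StandardBraided k H :=
  letI := monoidalCategory hS
  letI := braidedCategory hS
  { tens := fun M N => tens hS M N
    tens_injective := fun M N => (TensorProduct.comm k N M).injective.comp
      (TensorT.incl_injective k H (G N) (G M))
    range_tens := fun M N => range_comm_incl M N
    tens_act := fun M N h x => tens_smul hS M N h x
    tens_coact := tens_coact hS
    tens_hom := fun f g => LinearMap.ext fun x => tens_hom hS f g x
    unit := unitMap k H
    unit_injective := unitMap_injective hS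
    range_unit := range_unitMap
    unit_act := fun h z => unitMap_smul hS h z
    unit_coact := lTensor_unitMap_unitCoact
    associator := fun M N P => LinearMap.ext fun x => tens_associator hS M N P x
    leftUnitor := fun M z m x hx =>
      (congrArg _ (eq_tm_of_tens hS hx)).trans (leftUnitor_hom hS M z m)
    rightUnitor := fun M m z x hx =>
      (congrArg _ (eq_tm_of_tens hS hx)).trans (rightUnitor_hom hS M m z)
    braiding := fun M N m n x hx =>
      (congrArg (fun x => tens hS N M (LLYD.braidInvFun (M := G M) (N := G N) hS x))
        (eq_tm_of_tens hS hx)).trans (tens_braiding hS M N m n) }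

end RLYD

end

/-! ### The isomorphisms of braided monoidal categories -/

namespace BraidedIsomorphic

universe v₁ v₂ v₃ u₁ u₂ u₃

variable {C : Type u₁} [Category.{v₁} C] [MonoidalCategory C] [BraidedCategory C]
  {D : Type u₂} [Category.{v₂} D]

theorem trans [MonoidalCategory D] [BraidedCategory D] {E : Type u₃} [Category.{v₃} E]
    [MonoidalCategory E] [BraidedCategory E] (h : BraidedIsomorphic C D)
    (h' : BraidedIsomorphic D E) : BraidedIsomorphic C E := by
  obtain ⟨F, G, _, h₁, h₂⟩ := h
  obtain ⟨F', G', _, h₁', h₂'⟩ := h'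
  refine ⟨F ⋙ F', G' ⋙ G, inferInstance, ?_, ?_⟩
  · exact (congrArg (fun K => F ⋙ K ⋙ G) h₁').trans h₁
  · exact (congrArg (fun K => G' ⋙ K ⋙ F') h₂).trans h₂'

-- In a braided category the identity functor to the reversed category is braided monoidal, the
-- tensor comparison being the braiding itself.
variable (C) in
theorem mop : BraidedIsomorphic C (MonoidalOpposite C) :=
  ⟨mopFunctor C, unmopFunctor C, inferInstance, rfl, rfl⟩

variable (C) in
theorem unmop : BraidedIsomorphic (MonoidalOpposite C) C :=
  ⟨unmopFunctor C, mopFunctor C, inferInstance, rfl, rfl⟩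

variable {F : C ⥤ D} {G : D ⥤ C} (h : F ⋙ G = 𝟭 C) (h' : G ⋙ F = 𝟭 D)

/-- `BraidedIsomorphic` records a braided structure on one functor only, so the opposite direction
is stated separately below instead of being deduced by symmetry. -/
theorem transported : BraidedIsomorphic C (Monoidal.Transported (equivalenceOfEq F G h h')) :=
  ⟨(Monoidal.equivalenceTransported (equivalenceOfEq F G h h')).functor,
    (Monoidal.equivalenceTransported (equivalenceOfEq F G h h')).inverse, inferInstance, h, h'⟩

theorem of_transported : BraidedIsomorphic (Monoidal.Transported (equivalenceOfEq F G h h')) C :=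
  ⟨(Monoidal.equivalenceTransported (equivalenceOfEq F G h h')).inverse,
    (Monoidal.equivalenceTransported (equivalenceOfEq F G h h')).functor, inferInstance, h', h⟩

end BraidedIsomorphic

section

variable {k : Type u} {H : Type v} [CommRing k] [Ring H] [Algebra k H] [Coalgebra k H]
  [WeakHopfAlgebra k H]
  (hS : Function.Bijective (WeakHopfAlgebra.antipode (k := k) (H := H)))

/-- The left-right braiding is the inverse of the transported one, so passing to the inverse
braiding gives back the transported one definitionally. -/
theorem braidedIsomorphic_inverseBraided_LRYD :
    letI := LLYD.braidedCategory hS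
    letI := LRYD.monoidalCategory hS; letI := LRYD.braidedCategory hS
    BraidedIsomorphic (LLYD k H) (InverseBraided (LRYD k H)) :=
  letI := LLYD.braidedCategory hS
  BraidedIsomorphic.transported (functorLR_inverseLR hS) (inverseLR_functorLR hS)

theorem inverseBraided_LRYD_braidedIsomorphic :
    letI := LLYD.braidedCategory hS
    letI := LRYD.monoidalCategory hS; letI := LRYD.braidedCategory hS
    BraidedIsomorphic (InverseBraided (LRYD k H)) (LLYD k H) :=
  letI := LLYD.braidedCategory hS
  BraidedIsomorphic.of_transported (functorLR_inverseLR hS) (inverseLR_functorLR hS)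

theorem braidedIsomorphic_mop_RRYD :
    letI := LLYD.braidedCategory hS
    letI := RRYD.monoidalCategory hS; letI := RRYD.braidedCategory hS
    BraidedIsomorphic (LLYD k H) (MonoidalOpposite (RRYD k H)) :=
  letI := LLYD.braidedCategory hS
  letI := RRYD.monoidalCategory hS
  letI := RRYD.braidedCategory hS
  have h : BraidedIsomorphic (MonoidalOpposite (LLYD k H)) (RRYD k H) :=
    BraidedIsomorphic.transported (unmopFunctor_comp_eq (functorRR_inverseRR hS))
      (inverseRR_functorRR hS)
  -- Transport compares the reverse of `LLYD` with `RRYD`. Composing with the identification of a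
  -- braided category with its reverse at both ends moves the reversal to `RRYD`.
  ((BraidedIsomorphic.mop _).trans h).trans (BraidedIsomorphic.mop _)

theorem mop_RRYD_braidedIsomorphic :
    letI := LLYD.braidedCategory hS
    letI := RRYD.monoidalCategory hS; letI := RRYD.braidedCategory hS
    BraidedIsomorphic (MonoidalOpposite (RRYD k H)) (LLYD k H) :=
  letI := LLYD.braidedCategory hS
  letI := RRYD.monoidalCategory hS
  letI := RRYD.braidedCategory hS
  have h : BraidedIsomorphic (RRYD k H) (MonoidalOpposite (LLYD k H)) :=
    BraidedIsomorphic.of_transported (unmopFunctor_comp_eq (functorRR_inverseRR hS))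
      (inverseRR_functorRR hS)
  ((BraidedIsomorphic.unmop _).trans h).trans (BraidedIsomorphic.unmop _)

theorem braidedIsomorphic_inverseBraided_mop_RLYD :
    letI := LLYD.braidedCategory hS
    letI := RLYD.monoidalCategory hS; letI := RLYD.braidedCategory hS
    BraidedIsomorphic (LLYD k H) (InverseBraided (MonoidalOpposite (RLYD k H))) :=
  letI := LLYD.braidedCategory hS
  letI := RLYD.monoidalCategory hS
  letI := RLYD.braidedCategory hS
  have h := BraidedIsomorphic.transported (unmopFunctor_comp_eq (functorRL_inverseRL hS))
      (inverseRL_functorRL hS)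
  -- Inverting and reversing the braiding commute definitionally, so the inverse built into the
  -- right-left braiding cancels the one in the target.
  ((BraidedIsomorphic.mop _).trans h).trans (BraidedIsomorphic.mop _)

end

end WeakHopf

end

theorem theorem2p10 {k : Type u} {H : Type v} [CommRing k] [Ring H] [Algebra k H]
    [Coalgebra k H] [WeakHopf.WeakHopfAlgebra k H]
    (hS : Function.Bijective (WeakHopf.WeakHopfAlgebra.antipode (k := k) (H := H))) :
    ∃ (_ : MonoidalCategory (WeakHopf.LLYD k H)) (_ : BraidedCategory (WeakHopf.LLYD k H))
      (_ : MonoidalCategory (WeakHopf.LRYD k H)) (_ : BraidedCategory (WeakHopf.LRYD k H))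
      (_ : MonoidalCategory (WeakHopf.RRYD k H)) (_ : BraidedCategory (WeakHopf.RRYD k H))
      (_ : MonoidalCategory (WeakHopf.RLYD k H)) (_ : BraidedCategory (WeakHopf.RLYD k H)),
      (Nonempty (WeakHopf.LLYD.StandardBraided k H) ∧
        Nonempty (WeakHopf.LRYD.StandardBraided k H) ∧
        Nonempty (WeakHopf.RRYD.StandardBraided k H) ∧
        Nonempty (WeakHopf.RLYD.StandardBraided k H)) ∧
      WeakHopf.BraidedIsomorphic (WeakHopf.LLYD k H)
        (WeakHopf.InverseBraided (WeakHopf.LRYD k H)) ∧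
      WeakHopf.BraidedIsomorphic (WeakHopf.InverseBraided (WeakHopf.LRYD k H))
        (MonoidalOpposite (WeakHopf.RRYD k H)) ∧
      WeakHopf.BraidedIsomorphic (MonoidalOpposite (WeakHopf.RRYD k H))
        (WeakHopf.InverseBraided (MonoidalOpposite (WeakHopf.RLYD k H))) := by
  let _ := WeakHopf.LLYD.braidedCategory hS
  let _ := WeakHopf.LRYD.monoidalCategory hS
  let _ := WeakHopf.LRYD.braidedCategory hS
  let _ := WeakHopf.RRYD.monoidalCategory hS
  let _ := WeakHopf.RRYD.braidedCategory hS
  let _ := WeakHopf.RLYD.monoidalCategory hS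
  let _ := WeakHopf.RLYD.braidedCategory hS
  exact ⟨inferInstance, WeakHopf.LLYD.braidedCategory hS,
    WeakHopf.LRYD.monoidalCategory hS, WeakHopf.LRYD.braidedCategory hS,
    WeakHopf.RRYD.monoidalCategory hS, WeakHopf.RRYD.braidedCategory hS,
    WeakHopf.RLYD.monoidalCategory hS, WeakHopf.RLYD.braidedCategory hS,
    ⟨⟨WeakHopf.LLYD.standardBraided hS⟩, ⟨WeakHopf.LRYD.standardBraided hS⟩,
      ⟨WeakHopf.RRYD.standardBraided hS⟩, ⟨WeakHopf.RLYD.standardBraided hS⟩⟩,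
    WeakHopf.braidedIsomorphic_inverseBraided_LRYD hS,
    (WeakHopf.inverseBraided_LRYD_braidedIsomorphic hS).trans
      (WeakHopf.braidedIsomorphic_mop_RRYD hS),
    (WeakHopf.mop_RRYD_braidedIsomorphic hS).trans
      (WeakHopf.braidedIsomorphic_inverseBraided_mop_RLYD hS)⟩
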